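/- Let $F=\mathbb R$ or $\mathbb C$, let $1\le k_1\le k$, and let $G=\mathrm{Sp}(k,F)$ be the group of symplectic $2k\times 2k$ matrices over $F$. Let $P=MU$ be the standard maximal parabolic subgroup of $G$ with Levi factor $M\cong \mathrm{GL}(k_1,F)\times \mathrm{Sp}(k-k_1,F)$ and unipotent radical $U$, let $\overline P={}^tP=M\overline U$ with $\overline U={}^tU$, let $\delta_P$, $\delta_{\overline P}$ be the modules of $P$ and $\overline P$ (so $\delta_P(m)=|\det(\mathrm{Ad}(m)|_{\mathrm{Lie}\,U})|$, a real determinant), and let $K$ be the standard maximal compact subgroup of $G$ (the unitary matrices in $G$). Let $\sigma$ be an irreducible smooth admissible representation of $M$ on a complete Hausdorff locally convex space $V$ (for instance $\sigma=\sigma_1\otimes\sigma_2$ with $\sigma_1$, $\sigma_2$ irreducible smooth admissible representations of $\mathrm{GL}(k_1,F)$ and $\mathrm{Sp}(k-k_1,F)$). Let $\mathrm{Ind}_P^G(\sigma)$ be the space of smooth $f:G\to V$ with $f(umg)=\delta_P(m)^{1/2}\sigma(m)f(g)$ for $u\in U$, $m\in M$, and define $\mathrm{Ind}_{\overline P}^G(\sigma)$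 in the same way with $\overline U$, $\delta_{\overline P}$. Assume that the intertwining integral $$J(f)(g)=\int_{\overline U}f(\bar u g)\,d\bar u$$ (paired with the $K\cap M$-finite vectors of the contragredient of $\sigma$) converges absolutely and defines an operator $J:\mathrm{Ind}_P^G(\sigma)\to \mathrm{Ind}_{\overline P}^G(\sigma)$, and let $\pi$ be the representation of $G$ by right translation on the image of $J$. By a coefficient of a representation we mean a finite $\mathbb C$-linear combination of its matrix coefficients $g\mapsto\langle\rho(g)v,\lambda\rangle$, $\lambda$ a continuous linear functional, and by a $K$-finite coefficient one in which all the vectors $v$ and functionals $\lambda$ can be taken $K$-finite. Let $H:G\times G\to\mathbb C$ be a function such that 1. $H(u_1mg_1,\bar u_2mg_2)=H(g_1,g_2)$ for all $u_1\in U$, $\bar u_2\in\overline U$, $m\in M$, $g_1,g_2\in G$; 2. for all $g_1,g_2\in G$ the function $m\mapsto H(mg_1,g_2)$ on $M$ is a coefficient of $\sigma\otimes\delta_P^{1/2}$; 3. $H$ is $C^\infty$, and its right translates by $K\times K$ span a finite-dimensional space. Let $dh$ be a non-zero right $G$-invariant Radon measure on $M\backslash G$, and $d\bar u$, $dk$ Haar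 measures on $\overline U$, $K$. Then for every $g\in G$ the two integrals in $$f(g)=\int_{M\backslash G}H(hg,h)\,dh=c\int_{\overline U\times K}H(\bar ukg,k)\,d\bar u\,dk$$ converge absolutely and the equality holds, where $c>0$ depends only on the normalisations of the measures (not on $H$ or $g$); and $f$ is a $K$-finite coefficient of $\pi$. -/

import Mathlib

open MeasureTheory Matrix Topology
open scoped ContDiff

noncomputable section

namespace SpCoeff

/-! ### The group `Sp(k, F)` and its subgroups, `F = ℝ` or `ℂ` -/

/-- `Sp(k, F)`, realised by `2k × 2k` matrices preserving the standard alternating form. -/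
abbrev Sp (k : ℕ) (F : Type*) [RCLike F] : Type _ := ↥(Matrix.symplecticGroup (Fin k) F)

instance instMeasurableSpaceSp (k : ℕ) (F : Type*) [RCLike F] : MeasurableSpace (Sp k F) :=
  borel _

instance instBorelSpaceSp (k : ℕ) (F : Type*) [RCLike F] : BorelSpace (Sp k F) := ⟨rfl⟩

/-- The weight of a coordinate: among the standard basis `e_1, …, e_k, e_1', …, e_k'` of `F^{2k}`,
the vectors `e_1, …, e_{k₁}` have weight `1`, the vectors `e_1', …, e_{k₁}'` have weight `-1`, and
all others have weight `0`. -/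
def wt (k k₁ : ℕ) : Fin k ⊕ Fin k → ℤ
  | Sum.inl i => if (i : ℕ) < k₁ then 1 else 0
  | Sum.inr i => if (i : ℕ) < k₁ then -1 else 0

theorem wt_swap (k k₁ : ℕ) (i : Fin k ⊕ Fin k) : wt k k₁ i.swap = - wt k k₁ i := by
  rcases i with i | i <;> simp only [wt, Sum.swap_inl, Sum.swap_inr] <;> split_ifs <;> simp

section Groups

variable {k : ℕ} {F : Type*} [RCLike F]

/-- The matrix of an element of `Sp(k, F)`. -/
abbrev mat (g : Sp k F) : Matrix (Fin k ⊕ Fin k) (Fin k ⊕ Fin k) F := g.1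

theorem mat_one : mat (1 : Sp k F) = 1 := rfl

theorem mat_mul (g h : Sp k F) : mat (g * h) = mat g * mat h := rfl

theorem mat_inv (g : Sp k F) : mat g⁻¹ = -Matrix.J (Fin k) F * (mat g)ᵀ * Matrix.J (Fin k) F := rfl

/-- Up to sign, the `(i, j)` entry of `g⁻¹` is the `(j', i')` entry of `g`. -/
theorem inv_entry (g : Sp k F) (i j : Fin k ⊕ Fin k) :
    mat g⁻¹ i j =
      (if i.isLeft = j.isLeft then 1 else -1) * mat g j.swap i.swap := by
  rw [mat_inv]
  rcases i with i | i <;> rcases j with j | j <;>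
    simp [Matrix.mul_apply, Matrix.J, Fintype.sum_sum_type, Matrix.one_apply]

/-- The Levi subgroup `M_{k₁} ≅ GL(k₁, F) × Sp(k - k₁, F)`: the matrices that are block diagonal
with respect to the weight decomposition of `F^{2k}`. -/
def levi (k k₁ : ℕ) (F : Type*) [RCLike F] : Subgroup (Sp k F) where
  carrier := {g | ∀ i j, wt k k₁ i ≠ wt k k₁ j → mat g i j = 0}
  one_mem' := by
    intro i j h
    rw [mat_one, Matrix.one_apply_ne fun e => h (by rw [e])]
  mul_mem' := by
    intro a b ha hb i j h
    rw [mat_mul, Matrix.mul_apply]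
    refine Finset.sum_eq_zero fun x _ => ?_
    by_cases h1 : wt k k₁ i = wt k k₁ x
    · rw [hb x j (by rwa [← h1]), mul_zero]
    · rw [ha i x h1, zero_mul]
  inv_mem' := by
    intro g hg i j h
    rw [inv_entry, hg _ _ (by rw [wt_swap, wt_swap]; intro e; exact h (by linarith)), mul_zero]

/-- For `s = 1` this is the unipotent radical `U_{k₁}` of the standard parabolic subgroup
`P_{k₁}` (the stabiliser of the span of `e_1, …, e_{k₁}`): the `u` for which `u - 1` strictly raises
weights. For `s = -1` it is the transposed group `Ū_{k₁}`. -/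
def unip (k k₁ : ℕ) (F : Type*) [RCLike F] (s : ℤ) : Subgroup (Sp k F) where
  carrier := {g | ∀ i j, s * wt k k₁ i ≤ s * wt k k₁ j →
    mat g i j = (1 : Matrix _ _ F) i j}
  one_mem' := fun i j _ => rfl
  mul_mem' := by
    intro a b ha hb i j h
    have key : ∀ x, mat a i x * mat b x j =
        (1 : Matrix _ _ F) i x * (1 : Matrix _ _ F) x j := by
      intro x
      by_cases h1 : s * wt k k₁ i ≤ s * wt k k₁ x
      · by_cases h2 : s * wt k k₁ x ≤ s * wt k k₁ j
        · rw [ha _ _ h1, hb _ _ h2]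
        · have hix : i ≠ x := by rintro rfl; exact h2 h
          rw [ha _ _ h1, Matrix.one_apply_ne hix, zero_mul, zero_mul]
      · have h2 : s * wt k k₁ x ≤ s * wt k k₁ j := by omega
        have hxj : x ≠ j := by rintro rfl; exact h1 h
        rw [hb _ _ h2, Matrix.one_apply_ne hxj, mul_zero, mul_zero]
    rw [mat_mul, Matrix.mul_apply]
    rw [Finset.sum_congr rfl fun x _ => key x, ← Matrix.mul_apply, Matrix.one_mul]
  inv_mem' := by
    intro g hg i j h
    rw [inv_entry, hg _ _ (by rw [wt_swap, wt_swap]; linarith)]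
    by_cases e : i = j
    · subst e; simp
    · have : j.swap ≠ i.swap := fun e' => e (Sum.swap_leftInverse.injective e').symm
      rw [Matrix.one_apply_ne this, Matrix.one_apply_ne e, mul_zero]

/-- The standard maximal compact subgroup of `Sp(k, F)`: the unitary matrices in it. -/
def maxCompact (k : ℕ) (F : Type*) [RCLike F] : Subgroup (Sp k F) where
  carrier := {g | mat g ∈ Matrix.unitaryGroup (Fin k ⊕ Fin k) F}
  one_mem' := (Matrix.unitaryGroup (Fin k ⊕ Fin k) F).one_mem
  mul_mem' := fun ha hb => (Matrix.unitaryGroup (Fin k ⊕ Fin k) F).mul_mem ha hb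
  inv_mem' := by
    intro g hg
    have h : mat g⁻¹ = star (mat g) := by
      refine (SymplecticGroup.coe_inv' g).trans ?_
      exact Matrix.inv_eq_left_inv (Matrix.mem_unitaryGroup_iff'.mp hg)
    change mat g⁻¹ ∈ Matrix.unitaryGroup (Fin k ⊕ Fin k) F
    rw [h]
    exact Unitary.star_mem hg

/-- The Lie algebra of `unip k k₁ F s`, as a real vector space of matrices. -/
def nilrad (k k₁ : ℕ) (F : Type*) [RCLike F] (s : ℤ) :
    Submodule ℝ (Matrix (Fin k ⊕ Fin k) (Fin k ⊕ Fin k) F) where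
  carrier := {X | X * Matrix.J (Fin k) F + Matrix.J (Fin k) F * Xᵀ = 0 ∧
    ∀ i j, s * wt k k₁ i ≤ s * wt k k₁ j → X i j = 0}
  zero_mem' := by simp
  add_mem' := by
    rintro X Y ⟨hX, hX'⟩ ⟨hY, hY'⟩
    refine ⟨?_, fun i j h => by simp [hX' i j h, hY' i j h]⟩
    rw [Matrix.transpose_add, Matrix.add_mul, Matrix.mul_add, add_add_add_comm, hX, hY, add_zero]
  smul_mem' := by
    rintro c X ⟨hX, hX'⟩
    refine ⟨?_, fun i j h => by simp [hX' i j h]⟩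
    rw [Matrix.transpose_smul, Matrix.smul_mul, Matrix.mul_smul, ← smul_add, hX, smul_zero]

/-- Conjugation `X ↦ m X m⁻¹` on matrices. -/
def conjBy (g : Sp k F) :
    Matrix (Fin k ⊕ Fin k) (Fin k ⊕ Fin k) F →ₗ[ℝ] Matrix (Fin k ⊕ Fin k) (Fin k ⊕ Fin k) F where
  toFun X := mat g * X * mat g⁻¹
  map_add' X Y := by rw [Matrix.mul_add, Matrix.add_mul]
  map_smul' c X := by rw [Matrix.mul_smul, Matrix.smul_mul, RingHom.id_apply]

theorem conj_mem_nilrad {k₁ : ℕ} (s : ℤ) (m : levi k k₁ F) :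
    ∀ X ∈ nilrad k k₁ F s, conjBy (m : Sp k F) X ∈ nilrad k k₁ F s := by
  rintro X ⟨hX, hX'⟩
  have hm := m.2
  have hm' := (m⁻¹).2
  generalize (m : Sp k F) = g at hm hm' ⊢
  refine ⟨?_, fun i j h => ?_⟩
  · have h1 : mat g * Matrix.J (Fin k) F * (mat g)ᵀ = Matrix.J (Fin k) F :=
      SymplecticGroup.mem_iff.mp g.2
    have h2 : mat g⁻¹ * mat g = 1 := by
      rw [← mat_mul, inv_mul_cancel, mat_one]
    have h3 : mat g⁻¹ * Matrix.J (Fin k) F =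
        Matrix.J (Fin k) F * (mat g)ᵀ := by
      conv_lhs => rw [← h1]
      rw [Matrix.mul_assoc (mat g), ← Matrix.mul_assoc, h2, Matrix.one_mul]
    have h4 : Matrix.J (Fin k) F * (mat g⁻¹)ᵀ =
        mat g * Matrix.J (Fin k) F := by
      conv_lhs => rw [← h1]
      rw [Matrix.mul_assoc, ← Matrix.transpose_mul, h2, Matrix.transpose_one, Matrix.mul_one]
    change mat g * X * mat g⁻¹ * Matrix.J (Fin k) F +
      Matrix.J (Fin k) F * (mat g * X * mat g⁻¹)ᵀ = 0
    rw [Matrix.transpose_mul, Matrix.transpose_mul, ← Matrix.mul_assoc (Matrix.J (Fin k) F), h4,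
      Matrix.mul_assoc _ _ (Matrix.J (Fin k) F), h3]
    have : mat g * (X * Matrix.J (Fin k) F + Matrix.J (Fin k) F * Xᵀ) *
        (mat g)ᵀ = 0 := by rw [hX, Matrix.mul_zero, Matrix.zero_mul]
    rw [← this]
    simp only [Matrix.mul_add, Matrix.add_mul, Matrix.mul_assoc]
  · change (mat g * X * mat g⁻¹) i j = 0
    rw [Matrix.mul_apply]
    refine Finset.sum_eq_zero fun b _ => ?_
    by_cases hb : wt k k₁ b = wt k k₁ j
    · rw [Matrix.mul_apply, Finset.sum_eq_zero, zero_mul]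
      intro a _
      by_cases ha : wt k k₁ i = wt k k₁ a
      · rw [hX' a b (by rw [← ha, hb]; exact h), mul_zero]
      · rw [hm i a ha, zero_mul]
    · have : mat g⁻¹ b j = 0 :=
        (levi k k₁ F).inv_mem hm b j hb
      rw [this, mul_zero]

/-- The module `δ_P(m) = |det (Ad m | Lie U)|` (real determinant) of `P_{k₁}` for `s = 1`, and of
the opposite parabolic subgroup for `s = -1`. -/
def modulus (k k₁ : ℕ) (F : Type*) [RCLike F] (s : ℤ) (m : levi k k₁ F) : ℝ :=
  |LinearMap.det ((conjBy (m : Sp k F)).restrict (conj_mem_nilrad s m))|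

end Groups

/-! ### Smooth functions on matrix groups -/

/-- `f : X → ℂ` is smooth, where `X` is a submanifold of the real vector space `E` through the
embedding `ι`: near each point `f` is the restriction of a smooth function on `E`. -/
def SmoothAlong {X E : Type*} [TopologicalSpace X] [NormedAddCommGroup E] [NormedSpace ℝ E]
    (ι : X → E) (f : X → ℂ) : Prop :=
  ∀ x, ∃ f' : E → ℂ, ContDiffAt ℝ ∞ f' (ι x) ∧ ∀ᶠ y in 𝓝 x, f y = f' (ι y)

/-- Smoothness of a function with values in a complete locally convex space `V`; for such `V` it may
be tested on continuous linear functionals. -/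
def SmoothAlongVec {X E V : Type*} [TopologicalSpace X] [NormedAddCommGroup E] [NormedSpace ℝ E]
    [AddCommGroup V] [Module ℂ V] [TopologicalSpace V] (ι : X → E) (f : X → V) : Prop :=
  ∀ l : V →L[ℂ] ℂ, SmoothAlong ι fun x => l (f x)

/-- The matrix entries of an element of `Sp(k, F)`. -/
def entries {k : ℕ} {F : Type*} [RCLike F] (g : Sp k F) : Fin k ⊕ Fin k → Fin k ⊕ Fin k → F :=
  fun i j => mat g i j

/-! ### Representations on topological vector spaces -/

section Reps

variable {Γ V : Type*} [Group Γ] [TopologicalSpace Γ]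
  [AddCommGroup V] [Module ℂ V] [TopologicalSpace V]

/-- The representation is (jointly) continuous. -/
def IsContRep (ρ : Γ →* (V →L[ℂ] V)) : Prop :=
  Continuous fun p : Γ × V => ρ p.1 p.2

/-- Topological irreducibility. -/
def IsIrredRep (ρ : Γ →* (V →L[ℂ] V)) : Prop :=
  Nontrivial V ∧ ∀ W : Submodule ℂ V, IsClosed (W : Set V) →
    (∀ g, ∀ v ∈ W, ρ g v ∈ W) → W = ⊥ ∨ W = ⊤

/-- The `L`-homomorphisms from a finite-dimensional representation `θ` of the subgroup `L`
to `ρ`. -/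
def homSpace (ρ : Γ →* (V →L[ℂ] V)) (L : Subgroup Γ) {n : ℕ}
    (θ : L →* ((Fin n → ℂ) →L[ℂ] (Fin n → ℂ))) : Submodule ℂ ((Fin n → ℂ) →ₗ[ℂ] V) where
  carrier := {T | ∀ (x : L) (v : Fin n → ℂ), T (θ x v) = ρ x (T v)}
  zero_mem' := by intro x v; simp
  add_mem' := by intro S T hS hT x v; simp [hS x v, hT x v]
  smul_mem' := by intro c T hT x v; simp [hT x v]

/-- Admissibility with respect to the compact subgroup `L`: every finite-dimensional continuous
representation of `L` occurs with finite multiplicity. -/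
def IsAdmissibleRep (ρ : Γ →* (V →L[ℂ] V)) (L : Subgroup Γ) : Prop :=
  ∀ (n : ℕ) (θ : L →* ((Fin n → ℂ) →L[ℂ] (Fin n → ℂ))), Continuous θ →
    FiniteDimensional ℂ (homSpace ρ L θ)

/-- `v` is an `L`-finite vector. -/
def IsFiniteVec (ρ : Γ →* (V →L[ℂ] V)) (L : Subgroup Γ) (v : V) : Prop :=
  FiniteDimensional ℂ (Submodule.span ℂ (Set.range fun x : L => ρ x v))

/-- The continuous linear functional `l` is an `L`-finite vector of the dual representation. -/
def IsFiniteFunctional (ρ : Γ →* (V →L[ℂ] V)) (L : Subgroup Γ) (l : V →L[ℂ] ℂ) : Prop :=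
  FiniteDimensional ℂ (Submodule.span ℂ (Set.range fun x : L => l.comp (ρ x)))

/-- Coefficients of `ρ`: finite linear combinations of matrix coefficients `g ↦ ⟨ρ(g) v, l⟩`. -/
def coefficients (ρ : Γ →* (V →L[ℂ] V)) : Submodule ℂ (Γ → ℂ) :=
  Submodule.span ℂ {φ | ∃ (v : V) (l : V →L[ℂ] ℂ), φ = fun g => l (ρ g v)}

/-- `L`-finite coefficients of `ρ`: finite linear combinations of matrix coefficients
`g ↦ ⟨ρ(g) v, l⟩` of `L`-finite vectors `v` and `L`-finite functionals `l`. -/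
def finiteCoefficients (ρ : Γ →* (V →L[ℂ] V)) (L : Subgroup Γ) : Submodule ℂ (Γ → ℂ) :=
  Submodule.span ℂ {φ | ∃ (v : V) (l : V →L[ℂ] ℂ), IsFiniteVec ρ L v ∧ IsFiniteFunctional ρ L l ∧
    φ = fun g => l (ρ g v)}

end Reps

/-! ### Parabolic induction and the intertwining integral -/

section Induction

variable {k k₁ : ℕ} {F : Type*} [RCLike F]
variable {V : Type*} [AddCommGroup V] [Module ℂ V] [TopologicalSpace V]

/-- `K ∩ M`, as a subgroup of the Levi subgroup `M`. -/
def leviCompact (k k₁ : ℕ) (F : Type*) [RCLike F] : Subgroup (levi k k₁ F) :=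
  (maxCompact k F).subgroupOf (levi k k₁ F)

/-- All vectors of the representation `σ` of `M` are smooth. -/
def IsSmoothRep (σ : levi k k₁ F →* (V →L[ℂ] V)) : Prop :=
  ∀ v, SmoothAlongVec (fun m : levi k k₁ F => entries (m : Sp k F)) fun m => σ m v

variable [IsTopologicalAddGroup V] [ContinuousSMul ℂ V]

/-- The space of the normalised smooth induced representation: smooth `f : G → V` with
`f(n m g) = δ(m)^{1/2} σ(m) f(g)`, where `(N, δ)` is `(U, δ_P)` for `s = 1`, which gives
`Ind_P^G σ`, and `(Ū, δ_P̄)` for `s = -1`, which gives `Ind_P̄^G σ`. -/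
def smoothInd (σ : levi k k₁ F →* (V →L[ℂ] V)) (s : ℤ) : Submodule ℂ C(Sp k F, V) where
  carrier := {f | SmoothAlongVec entries f ∧
    ∀ (n : unip k k₁ F s) (m : levi k k₁ F) (g : Sp k F),
      f (n * m * g) = ((√(modulus k k₁ F s m) : ℝ) : ℂ) • σ m (f g)}
  zero_mem' := by
    refine ⟨fun l x => ⟨fun _ => 0, contDiffAt_const, by simp⟩, by simp⟩
  add_mem' := by
    rintro f f' ⟨hf, hf'⟩ ⟨hg, hg'⟩
    refine ⟨fun l x => ?_, fun n m g => by simp [hf', hg']⟩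
    obtain ⟨a, ha, ha'⟩ := hf l x
    obtain ⟨b, hb, hb'⟩ := hg l x
    refine ⟨fun e => a e + b e, ha.add hb, ?_⟩
    filter_upwards [ha', hb'] with y h1 h2
    simp [h1, h2]
  smul_mem' := by
    rintro c f ⟨hf, hf'⟩
    refine ⟨fun l x => ?_, fun n m g => by simp [hf', smul_comm c]⟩
    obtain ⟨a, ha, ha'⟩ := hf l x
    refine ⟨fun e => c * a e, contDiffAt_const.mul ha, ?_⟩
    filter_upwards [ha'] with y h1
    simp [h1]

/-- `Φ = J(f)`, that is `Φ(g) = ∫_Ū f(ū g) dū`, with absolute convergence. As usual the integral is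
understood by pairing with the `K ∩ M`-finite vectors of the contragredient of `σ`. -/
def IsIntertwiningIntegral (σ : levi k k₁ F →* (V →L[ℂ] V)) (μU : Measure (unip k k₁ F (-1)))
    (f Φ : C(Sp k F, V)) : Prop :=
  ∀ (g : Sp k F) (l : V →L[ℂ] ℂ), IsFiniteFunctional σ (leviCompact k k₁ F) l →
    Integrable (fun u : unip k k₁ F (-1) => l (f (u * g))) μU ∧
      l (Φ g) = ∫ u : unip k k₁ F (-1), l (f (u * g)) ∂μU

/-- The intertwining integral is an absolutely convergent operator
`J : Ind_P^G σ → Ind_P̄^G σ`. -/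
def IntertwiningConverges (σ : levi k k₁ F →* (V →L[ℂ] V))
    (μU : Measure (unip k k₁ F (-1))) : Prop :=
  ∀ f ∈ smoothInd σ 1, ∃ Φ ∈ smoothInd σ (-1), IsIntertwiningIntegral σ μU f Φ

/-- The image of the intertwining integral `J : Ind_P^G σ → Ind_P̄^G σ`. -/
def imageJ (σ : levi k k₁ F →* (V →L[ℂ] V)) (μU : Measure (unip k k₁ F (-1))) :
    Submodule ℂ C(Sp k F, V) where
  carrier := {Φ | Φ ∈ smoothInd σ (-1) ∧ ∃ f ∈ smoothInd σ 1, IsIntertwiningIntegral σ μU f Φ}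
  zero_mem' := ⟨zero_mem _, 0, zero_mem _, fun g l _ => by simp⟩
  add_mem' := by
    rintro Φ Φ' ⟨h, f, hf, hJ⟩ ⟨h', f', hf', hJ'⟩
    refine ⟨add_mem h h', f + f', add_mem hf hf', fun g l hl => ?_⟩
    obtain ⟨a, b⟩ := hJ g l hl
    obtain ⟨a', b'⟩ := hJ' g l hl
    simp only [ContinuousMap.add_apply, map_add]
    exact ⟨a.add a', by rw [integral_add a a', b, b']⟩
  smul_mem' := by
    rintro c Φ ⟨h, f, hf, hJ⟩
    refine ⟨Submodule.smul_mem _ c h, c • f, Submodule.smul_mem _ c hf, fun g l hl => ?_⟩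
    obtain ⟨a, b⟩ := hJ g l hl
    simp only [ContinuousMap.smul_apply, map_smul]
    exact ⟨a.smul c, by rw [integral_smul, b]⟩

/-- Right translation `(R(g) Φ)(x) = Φ(x g)` on `C(G, V)`, which carries the topology of uniform
convergence on compact sets. -/
def rightTranslation (k : ℕ) (F : Type*) [RCLike F] (V : Type*) [AddCommGroup V] [Module ℂ V]
    [TopologicalSpace V] [IsTopologicalAddGroup V] [ContinuousSMul ℂ V] :
    Sp k F →* (C(Sp k F, V) →L[ℂ] C(Sp k F, V)) where
  toFun g :=
    { toFun := fun Φ => Φ.comp ⟨fun x => x * g, continuous_mul_const g⟩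
      map_add' := fun _ _ => rfl
      map_smul' := fun _ _ => rfl
      cont := ContinuousMap.continuous_precomp _ }
  map_one' := by ext Φ x; simp
  map_mul' g h := by ext Φ x; simp [mul_assoc]

theorem smooth_comp_mul_right {V : Type*} [AddCommGroup V] [Module ℂ V] [TopologicalSpace V]
    (g : Sp k F) (f : Sp k F → V) (hf : SmoothAlongVec entries f) :
    SmoothAlongVec entries fun x => f (x * g) := by
  intro l x
  obtain ⟨a, ha, ha'⟩ := hf l (x * g)
  let r : (Fin k ⊕ Fin k → Fin k ⊕ Fin k → F) → (Fin k ⊕ Fin k → Fin k ⊕ Fin k → F) :=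
    fun e i j => ∑ b, e i b * mat g b j
  have hr : ContDiff ℝ ∞ r := by
    refine contDiff_pi.mpr fun i => contDiff_pi.mpr fun j => ContDiff.sum fun b _ => ?_
    exact (((contDiff_apply_apply ℝ F i b)).mul contDiff_const)
  have hrx : ∀ y : Sp k F, r (entries y) = entries (y * g) := by
    intro y; funext i j; simp [r, entries, Matrix.mul_apply]
  refine ⟨fun e => a (r e), ?_, ?_⟩
  · refine ContDiffAt.comp (entries x) ?_ hr.contDiffAt
    rw [hrx]; exact ha
  · have : Filter.Tendsto (fun y : Sp k F => y * g) (𝓝 x) (𝓝 (x * g)) :=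
      (continuous_mul_const g).tendsto x
    filter_upwards [this.eventually ha'] with y hy
    rw [hrx]; exact hy

theorem rightTranslation_mem_smoothInd (σ : levi k k₁ F →* (V →L[ℂ] V)) (s : ℤ) (g : Sp k F)
    (f : C(Sp k F, V)) (hf : f ∈ smoothInd σ s) :
    rightTranslation k F V g f ∈ smoothInd σ s :=
  ⟨smooth_comp_mul_right g f hf.1, fun n m x => by
    change f (n * m * x * g) = _ • σ m (f (x * g))
    rw [mul_assoc _ x g, hf.2 n m (x * g)]⟩

theorem rightTranslation_mem_imageJ (σ : levi k k₁ F →* (V →L[ℂ] V))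
    (μU : Measure (unip k k₁ F (-1))) (g : Sp k F) (Φ : C(Sp k F, V)) (hΦ : Φ ∈ imageJ σ μU) :
    rightTranslation k F V g Φ ∈ imageJ σ μU := by
  obtain ⟨h, f, hf, hJ⟩ := hΦ
  refine ⟨rightTranslation_mem_smoothInd σ _ g Φ h, rightTranslation k F V g f,
    rightTranslation_mem_smoothInd σ _ g f hf, fun x l hl => ?_⟩
  change Integrable (fun u : unip k k₁ F (-1) => l (f (u * x * g))) μU ∧
    l (Φ (x * g)) = ∫ u : unip k k₁ F (-1), l (f (u * x * g)) ∂μU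
  simp only [mul_assoc]
  exact hJ (x * g) l hl

/-- The representation `π` of `G = Sp(k, F)` by right translation on the image of `J`. -/
def imageRep (σ : levi k k₁ F →* (V →L[ℂ] V)) (μU : Measure (unip k k₁ F (-1))) :
    Sp k F →* (imageJ σ μU →L[ℂ] imageJ σ μU) where
  toFun g := ((rightTranslation k F V g).comp (imageJ σ μU).subtypeL).codRestrict (imageJ σ μU)
    fun Φ => rightTranslation_mem_imageJ σ μU g Φ Φ.2
  map_one' := by ext Φ x; simp
  map_mul' g h := by
    ext Φ x
    change (rightTranslation k F V (g * h) Φ) x = _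
    rw [map_mul]
    rfl

end Induction

/-! ### The space `M \ G` -/

section Quotient

variable {k k₁ : ℕ} {F : Type*} [RCLike F]

/-- The space `M \ G` of right cosets `M h`, with the quotient topology and its Borel sets. -/
def LeviQuot (k k₁ : ℕ) (F : Type*) [RCLike F] : Type _ :=
  Quotient (QuotientGroup.rightRel (levi k k₁ F))

instance instTopLeviQuot : TopologicalSpace (LeviQuot k k₁ F) :=
  inferInstanceAs (TopologicalSpace (Quotient (QuotientGroup.rightRel (levi k k₁ F))))

instance instMeasLeviQuot : MeasurableSpace (LeviQuot k k₁ F) := borel _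

instance instBorelLeviQuot : BorelSpace (LeviQuot k k₁ F) := ⟨rfl⟩

/-- A function on `G` that is invariant under left translation by `M`, as a function
on `M \ G`. -/
def LeviQuot.lift (φ : Sp k F → ℂ) (hφ : ∀ (m : levi k k₁ F) (h : Sp k F), φ (m * h) = φ h) :
    LeviQuot k k₁ F → ℂ :=
  Quotient.lift φ fun a b hab => by
    have h : b * a⁻¹ ∈ levi k k₁ F := QuotientGroup.rightRel_apply.mp hab
    simpa using (hφ ⟨b * a⁻¹, h⟩ a).symm

/-- The right action `M h ↦ M h g` of `g ∈ G` on `M \ G`. -/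
def LeviQuot.translate (g : Sp k F) : LeviQuot k k₁ F → LeviQuot k k₁ F :=
  Quotient.map (fun h => h * g) fun a b hab => by
    have h : b * a⁻¹ ∈ levi k k₁ F := QuotientGroup.rightRel_apply.mp hab
    exact QuotientGroup.rightRel_apply.mpr (by simpa [mul_assoc] using h)

/-- `ν` is invariant under the right action of `G` on `M \ G`. -/
def IsRightInvariant (ν : Measure (LeviQuot k k₁ F)) : Prop :=
  ∀ g : Sp k F, ν.map (LeviQuot.translate g) = ν

end Quotient

/-! ### The kernel functions `H` -/

section Kernel

variable {k k₁ : ℕ} {F : Type*} [RCLike F]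
variable {V : Type*} [AddCommGroup V] [Module ℂ V] [TopologicalSpace V]

/-- The three conditions on `H : G × G → ℂ`. -/
structure IsCoeffKernel (σ : levi k k₁ F →* (V →L[ℂ] V)) (H : Sp k F → Sp k F → ℂ) : Prop where
  /-- `H(u₁ m g₁, ū₂ m g₂) = H(g₁, g₂)`. -/
  invariant : ∀ (u₁ : unip k k₁ F 1) (u₂ : unip k k₁ F (-1)) (m : levi k k₁ F) (g₁ g₂ : Sp k F),
    H (u₁ * m * g₁) (u₂ * m * g₂) = H g₁ g₂
  /-- `m ↦ H(m g₁, g₂)` is a coefficient of `σ ⊗ δ_P^{1/2}`. -/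
  coefficient : ∀ g₁ g₂ : Sp k F, ∃ φ ∈ coefficients σ, ∀ m : levi k k₁ F,
    H (m * g₁) g₂ = ((√(modulus k k₁ F 1 m) : ℝ) : ℂ) * φ m
  /-- `H` is smooth on `G × G`. -/
  smooth : SmoothAlong (fun p : Sp k F × Sp k F => (entries p.1, entries p.2))
    fun p => H p.1 p.2
  /-- The right translates of `H` by `K × K` span a finite-dimensional space. -/
  finite : FiniteDimensional ℂ (Submodule.span ℂ
    (Set.range fun (x : maxCompact k F × maxCompact k F) (p : Sp k F × Sp k F) =>
      H (p.1 * x.1) (p.2 * x.2)))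

/-- The function `M h ↦ H(h g, h)` on `M \ G`. -/
def IsCoeffKernel.onQuot {σ : levi k k₁ F →* (V →L[ℂ] V)} {H : Sp k F → Sp k F → ℂ}
    (hH : IsCoeffKernel σ H) (g : Sp k F) : LeviQuot k k₁ F → ℂ :=
  LeviQuot.lift (fun h => H (h * g) h) fun m h => by
    simpa [mul_assoc] using hH.invariant 1 1 m (h * g) h

end Kernel

end SpCoeff

end

open SpCoeff

set_option linter.unusedSectionVars false
set_option linter.style.haveILetI false

noncomputable section

namespace SpCoeff

/-! ### Topology of `Sp(k, F)` and its subgroups -/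

section SpTopology

variable {k : ℕ} {F : Type*} [RCLike F]

/-! The integral formula is a change of variables. Since G = M Ū K, the measure dū dk has an image
on M \ G, which is up to a scalar the only invariant measure there; and for h = ū k condition 1
gives H(ūkg, ūk) = H(ūkg, k). Three points carry the content.

Invariance of the image measure. The image of dm dū dk on G is invariant under P̄ on the left and K
on the right. Haar measure of the unimodular group G has the same invariance, and P̄ × K acts
transitively on G, so the two are proportional by `IsTransitiveAction.exists_eq_smul`; hence the
image of dm dū dk is invariant under right translation by G (`mukMeasure_map_mul_right`).
Integrating out M, which is unimodular, gives the invariance of the image of dū dk on M \ G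
(`ukMeasure_invariant_and_sigmaFinite`), and the same uniqueness principle compares it with ν
(`exists_eq_smul_ukMeasure`).

The coefficient. By K × K-finiteness H = ∑ a_q h_q for finitely many kernels with h_q(g x, g') = ∑
A_{qi}(x) h_i(g, g') and h_q(g, g' x) = ∑ B_{qi}(x) h_i(g, g') for x in K. On M, h_r(m, 1) is
δ_P(m)^{1/2} times a coefficient of σ. Averaging over K ∩ M brings this coefficient to the form ∑_J
ℓ_J(σ(m) w_{rJ}) with K ∩ M-finite ℓ_J and with vectors w_{rJ} that transform through the matrix A
(`KernelBasis.exists_matrix_coefficients`). This equivariance is what makes F_{iJ}(u m x) =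
δ_P(m)^{1/2} σ(m) ∑_r A_{ir}(x) w_{rJ} a well-defined element of Ind_P^G σ, and h_i(g, 1) = ∑_J
ℓ_J(F_{iJ}(g)). Therefore H(ūkg, k) = ∑ a_q B_{qi}(k) ℓ_J(F_{iJ}(ūkg)), whose integral is ∑ a_q
λ_{qiJ}(π(g) J F_{iJ}) with λ_{qiJ}(Φ) = ∫_K B_{qi}(x) ℓ_J(Φ(x)) dx. The matrices A and B show that
the vectors J F_{iJ} and the functionals λ_{qiJ} are K-finite. As J is known only through K ∩
M-finite functionals, relations between values of J F_{iJ} require that these separate points of V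
(`eq_zero_of_finite_functionals`, by Stone–Weierstrass).

Absolute convergence on Ū × K. The hypothesis controls ∫ |ℓ(f(ūx))| dū for each x separately, while
Fubini needs a bound uniform for x in the compact set K g. It comes from the closed graph theorem:
for x_n → x_0 and c in ℓ¹ the series ∑ c_n f(· x_n) lies again in Ind_P^G σ, so its intertwining
integral converges absolutely; the resulting linear map from ℓ¹ to L¹(Ū) is bounded, and its values
at unit vectors bound all the integrals for x_n (`exists_bound_integral_norm`,
`exists_bound_intertwining`). That the series is smooth uses completeness of V and the extension of
smooth functions on G to open sets of matrices by a Cayley retraction. -/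

theorem continuous_mat : Continuous (mat : Sp k F → Matrix (Fin k ⊕ Fin k) (Fin k ⊕ Fin k) F) :=
  continuous_subtype_val

theorem continuous_entry (i j : Fin k ⊕ Fin k) : Continuous fun g : Sp k F => mat g i j :=
  continuous_mat.matrix_elem i j

theorem continuous_entries : Continuous (entries : Sp k F → _) :=
  continuous_pi fun i => continuous_pi fun j => continuous_entry i j

instance instIsTopologicalGroupSp : IsTopologicalGroup (Sp k F) where
  continuous_inv := by
    refine Continuous.subtype_mk (f := fun g : Sp k F =>
      -Matrix.J (Fin k) F * (mat g)ᵀ * Matrix.J (Fin k) F) ?_ _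
    exact (continuous_const.matrix_mul continuous_mat.matrix_transpose).matrix_mul continuous_const

instance instSecondCountableMatrix :
    SecondCountableTopology (Matrix (Fin k ⊕ Fin k) (Fin k ⊕ Fin k) F) :=
  inferInstanceAs (SecondCountableTopology (Fin k ⊕ Fin k → Fin k ⊕ Fin k → F))

instance instLocallyCompactMatrix :
    LocallyCompactSpace (Matrix (Fin k ⊕ Fin k) (Fin k ⊕ Fin k) F) :=
  inferInstanceAs (LocallyCompactSpace (Fin k ⊕ Fin k → Fin k ⊕ Fin k → F))

instance instSecondCountableSp : SecondCountableTopology (Sp k F) :=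
  TopologicalSpace.Subtype.secondCountableTopology _

theorem isClosed_symplecticGroup :
    IsClosed (Matrix.symplecticGroup (Fin k) F : Set (Matrix (Fin k ⊕ Fin k) (Fin k ⊕ Fin k) F)) := by
  have : (Matrix.symplecticGroup (Fin k) F : Set (Matrix (Fin k ⊕ Fin k) (Fin k ⊕ Fin k) F)) =
      {A | A * Matrix.J (Fin k) F * Aᵀ = Matrix.J (Fin k) F} := by
    ext A
    exact SymplecticGroup.mem_iff
  rw [this]
  exact isClosed_eq ((continuous_id.matrix_mul continuous_const).matrix_mul
    continuous_id.matrix_transpose) continuous_const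

theorem isClosedEmbedding_mat :
    IsClosedEmbedding (mat : Sp k F → Matrix (Fin k ⊕ Fin k) (Fin k ⊕ Fin k) F) :=
  isClosed_symplecticGroup.isClosedEmbedding_subtypeVal

instance instLocallyCompactSp : LocallyCompactSpace (Sp k F) :=
  isClosedEmbedding_mat.locallyCompactSpace

theorem isInducing_entries : IsInducing (entries : Sp k F → _) :=
  IsInducing.subtypeVal

theorem isClosed_levi (k k₁ : ℕ) : IsClosed (levi k k₁ F : Set (Sp k F)) := by
  have : (levi k k₁ F : Set (Sp k F)) =
      ⋂ i, ⋂ j, {g | wt k k₁ i ≠ wt k k₁ j → mat g i j = 0} := by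
    ext g; simp only [Set.mem_iInter]; rfl
  rw [this]
  refine isClosed_iInter fun i => isClosed_iInter fun j => ?_
  by_cases h : wt k k₁ i = wt k k₁ j
  · simp [h]
  · simpa [h] using isClosed_eq (continuous_entry (F := F) i j) continuous_const

theorem isClosed_unip (k k₁ : ℕ) (s : ℤ) : IsClosed (unip k k₁ F s : Set (Sp k F)) := by
  have : (unip k k₁ F s : Set (Sp k F)) = ⋂ i, ⋂ j, {g | s * wt k k₁ i ≤ s * wt k k₁ j →
      mat g i j = (1 : Matrix _ _ F) i j} := by
    ext g; simp only [Set.mem_iInter]; rfl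
  rw [this]
  refine isClosed_iInter fun i => isClosed_iInter fun j => ?_
  by_cases h : s * wt k k₁ i ≤ s * wt k k₁ j
  · simpa only [h, true_imp_iff] using isClosed_eq (continuous_entry (F := F) i j) continuous_const
  · simp only [h, false_imp_iff, Set.ofPred_true, isClosed_univ]

theorem isCompact_maxCompact (k : ℕ) : IsCompact (maxCompact k F : Set (Sp k F)) := by
  have hc : IsClosed (maxCompact k F : Set (Sp k F)) := by
    have : (maxCompact k F : Set (Sp k F)) = {g | mat g * star (mat g) = 1} := by
      ext g; exact Matrix.mem_unitaryGroup_iff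
    rw [this]
    exact isClosed_eq (continuous_mat.matrix_mul continuous_mat.matrix_conjTranspose)
      continuous_const
  have hb : IsCompact (Set.univ.pi fun _ => Set.univ.pi fun _ => Metric.closedBall (0 : F) 1 :
      Set (Fin k ⊕ Fin k → Fin k ⊕ Fin k → F)) :=
    isCompact_univ_pi fun _ => isCompact_univ_pi fun _ => isCompact_closedBall _ _
  refine (isClosedEmbedding_mat.isCompact_preimage (K := _) hb).of_isClosed_subset hc ?_
  intro g hg i _ j _
  exact mem_closedBall_zero_iff.mpr (entry_norm_bound_of_unitary hg i j)

instance instCompactSpaceMaxCompact : CompactSpace (maxCompact k F) :=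
  isCompact_iff_compactSpace.mp (isCompact_maxCompact k)

instance instLocallyCompactLevi (k₁ : ℕ) : LocallyCompactSpace (levi k k₁ F) :=
  (isClosed_levi k k₁).isClosedEmbedding_subtypeVal.locallyCompactSpace

instance instLocallyCompactUnip (k₁ : ℕ) (s : ℤ) : LocallyCompactSpace (unip k k₁ F s) :=
  (isClosed_unip k k₁ s).isClosedEmbedding_subtypeVal.locallyCompactSpace

instance instCompactSpaceLeviCompact (k₁ : ℕ) : CompactSpace (leviCompact k k₁ F) := by
  refine isCompact_iff_compactSpace.mp ?_
  exact (isClosed_levi k k₁).isClosedEmbedding_subtypeVal.isCompact_preimage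
    (isCompact_maxCompact k)

instance instSecondCountableSubgroup (S : Subgroup (Sp k F)) : SecondCountableTopology S :=
  TopologicalSpace.Subtype.secondCountableTopology _

/-- The symplectic matrix `J`, as an element of `Sp(k, F)`. -/
def spJ (k : ℕ) (F : Type*) [RCLike F] : Sp k F := SymplecticGroup.symJ (Fin k) F

theorem mat_spJ : mat (spJ k F) = Matrix.J (Fin k) F := rfl

theorem spJ_mem_maxCompact : spJ k F ∈ maxCompact k F := by
  change Matrix.J (Fin k) F ∈ Matrix.unitaryGroup _ F
  rw [Matrix.mem_unitaryGroup_iff]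
  have : star (Matrix.J (Fin k) F) = -Matrix.J (Fin k) F := by
    rw [Matrix.star_eq_conjTranspose, Matrix.J, Matrix.fromBlocks_conjTranspose,
      Matrix.fromBlocks_neg]
    simp
  rw [this, Matrix.mul_neg, Matrix.J_squared, neg_neg]

/-- Conjugation by `J` acts on matrix entries, up to sign, by the swap of coordinates. -/
theorem spJ_conj_entry (g : Sp k F) (i j : Fin k ⊕ Fin k) :
    mat (spJ k F * g * (spJ k F)⁻¹) i j =
      (if i.isLeft = j.isLeft then 1 else -1) * mat g i.swap j.swap := by
  have h : mat (spJ k F)⁻¹ = -Matrix.J (Fin k) F := by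
    rw [mat_inv, mat_spJ, Matrix.J_transpose]
    rw [_root_.neg_mul_neg, Matrix.J_squared, _root_.neg_mul, Matrix.one_mul]
  rw [mat_mul, mat_mul, h, mat_spJ]
  rcases i with i | i <;> rcases j with j | j <;>
    simp [Matrix.mul_apply, Matrix.J, Fintype.sum_sum_type, Matrix.one_apply]

end SpTopology

/-! ### Triangular matrices with respect to a weight function -/

section Triangular

variable {ι F : Type*} [Fintype ι] [DecidableEq ι] [RCLike F]

/-- `A` is upper triangular with respect to the weight function `w`: entries that lower weights
vanish. -/
def IsUpper (w : ι → ℤ) (A : Matrix ι ι F) : Prop := ∀ i j, w i < w j → A i j = 0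

theorem IsUpper.mul {w : ι → ℤ} {A B : Matrix ι ι F} (hA : IsUpper w A) (hB : IsUpper w B) :
    IsUpper w (A * B) :=
  Matrix.BlockTriangular.mul (b := OrderDual.toDual ∘ w) hA hB

theorem IsUpper.inv {w : ι → ℤ} {A : Matrix ι ι F} (hA : IsUpper w A) (hdet : IsUnit A.det) :
    IsUpper w A⁻¹ := by
  haveI := Matrix.invertibleOfIsUnitDet A hdet
  exact Matrix.blockTriangular_inv_of_blockTriangular (b := OrderDual.toDual ∘ w) hA

/-- The part of a matrix that preserves weights. -/
def diagPart (w : ι → ℤ) (A : Matrix ι ι F) : Matrix ι ι F :=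
  Matrix.of fun i j => if w i = w j then A i j else 0

theorem diagPart_apply (w : ι → ℤ) (A : Matrix ι ι F) (i j : ι) :
    diagPart w A i j = if w i = w j then A i j else 0 := rfl

theorem diagPart_one (w : ι → ℤ) : diagPart w (1 : Matrix ι ι F) = 1 := by
  ext i j
  rw [diagPart_apply]
  by_cases h : i = j
  · simp [h]
  · simp [Matrix.one_apply_ne h]

/-- A summand through x survives only if x has the common weight of i and j: a higher weight kills
the first factor, a lower one the second. This makes the projection of a parabolic subgroup to its
Levi subgroup a homomorphism. -/
theorem diagPart_mul {w : ι → ℤ} {A B : Matrix ι ι F} (hA : IsUpper w A) (hB : IsUpper w B) :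
    diagPart w (A * B) = diagPart w A * diagPart w B := by
  ext i j
  rw [diagPart_apply, Matrix.mul_apply, Matrix.mul_apply]
  by_cases h : w i = w j
  · rw [if_pos h]
    refine Finset.sum_congr rfl fun x _ => ?_
    rw [diagPart_apply, diagPart_apply]
    rcases lt_trichotomy (w i) (w x) with h1 | h1 | h1
    · rw [hA i x h1, zero_mul, if_neg h1.ne, zero_mul]
    · rw [if_pos h1, if_pos (h1.symm.trans h)]
    · rw [hB x j (h ▸ h1), mul_zero, if_neg h1.ne', zero_mul]
  · rw [if_neg h]
    refine (Finset.sum_eq_zero fun x _ => ?_).symm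
    rw [diagPart_apply, diagPart_apply]
    by_cases h1 : w i = w x
    · rw [if_neg fun h2 => h (h1.trans h2), mul_zero]
    · rw [if_neg h1, zero_mul]

theorem mul_diag_of_isUpper {w : ι → ℤ} (hw : Function.Injective w) {A B : Matrix ι ι F}
    (hA : IsUpper w A) (hB : IsUpper w B) (i : ι) : (A * B) i i = A i i * B i i := by
  rw [Matrix.mul_apply, Finset.sum_eq_single i]
  · intro x _ hx
    rcases lt_trichotomy (w i) (w x) with h | h | h
    · rw [hA _ _ h, zero_mul]
    · exact absurd (hw h).symm hx
    · rw [hB _ _ h, mul_zero]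
  · simp

/-- The inverse of `T` is triangular in the same sense and equals `star T`, which is triangular in
the opposite sense; so `T` is diagonal, and positive diagonal entries of modulus one are 1. This is
the uniqueness of the triangular–unitary factorisation. -/
theorem eq_one_of_isUpper_of_unitary {w : ι → ℤ} (hw : Function.Injective w)
    {T : Matrix ι ι F} (hT : IsUpper w T) (hu : T ∈ Matrix.unitaryGroup ι F)
    (hpos : ∀ i, ∃ r : ℝ, 0 < r ∧ T i i = r) : T = 1 := by
  have hmul : T * star T = 1 := Matrix.mem_unitaryGroup_iff.mp hu
  have hinv : T⁻¹ = star T := Matrix.inv_eq_right_inv hmul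
  have hdet : IsUnit T.det := Matrix.isUnit_det_of_right_inverse hmul
  have hlow : IsUpper w (star T) := hinv ▸ hT.inv hdet
  ext i j
  by_cases hij : i = j
  · subst hij
    obtain ⟨r, hr, hTr⟩ := hpos i
    have h1 := mul_diag_of_isUpper hw hT hlow i
    rw [hmul, Matrix.one_apply_eq, Matrix.star_apply, hTr, RCLike.star_def, RCLike.conj_ofReal,
      ← RCLike.ofReal_mul] at h1
    have h2 : r * r = 1 := by exact_mod_cast h1.symm
    have h3 : r = 1 := by nlinarith
    rw [hTr, h3, Matrix.one_apply_eq, RCLike.ofReal_one]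
  · rw [Matrix.one_apply_ne hij]
    rcases lt_trichotomy (w i) (w j) with h | h | h
    · exact hT i j h
    · exact absurd (hw h) hij
    · have := hlow j i h
      rwa [Matrix.star_apply, star_eq_zero] at this

end Triangular

/-! ### Gram–Schmidt orthogonalisation as a smooth map -/

section GramSchmidt

variable {ι F E : Type*} [Fintype ι] [LinearOrder ι] [LocallyFiniteOrderBot ι] [WellFoundedLT ι]
  [RCLike F] [NormedAddCommGroup E] [InnerProductSpace F E]

/-- Orthogonality leaves only the component of `f i` along its own Gram–Schmidt vector. These are
the diagonal entries of the triangular factor, positive for independent vectors. -/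
theorem inner_gramSchmidtNormed_self (f : ι → E) (i : ι) :
    inner F (InnerProductSpace.gramSchmidtNormed F f i) (f i) =
      ((‖InnerProductSpace.gramSchmidt F f i‖ : ℝ) : F) := by
  set gs := InnerProductSpace.gramSchmidt F f with hgs
  have h1 : inner F (gs i) (f i) = ((‖gs i‖ ^ 2 : ℝ) : F) := by
    rw [InnerProductSpace.gramSchmidt_def'' F f i, inner_add_right, inner_sum,
      Finset.sum_eq_zero, add_zero, inner_self_eq_norm_sq_to_K, RCLike.ofReal_pow]
    intro j hj
    rw [inner_smul_right, InnerProductSpace.gramSchmidt_orthogonal F f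
      (Finset.mem_Iio.mp hj).ne', mul_zero]
  rw [InnerProductSpace.gramSchmidtNormed, inner_smul_left, h1]
  by_cases h0 : gs i = 0
  · simp [← hgs, h0]
  · have : ((‖gs i‖ : ℝ) : F) ≠ 0 := by simpa using h0
    simp only [map_inv₀, RCLike.conj_ofReal, RCLike.ofReal_pow]
    rw [← hgs, sq, inv_mul_cancel_left₀ this]

theorem contDiff_ofReal : ContDiff ℝ ∞ fun r : ℝ => (r : F) :=
  (RCLike.ofRealCLM (K := F)).contDiff

variable [NormedSpace ℝ E] [IsScalarTower ℝ F E]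

/-- Induction along the Gram–Schmidt recursion. Its denominators are norms of earlier Gram–Schmidt
vectors, which are non-zero by linear independence at `x`. -/
theorem contDiffAt_gramSchmidt {X : Type*} [NormedAddCommGroup X] [NormedSpace ℝ X]
    {f : X → ι → E} {x : X} (hf : ∀ i, ContDiffAt ℝ ∞ (fun y => f y i) x)
    (hx : LinearIndependent F (f x)) (i : ι) :
    ContDiffAt ℝ ∞ (fun y => InnerProductSpace.gramSchmidt F (f y) i) x := by
  induction i using WellFoundedLT.induction with
  | ind i ih =>
    have : (fun y => InnerProductSpace.gramSchmidt F (f y) i) = fun y =>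
        f y i - ∑ j ∈ Finset.Iio i,
          (inner F (InnerProductSpace.gramSchmidt F (f y) j) (f y i) /
            ((‖InnerProductSpace.gramSchmidt F (f y) j‖ : ℝ) : F) ^ 2) •
              InnerProductSpace.gramSchmidt F (f y) j := by
      funext y
      exact eq_sub_of_add_eq (InnerProductSpace.gramSchmidt_def'' F (f y) i).symm
    rw [this]
    refine (hf i).sub (ContDiffAt.sum fun j hj => ?_)
    have hj' := ih j (Finset.mem_Iio.mp hj)
    have hne := InnerProductSpace.gramSchmidt_ne_zero (𝕜 := F) j hx
    have hn : ContDiffAt ℝ ∞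
        (fun y => ((‖InnerProductSpace.gramSchmidt F (f y) j‖ : ℝ) : F)) x :=
      contDiff_ofReal.contDiffAt.comp x (hj'.norm F hne)
    refine ContDiffAt.smul ?_ hj'
    simp only [div_eq_mul_inv]
    exact (hj'.inner F (hf i)).mul ((hn.pow 2).inv (pow_ne_zero _ (by simpa using hne)))

theorem contDiffAt_gramSchmidtNormed {X : Type*} [NormedAddCommGroup X] [NormedSpace ℝ X]
    {f : X → ι → E} {x : X} (hf : ∀ i, ContDiffAt ℝ ∞ (fun y => f y i) x)
    (hx : LinearIndependent F (f x)) (i : ι) :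
    ContDiffAt ℝ ∞ (fun y => InnerProductSpace.gramSchmidtNormed F (f y) i) x := by
  have h := contDiffAt_gramSchmidt hf hx i
  have hne := InnerProductSpace.gramSchmidt_ne_zero (𝕜 := F) i hx
  have hn : ContDiffAt ℝ ∞
      (fun y => ((‖InnerProductSpace.gramSchmidt F (f y) i‖ : ℝ) : F)) x :=
    contDiff_ofReal.contDiffAt.comp x (h.norm F hne)
  exact (hn.inv (by simpa using hne)).smul h

end GramSchmidt

/-! ### The Iwasawa decomposition -/

section QR

variable {ι F : Type*} [Fintype ι] [DecidableEq ι] [RCLike F]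

/-- A smooth triangular factorisation `A = (A Q⋆) Q` with `Q` unitary. -/
theorem exists_smooth_unitary_factor (w : ι → ℤ) (hw : Function.Injective w) :
    ∃ Q : (ι → ι → F) → ι → ι → F, ∀ e, IsUnit (Matrix.of e).det →
      ContDiffAt ℝ ∞ Q e ∧ Matrix.of (Q e) ∈ Matrix.unitaryGroup ι F ∧
      IsUpper w (Matrix.of e * star (Matrix.of (Q e))) ∧
      ∀ i, ∃ r : ℝ, 0 < r ∧ (Matrix.of e * star (Matrix.of (Q e))) i i = r := by
  -- The rows are orthogonalised in order of increasing weight. Row i is then a combination of the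
  -- new rows of weight at most `w i`, which is triangularity in the sense of `IsUpper`.
  letI : LinearOrder ι := LinearOrder.lift' w hw
  letI : LocallyFiniteOrder ι := Fintype.toLocallyFiniteOrder
  letI : LocallyFiniteOrderBot ι :=
    { finsetIic := fun a => Finset.univ.filter (· ≤ a)
      finsetIio := fun a => Finset.univ.filter (· < a)
      finset_mem_Iic := fun a x => by simp
      finset_mem_Iio := fun a x => by simp }
  let f : (ι → ι → F) → ι → EuclideanSpace F ι := fun e i => WithLp.toLp 2 (e i)
  have hf : ∀ e i, ContDiffAt ℝ ∞ (fun y => f y i) e := fun e i =>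
    ((PiLp.continuousLinearEquiv 2 ℝ (fun _ : ι => F)).symm.contDiff.contDiffAt).comp e
      (contDiff_apply ℝ (ι → F) i).contDiffAt
  have hlin : ∀ e, IsUnit (Matrix.of e).det → LinearIndependent F (f e) := by
    intro e he
    have h := Matrix.linearIndependent_rows_iff_isUnit.mpr
      ((Matrix.isUnit_iff_isUnit_det _).mpr he)
    exact h.map' (WithLp.linearEquiv 2 F (ι → F)).symm.toLinearMap (LinearEquiv.ker _)
  refine ⟨fun e i j => InnerProductSpace.gramSchmidtNormed F (f e) i j, fun e he => ?_⟩
  have hinner : ∀ i j, (Matrix.of e * star (Matrix.of fun i j =>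
      InnerProductSpace.gramSchmidtNormed F (f e) i j)) i j =
      inner F (InnerProductSpace.gramSchmidtNormed F (f e) j) (f e i) := by
    intro i j
    rw [Matrix.mul_apply, PiLp.inner_apply]
    refine Finset.sum_congr rfl fun x _ => ?_
    rw [RCLike.inner_apply]
    rfl
  have hon := InnerProductSpace.gramSchmidtNormed_orthonormal (𝕜 := F) (hlin e he)
  refine ⟨?_, ?_, ?_, ?_⟩
  · refine contDiffAt_pi.mpr fun i => contDiffAt_pi.mpr fun j => ?_
    exact (PiLp.proj (𝕜 := ℝ) 2 (fun _ : ι => F) j).contDiff.contDiffAt.comp e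
      (contDiffAt_gramSchmidtNormed (hf e) (hlin e he) i)
  · rw [Matrix.mem_unitaryGroup_iff]
    ext i j
    have h := orthonormal_iff_ite.mp hon j i
    rw [PiLp.inner_apply] at h
    rw [Matrix.mul_apply, Matrix.one_apply]
    simp only [eq_comm (a := j)] at h
    rw [← h]
    refine Finset.sum_congr rfl fun x _ => ?_
    rw [RCLike.inner_apply]
    rfl
  · intro i j hij
    rw [hinner, InnerProductSpace.gramSchmidtNormed, inner_smul_left,
      InnerProductSpace.gramSchmidt_inv_triangular F (f e) (show i < j from hij), mul_zero]
  · intro i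
    refine ⟨_, norm_pos_iff.mpr (InnerProductSpace.gramSchmidt_ne_zero (𝕜 := F) i (hlin e he)), ?_⟩
    rw [hinner, inner_gramSchmidtNormed_self]

end QR

/-! ### Symplecticity of the triangular factor -/

section Parabolic

variable {k : ℕ} {F : Type*} [RCLike F]

/-- A regular weight function, refining all the weight functions `wt k k₁`. -/
def regWt (k : ℕ) : Fin k ⊕ Fin k → ℤ
  | Sum.inl i => k - i
  | Sum.inr i => i - k

theorem regWt_swap (i : Fin k ⊕ Fin k) : regWt k i.swap = - regWt k i := by
  rcases i with i | i <;> simp [regWt]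

theorem regWt_injective : Function.Injective (regWt k) := by
  rintro (i | i) (j | j) h <;> simp only [regWt] at h
  · congr 1; ext; omega
  · omega
  · omega
  · congr 1; ext; omega

theorem wt_mono {k₁ : ℕ} {i j : Fin k ⊕ Fin k} (h : regWt k i ≤ regWt k j) :
    wt k k₁ i ≤ wt k k₁ j := by
  rcases i with i | i <;> rcases j with j | j <;> simp only [regWt] at h <;> simp only [wt] <;>
    split_ifs <;> omega

theorem isUpper_inv {w : Fin k ⊕ Fin k → ℤ} (hw : ∀ i, w i.swap = -w i) {g : Sp k F}
    (hg : IsUpper w (mat g)) : IsUpper w (mat g⁻¹) := by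
  intro i j h
  rw [inv_entry, hg _ _ (by rw [hw, hw]; linarith), mul_zero]

/-- Symplectic inverse transposition. -/
theorem mem_symplectic_of_eq {B : Matrix (Fin k ⊕ Fin k) (Fin k ⊕ Fin k) F}
    (hdet : IsUnit B.det)
    (h : B = -(Matrix.J (Fin k) F * (B⁻¹)ᵀ * Matrix.J (Fin k) F)) :
    B ∈ Matrix.symplecticGroup (Fin k) F := by
  rw [SymplecticGroup.mem_iff]
  have hJ := Matrix.J_squared (Fin k) F
  have h1 : B⁻¹ᵀ * Bᵀ = 1 := by
    rw [← Matrix.transpose_mul, Matrix.mul_nonsing_inv _ hdet, Matrix.transpose_one]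
  calc B * Matrix.J (Fin k) F * Bᵀ
      = -(Matrix.J (Fin k) F * (B⁻¹)ᵀ * Matrix.J (Fin k) F) * Matrix.J (Fin k) F * Bᵀ := by
        rw [← h]
    _ = Matrix.J (Fin k) F * (B⁻¹ᵀ * Bᵀ) := by
        rw [Matrix.neg_mul, Matrix.mul_assoc _ _ (Matrix.J (Fin k) F), hJ]
        simp [Matrix.mul_assoc]
    _ = _ := by rw [h1, Matrix.mul_one]

/-- The entries of the symplectic inverse transpose of `B`. -/
theorem symplectic_theta_entry (B : Matrix (Fin k ⊕ Fin k) (Fin k ⊕ Fin k) F)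
    (i j : Fin k ⊕ Fin k) :
    (-(Matrix.J (Fin k) F * Bᵀ * Matrix.J (Fin k) F)) i j =
      (if i.isLeft = j.isLeft then 1 else -1) * B j.swap i.swap := by
  rcases i with i | i <;> rcases j with j | j <;>
    simp [Matrix.mul_apply, Matrix.J, Fintype.sum_sum_type, Matrix.one_apply]

/-- The map θ(X) = -J X⁻ᵀ J is multiplicative, fixes the symplectic matrices, and preserves both the
unitary group and the triangular matrices with positive diagonal. So A = θ(B) θ(Q) is a second
factorisation of A = B Q; by uniqueness B = θ(B), which says that B is symplectic. -/
theorem triangular_factor_symplectic {A B Q : Matrix (Fin k ⊕ Fin k) (Fin k ⊕ Fin k) F}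
    (hA : A ∈ Matrix.symplecticGroup (Fin k) F) (hAB : A = B * Q)
    (hQ : Q ∈ Matrix.unitaryGroup (Fin k ⊕ Fin k) F) (hB : IsUpper (regWt k) B)
    (hpos : ∀ i, ∃ r : ℝ, 0 < r ∧ B i i = r) :
    B ∈ Matrix.symplecticGroup (Fin k) F := by
  set J := Matrix.J (Fin k) F with hJdef
  have hJ : J * J = -1 := Matrix.J_squared (Fin k) F
  have hdA : IsUnit A.det := SymplecticGroup.symplectic_det hA
  have hdB : IsUnit B.det := by
    rw [hAB, Matrix.det_mul] at hdA
    exact isUnit_of_mul_isUnit_left hdA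
  have hQs : star Q * Q = 1 := Matrix.mem_unitaryGroup_iff'.mp hQ
  have hQs' : Q * star Q = 1 := Matrix.mem_unitaryGroup_iff.mp hQ
  have hQinv : Q⁻¹ = star Q := Matrix.inv_eq_right_inv hQs'
  have hJmem : J ∈ Matrix.unitaryGroup (Fin k ⊕ Fin k) F := spJ_mem_maxCompact (k := k) (F := F)
  set θ : Matrix (Fin k ⊕ Fin k) (Fin k ⊕ Fin k) F → Matrix (Fin k ⊕ Fin k) (Fin k ⊕ Fin k) F :=
    fun X => -(J * (X⁻¹)ᵀ * J) with hθ
  have hθmul : ∀ X Y, θ (X * Y) = θ X * θ Y := by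
    intro X Y
    simp only [hθ, Matrix.mul_inv_rev, Matrix.transpose_mul, Matrix.neg_mul, Matrix.mul_neg,
      neg_neg]
    rw [Matrix.mul_assoc _ J, ← Matrix.mul_assoc J (J * _), ← Matrix.mul_assoc J J, hJ]
    simp [Matrix.mul_assoc]
  have hθA : θ A = A := by
    have := SymplecticGroup.inv_eq_symplectic_inv A hA
    simp only [hθ]
    rw [this, Matrix.transpose_mul, Matrix.transpose_mul, Matrix.transpose_transpose,
      Matrix.transpose_neg, Matrix.J_transpose, neg_neg]
    rw [show J * (-J * (A * J)) * J = -((J * J) * A * (J * J)) by simp [Matrix.mul_assoc], hJ]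
    simp
  have hθQ : θ Q ∈ Matrix.unitaryGroup (Fin k ⊕ Fin k) F := by
    have h1 : Qᵀ ∈ Matrix.unitaryGroup (Fin k ⊕ Fin k) F := by
      rw [Matrix.mem_unitaryGroup_iff]
      have : star Qᵀ = (star Q)ᵀ := by
        ext i j; simp [Matrix.star_apply]
      rw [this, ← Matrix.transpose_mul, hQs, Matrix.transpose_one]
    have h2 : θ Q = J * star Qᵀ * (star J) := by
      have h3 : star J = -J := by
        have h4 := Matrix.mem_unitaryGroup_iff.mp hJmem
        have h5 : J * (-J) = 1 := by rw [Matrix.mul_neg, hJ, neg_neg]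
        calc star J = (star J * J) * (-J) := by rw [Matrix.mul_assoc, h5, Matrix.mul_one]
          _ = -J := by rw [Matrix.mem_unitaryGroup_iff'.mp hJmem, Matrix.one_mul]
      have : star Qᵀ = (star Q)ᵀ := by
        ext i j; simp [Matrix.star_apply]
      rw [h3, Matrix.mul_neg, this, ← hQinv]
    rw [h2]
    exact mul_mem (mul_mem hJmem (Unitary.star_mem h1)) (Unitary.star_mem hJmem)
  have hθentry : ∀ X i j, θ X i j = (if i.isLeft = j.isLeft then 1 else -1) *
      X⁻¹ j.swap i.swap := fun X i j => symplectic_theta_entry X⁻¹ i j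
  have hinvup : IsUpper (regWt k) B⁻¹ := hB.inv hdB
  have hinvdiag : ∀ i, B i i * B⁻¹ i i = 1 := fun i => by
    rw [← mul_diag_of_isUpper regWt_injective hB hinvup, Matrix.mul_nonsing_inv _ hdB,
      Matrix.one_apply_eq]
  have hθB : IsUpper (regWt k) (θ B) := by
    intro i j h
    rw [hθentry, hinvup _ _ (by rw [regWt_swap, regWt_swap]; linarith),
      mul_zero]
  have hθBdiag : ∀ i, B i.swap i.swap * θ B i i = 1 := fun i => by
    rw [hθentry]
    simpa using hinvdiag i.swap
  have hdθB : IsUnit (θ B).det := by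
    have : IsUnit (θ B * θ Q).det := by rw [← hθmul, ← hAB, hθA]; exact hdA
    rw [Matrix.det_mul] at this
    exact isUnit_of_mul_isUnit_left this
  have hθinv : IsUpper (regWt k) (θ B)⁻¹ := hθB.inv hdθB
  have hθinvdiag : ∀ i, θ B i i * (θ B)⁻¹ i i = 1 := fun i => by
    rw [← mul_diag_of_isUpper regWt_injective hθB hθinv, Matrix.mul_nonsing_inv _ hdθB,
      Matrix.one_apply_eq]
  -- Comparison of the two factorisations: a triangular matrix with positive diagonal is equal to a
  -- unitary one.
  have heq : (θ B)⁻¹ * B = θ Q * star Q := by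
    have h1 : B * Q = θ B * θ Q := by rw [← hθmul, ← hAB, hθA]
    calc (θ B)⁻¹ * B = (θ B)⁻¹ * (B * Q) * star Q := by
          rw [Matrix.mul_assoc, Matrix.mul_assoc B, hQs', Matrix.mul_one]
      _ = _ := by rw [h1, ← Matrix.mul_assoc, Matrix.nonsing_inv_mul _ hdθB, Matrix.one_mul]
  have hT : (θ B)⁻¹ * B = 1 := by
    refine eq_one_of_isUpper_of_unitary regWt_injective (hθinv.mul hB) ?_ fun i => ?_
    · rw [heq]; exact mul_mem hθQ (Unitary.star_mem hQ)
    · obtain ⟨r, hr, h1⟩ := hpos i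
      obtain ⟨t, ht, h2⟩ := hpos i.swap
      refine ⟨t * r, mul_pos ht hr, ?_⟩
      rw [mul_diag_of_isUpper regWt_injective hθinv hB, h1, RCLike.ofReal_mul, ← h2]
      congr 1
      have h3 := hθinvdiag i
      have h4 := hθBdiag i
      calc (θ B)⁻¹ i i = B i.swap i.swap * θ B i i * (θ B)⁻¹ i i := by rw [h4, one_mul]
        _ = B i.swap i.swap := by rw [mul_assoc, h3, mul_one]
  refine mem_symplectic_of_eq hdB ?_
  change B = θ B
  calc B = θ B * ((θ B)⁻¹ * B) := by
        rw [← Matrix.mul_assoc, Matrix.mul_nonsing_inv _ hdθB, Matrix.one_mul]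
    _ = θ B := by rw [hT, Matrix.mul_one]

end Parabolic

/-! ### Levi decomposition of the parabolic subgroups -/

section Parabolic

variable {k : ℕ} {F : Type*} [RCLike F]

theorem mul_diagPart_inv {w : Fin k ⊕ Fin k → ℤ} (hw : ∀ i, w i.swap = -w i) {g : Sp k F}
    (hg : IsUpper w (mat g)) : diagPart w (mat g) * diagPart w (mat g⁻¹) = 1 := by
  rw [← diagPart_mul hg (isUpper_inv hw hg), ← mat_mul, mul_inv_cancel, mat_one, diagPart_one]

/-- The symplectic form pairs a weight only with its negative, so taking weight-preserving parts is
compatible with the formula g⁻¹ = -J gᵀ J. Multiplicativity of `diagPart` on triangular matrices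
then carries g g⁻¹ = 1 over to the diagonal part. -/
theorem diagPart_mem_symplecticGroup {w : Fin k ⊕ Fin k → ℤ} (hw : ∀ i, w i.swap = -w i)
    {g : Sp k F} (hg : IsUpper w (mat g)) :
    diagPart w (mat g) ∈ Matrix.symplecticGroup (Fin k) F := by
  have h2 : diagPart w (mat g⁻¹) =
      -(Matrix.J (Fin k) F * (diagPart w (mat g))ᵀ * Matrix.J (Fin k) F) := by
    ext i j
    rw [symplectic_theta_entry, diagPart_apply, diagPart_apply, inv_entry, hw, hw]
    by_cases h : w i = w j
    · simp [h]
    · have h' : ¬ (-w j = -w i) := fun h' => h (by linarith)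
      simp [h, h']
  rw [SymplecticGroup.mem_iff]
  have h3 := mul_diagPart_inv hw hg
  rw [h2] at h3
  calc diagPart w (mat g) * Matrix.J (Fin k) F * (diagPart w (mat g))ᵀ
      = diagPart w (mat g) * -(Matrix.J (Fin k) F * (diagPart w (mat g))ᵀ * Matrix.J (Fin k) F) *
          Matrix.J (Fin k) F := by
        simp only [Matrix.mul_neg, Matrix.neg_mul, Matrix.mul_assoc, Matrix.J_squared]
        simp
    _ = _ := by rw [h3, Matrix.one_mul]

/-- The weight-preserving part of an upper triangular element of `Sp(k, F)`. -/
def diagElt {w : Fin k ⊕ Fin k → ℤ} (hw : ∀ i, w i.swap = -w i) {g : Sp k F}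
    (hg : IsUpper w (mat g)) : Sp k F :=
  ⟨diagPart w (mat g), diagPart_mem_symplecticGroup hw hg⟩

theorem mat_diagElt {w : Fin k ⊕ Fin k → ℤ} (hw : ∀ i, w i.swap = -w i) {g : Sp k F}
    (hg : IsUpper w (mat g)) : mat (diagElt hw hg) = diagPart w (mat g) := rfl

theorem isUpper_diagPart (w : Fin k ⊕ Fin k → ℤ) (A : Matrix (Fin k ⊕ Fin k) (Fin k ⊕ Fin k) F) :
    IsUpper w (diagPart w A) := fun i j h => by rw [diagPart_apply, if_neg h.ne]

theorem mat_diagElt_inv {w : Fin k ⊕ Fin k → ℤ} (hw : ∀ i, w i.swap = -w i) {g : Sp k F}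
    (hg : IsUpper w (mat g)) : mat (diagElt hw hg)⁻¹ = diagPart w (mat g⁻¹) := by
  have h1 : mat (diagElt hw hg) * mat (diagElt hw hg)⁻¹ = 1 := by
    rw [← mat_mul, mul_inv_cancel, mat_one]
  have h2 := mul_diagPart_inv hw hg
  rw [← mat_diagElt hw hg] at h2
  have h3 : mat (diagElt hw hg)⁻¹ * mat (diagElt hw hg) = 1 := by
    rw [← mat_mul, inv_mul_cancel, mat_one]
  calc mat (diagElt hw hg)⁻¹
      = mat (diagElt hw hg)⁻¹ * (mat (diagElt hw hg) * diagPart w (mat g⁻¹)) := by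
        rw [h2, Matrix.mul_one]
    _ = _ := by rw [← Matrix.mul_assoc, h3, Matrix.one_mul]

theorem unipotent_mul_diagElt_inv {w : Fin k ⊕ Fin k → ℤ} (hw : ∀ i, w i.swap = -w i) {g : Sp k F}
    (hg : IsUpper w (mat g)) (i j : Fin k ⊕ Fin k) (h : w i ≤ w j) :
    mat (g * (diagElt hw hg)⁻¹) i j = (1 : Matrix _ _ F) i j := by
  have hD : IsUpper w (mat (diagElt hw hg)⁻¹) := by
    rw [mat_diagElt_inv]; exact isUpper_diagPart _ _
  rcases h.lt_or_eq with h | h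
  · rw [mat_mul, (hg.mul hD) i j h, Matrix.one_apply_ne fun e => h.ne (by rw [e])]
  · have h1 : diagPart w (mat (g * (diagElt hw hg)⁻¹)) = 1 := by
      rw [mat_mul, diagPart_mul hg hD, mat_diagElt_inv]
      have : diagPart w (diagPart w (mat g⁻¹)) = diagPart w (mat g⁻¹) := by
        ext i j
        simp only [diagPart_apply]
        split_ifs <;> rfl
      rw [this, mul_diagPart_inv hw hg]
    have h2 := congrFun (congrFun h1 i) j
    rwa [diagPart_apply, if_pos h] at h2

/-- The parabolic subgroup `P = M U` for `s = 1`, and `P̄ = M Ū` for `s = -1`. -/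
def par (k k₁ : ℕ) (F : Type*) [RCLike F] (s : ℤ) : Subgroup (Sp k F) where
  carrier := {g | IsUpper (fun i => s * wt k k₁ i) (mat g)}
  one_mem' := fun i j h => by
    rw [mat_one, Matrix.one_apply_ne fun e => h.ne (by rw [e])]
  mul_mem' := fun ha hb => ha.mul hb
  inv_mem' := fun hg => isUpper_inv (fun i => by rw [wt_swap]; ring) hg

theorem levi_le_par (k₁ : ℕ) (s : ℤ) : levi k k₁ F ≤ par k k₁ F s := by
  intro g hg i j h
  exact hg i j fun e => h.ne (by simp only [e])

theorem unip_le_par (k₁ : ℕ) (s : ℤ) : unip k k₁ F s ≤ par k k₁ F s := by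
  intro g hg i j h
  rw [hg i j h.le, Matrix.one_apply_ne fun e => h.ne (by rw [e])]

theorem isClosed_par (k₁ : ℕ) (s : ℤ) : IsClosed (par k k₁ F s : Set (Sp k F)) := by
  have : (par k k₁ F s : Set (Sp k F)) = ⋂ i, ⋂ j, {g | s * wt k k₁ i < s * wt k k₁ j →
      mat g i j = 0} := by
    ext g; simp only [Set.mem_iInter]; rfl
  rw [this]
  refine isClosed_iInter fun i => isClosed_iInter fun j => ?_
  by_cases h : s * wt k k₁ i < s * wt k k₁ j
  · simpa only [h, true_imp_iff] using isClosed_eq (continuous_entry (F := F) i j) continuous_const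
  · simp only [h, false_imp_iff, Set.ofPred_true, isClosed_univ]

instance instLocallyCompactPar (k₁ : ℕ) (s : ℤ) : LocallyCompactSpace (par k k₁ F s) :=
  (isClosed_par k₁ s).isClosedEmbedding_subtypeVal.locallyCompactSpace

theorem smul_wt_swap (k₁ : ℕ) (s : ℤ) (i : Fin k ⊕ Fin k) :
    s * wt k k₁ i.swap = -(s * wt k k₁ i) := by rw [wt_swap]; ring

/-- The Levi component of an element of the parabolic subgroup. -/
def leviPart {k₁ : ℕ} {s : ℤ} (hs : s ≠ 0) (p : par k k₁ F s) : levi k k₁ F :=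
  ⟨diagElt (smul_wt_swap k₁ s) p.2, fun i j h => by
    change diagPart _ (mat (p : Sp k F)) i j = 0
    rw [diagPart_apply, if_neg fun e => h (mul_left_cancel₀ hs e)]⟩

/-- The unipotent component of an element of the parabolic subgroup. -/
def unipPart {k₁ : ℕ} {s : ℤ} (hs : s ≠ 0) (p : par k k₁ F s) : unip k k₁ F s :=
  ⟨p * (leviPart hs p : Sp k F)⁻¹, unipotent_mul_diagElt_inv (smul_wt_swap k₁ s) p.2⟩

theorem unipPart_mul_leviPart {k₁ : ℕ} {s : ℤ} (hs : s ≠ 0) (p : par k k₁ F s) :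
    (unipPart hs p : Sp k F) * leviPart hs p = p := by
  simp [unipPart]

theorem leviPart_mul {k₁ : ℕ} {s : ℤ} (hs : s ≠ 0) (p q : par k k₁ F s) :
    leviPart hs (p * q) = leviPart hs p * leviPart hs q := by
  refine Subtype.ext (Subtype.ext ?_)
  exact diagPart_mul p.2 q.2

theorem leviPart_unip {k₁ : ℕ} {s : ℤ} (hs : s ≠ 0) (u : unip k k₁ F s) :
    leviPart hs ⟨(u : Sp k F), unip_le_par k₁ s u.2⟩ = 1 := by
  refine Subtype.ext (Subtype.ext ?_)
  change diagPart _ (mat (u : Sp k F)) = 1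
  rw [← diagPart_one (fun i => s * wt k k₁ i)]
  ext i j
  rw [diagPart_apply, diagPart_apply]
  split_ifs with h
  · exact u.2 i j h.le
  · rfl

theorem leviPart_levi {k₁ : ℕ} {s : ℤ} (hs : s ≠ 0) (m : levi k k₁ F) :
    leviPart hs ⟨(m : Sp k F), levi_le_par k₁ s m.2⟩ = m := by
  refine Subtype.ext (Subtype.ext ?_)
  change diagPart _ (mat (m : Sp k F)) = mat (m : Sp k F)
  ext i j
  rw [diagPart_apply]
  split_ifs with h
  · rfl
  · exact (m.2 i j fun e => h (by simp only [e])).symm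

/-- A unitary element of a parabolic subgroup lies in the Levi subgroup. -/
theorem mem_levi_of_mem_par_of_mem_maxCompact {k₁ : ℕ} {s : ℤ} (hs : s ≠ 0) {g : Sp k F}
    (hp : g ∈ par k k₁ F s) (hK : g ∈ maxCompact k F) : g ∈ levi k k₁ F := by
  have h1 : mat g⁻¹ = star (mat g) :=
    (SymplecticGroup.coe_inv' g).trans
      (Matrix.inv_eq_left_inv (Matrix.mem_unitaryGroup_iff'.mp hK))
  intro i j hij
  rcases lt_trichotomy (s * wt k k₁ i) (s * wt k k₁ j) with h | h | h
  · exact hp i j h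
  · exact absurd (mul_left_cancel₀ hs h) hij
  · have h2 := ((par k k₁ F s).inv_mem hp) j i h
    rw [h1, Matrix.star_apply, star_eq_zero] at h2
    exact h2

end Parabolic

/-! ### Smooth maps and the smooth Iwasawa decomposition -/

section SmoothMaps

variable {X Y E E' : Type*} [TopologicalSpace X] [TopologicalSpace Y]
  [NormedAddCommGroup E] [NormedSpace ℝ E] [NormedAddCommGroup E'] [NormedSpace ℝ E']

/-- Smoothness of a map between submanifolds of real vector spaces. -/
def SmoothMapAlong (ι : X → E) (ι' : Y → E') (τ : X → Y) : Prop :=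
  ∀ x, ∃ T : E → E', ContDiffAt ℝ ∞ T (ι x) ∧ ∀ᶠ y in 𝓝 x, ι' (τ y) = T (ι y)

theorem SmoothMapAlong.continuous {ι : X → E} {ι' : Y → E'} {τ : X → Y}
    (h : SmoothMapAlong ι ι' τ) (hι : Continuous ι) (hι' : IsInducing ι') : Continuous τ := by
  rw [hι'.continuous_iff, continuous_iff_continuousAt]
  intro x
  obtain ⟨T, hT, hx⟩ := h x
  exact (hT.continuousAt.comp hι.continuousAt).congr (hx.mono fun y hy => hy.symm)

theorem SmoothAlong.comp {ι : X → E} {ι' : Y → E'} {τ : X → Y} {f : Y → ℂ}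
    (hf : SmoothAlong ι' f) (h : SmoothMapAlong ι ι' τ) (hτ : Continuous τ) :
    SmoothAlong ι fun x => f (τ x) := by
  intro x
  obtain ⟨T, hT, hx⟩ := h x
  obtain ⟨f', hf', hfx⟩ := hf (τ x)
  refine ⟨f' ∘ T, ContDiffAt.comp (ι x) ?_ hT, ?_⟩
  · rw [← hx.self_of_nhds]; exact hf'
  · filter_upwards [hx, hτ.continuousAt.eventually hfx] with y h1 h2
    rw [h2, h1, Function.comp_apply]

theorem SmoothAlong.mul {ι : X → E} {f g : X → ℂ} (hf : SmoothAlong ι f) (hg : SmoothAlong ι g) :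
    SmoothAlong ι fun x => f x * g x := by
  intro x
  obtain ⟨a, ha, ha'⟩ := hf x
  obtain ⟨b, hb, hb'⟩ := hg x
  exact ⟨fun e => a e * b e, ha.mul hb, by filter_upwards [ha', hb'] with y h1 h2; rw [h1, h2]⟩

theorem SmoothAlong.sum {ι : X → E} {α : Type*} {f : α → X → ℂ} (s : Finset α)
    (hf : ∀ i ∈ s, SmoothAlong ι (f i)) : SmoothAlong ι fun x => ∑ i ∈ s, f i x := by
  classical
  induction s using Finset.induction_on with
  | empty => exact fun x => ⟨fun _ => 0, contDiffAt_const, by simp⟩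
  | insert a s ha ih =>
    intro x
    obtain ⟨p, hp, hp'⟩ := hf a (Finset.mem_insert_self a s) x
    obtain ⟨q, hq, hq'⟩ := ih (fun i hi => hf i (Finset.mem_insert_of_mem hi)) x
    refine ⟨fun e => p e + q e, hp.add hq, ?_⟩
    filter_upwards [hp', hq'] with y h1 h2
    rw [Finset.sum_insert ha, h1, h2]

theorem smoothAlong_const (ι : X → E) (c : ℂ) : SmoothAlong ι fun _ => c :=
  fun _ => ⟨fun _ => c, contDiffAt_const, by simp⟩

theorem SmoothAlong.continuous {ι : X → E} {f : X → ℂ} (h : SmoothAlong ι f)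
    (hι : Continuous ι) : Continuous f := by
  rw [continuous_iff_continuousAt]
  intro x
  obtain ⟨T, hT, hx⟩ := h x
  exact (hT.continuousAt.comp hι.continuousAt).congr (hx.mono fun y hy => hy.symm)

end SmoothMaps

/-! ### Iwasawa decompositions of Sp(k, F) -/

section Iwasawa

variable {k : ℕ} {F : Type*} [RCLike F]

/-- The unitary factor of an invertible matrix, as a smooth function of its entries. -/
def unitaryFactor (k : ℕ) (F : Type*) [RCLike F] :
    (Fin k ⊕ Fin k → Fin k ⊕ Fin k → F) → Fin k ⊕ Fin k → Fin k ⊕ Fin k → F :=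
  (exists_smooth_unitary_factor (F := F) (regWt k) regWt_injective).choose

theorem unitaryFactor_spec (g : Sp k F) :
    ContDiffAt ℝ ∞ (unitaryFactor k F) (entries g) ∧
      Matrix.of (unitaryFactor k F (entries g)) ∈ Matrix.unitaryGroup (Fin k ⊕ Fin k) F ∧
      IsUpper (regWt k) (mat g * star (Matrix.of (unitaryFactor k F (entries g)))) ∧
      ∀ i, ∃ r : ℝ, 0 < r ∧
        (mat g * star (Matrix.of (unitaryFactor k F (entries g)))) i i = r :=
  (exists_smooth_unitary_factor (F := F) (regWt k) regWt_injective).choose_spec (entries g)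
    (SymplecticGroup.symplectic_det g.2)

theorem unitaryFactor_mem (g : Sp k F) :
    Matrix.of (unitaryFactor k F (entries g)) ∈ Matrix.symplecticGroup (Fin k) F := by
  obtain ⟨-, hQ, hB, hpos⟩ := unitaryFactor_spec g
  set Q := Matrix.of (unitaryFactor k F (entries g))
  have hAB : mat g = mat g * star Q * Q := by
    rw [Matrix.mul_assoc, Matrix.mem_unitaryGroup_iff'.mp hQ, Matrix.mul_one]
  have hBm := triangular_factor_symplectic g.2 hAB hQ hB hpos
  let b : Sp k F := ⟨_, hBm⟩
  have h1 : Q = mat (b⁻¹ * g) := by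
    have h2 : mat b⁻¹ * mat b = 1 := by rw [← mat_mul, inv_mul_cancel, mat_one]
    calc Q = mat b⁻¹ * mat b * Q := by rw [h2, Matrix.one_mul]
      _ = mat b⁻¹ * mat g := by rw [Matrix.mul_assoc]; exact congrArg _ hAB.symm
  rw [h1]
  exact (b⁻¹ * g).2

/-- The component in `K` of the Iwasawa decomposition. -/
def iwaK (g : Sp k F) : maxCompact k F :=
  ⟨⟨_, unitaryFactor_mem g⟩, (unitaryFactor_spec g).2.1⟩

theorem entries_iwaK (g : Sp k F) :
    entries (iwaK g : Sp k F) = unitaryFactor k F (entries g) := rfl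

theorem mat_inv_of_mem_maxCompact {g : Sp k F} (hg : g ∈ maxCompact k F) :
    mat g⁻¹ = star (mat g) :=
  (SymplecticGroup.coe_inv' g).trans (Matrix.inv_eq_left_inv (Matrix.mem_unitaryGroup_iff'.mp hg))

/-- The triangular component of the Iwasawa decomposition. -/
def iwaB (g : Sp k F) : Sp k F := g * (iwaK g : Sp k F)⁻¹

theorem iwaB_mul_iwaK (g : Sp k F) : iwaB g * iwaK g = g := by simp [iwaB]

theorem mat_iwaB (g : Sp k F) :
    mat (iwaB g) = mat g * star (Matrix.of (unitaryFactor k F (entries g))) := by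
  rw [iwaB, mat_mul, mat_inv_of_mem_maxCompact (iwaK g).2]
  rfl

theorem isUpper_iwaB (g : Sp k F) : IsUpper (regWt k) (mat (iwaB g)) := by
  rw [mat_iwaB]; exact (unitaryFactor_spec g).2.2.1

theorem iwaB_mem_par (k₁ : ℕ) (g : Sp k F) : iwaB g ∈ par k k₁ F 1 := by
  intro i j h
  refine isUpper_iwaB g i j ?_
  by_contra h'
  have := wt_mono (k₁ := k₁) (not_lt.mp h')
  simp only [one_mul] at h
  omega

/-- The component in `M` of the Iwasawa decomposition. -/
def iwaM (k₁ : ℕ) (g : Sp k F) : levi k k₁ F :=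
  leviPart one_ne_zero ⟨iwaB g, iwaB_mem_par k₁ g⟩

/-- The component in `U` of the Iwasawa decomposition. -/
def iwaU (k₁ : ℕ) (g : Sp k F) : unip k k₁ F 1 :=
  unipPart one_ne_zero ⟨iwaB g, iwaB_mem_par k₁ g⟩

theorem iwasawa (k₁ : ℕ) (g : Sp k F) :
    (iwaU k₁ g : Sp k F) * iwaM k₁ g * iwaK g = g := by
  rw [iwaU, iwaM, unipPart_mul_leviPart]
  exact iwaB_mul_iwaK g

theorem smoothMap_iwaK :
    SmoothMapAlong entries entries fun g : Sp k F => (iwaK g : Sp k F) :=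
  fun g => ⟨unitaryFactor k F, (unitaryFactor_spec g).1, Filter.Eventually.of_forall entries_iwaK⟩

theorem continuous_iwaK : Continuous fun g : Sp k F => (iwaK g : Sp k F) :=
  smoothMap_iwaK.continuous continuous_entries isInducing_entries

theorem smoothMap_iwaM (k₁ : ℕ) :
    SmoothMapAlong entries (fun m : levi k k₁ F => entries (m : Sp k F))
      fun g : Sp k F => iwaM k₁ g := by
  intro g
  refine ⟨fun e i j => if 1 * wt k k₁ i = 1 * wt k k₁ j then
    ∑ x, e i x * star (unitaryFactor k F e j x) else 0, ?_, Filter.Eventually.of_forall fun h => ?_⟩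
  · refine contDiffAt_pi.mpr fun i => contDiffAt_pi.mpr fun j => ?_
    split_ifs
    · refine ContDiffAt.sum fun x _ => ?_
      refine (contDiff_apply_apply ℝ F i x).contDiffAt.mul ?_
      refine (starL' ℝ (A := F)).contDiff.contDiffAt.comp _ ?_
      exact contDiffAt_pi.mp (contDiffAt_pi.mp (unitaryFactor_spec g).1 j) x
    · exact contDiffAt_const
  · funext i j
    change diagPart _ (mat (iwaB h)) i j = _
    rw [diagPart_apply, mat_iwaB, Matrix.mul_apply]
    rfl

theorem continuous_iwaM (k₁ : ℕ) : Continuous fun g : Sp k F => iwaM k₁ g :=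
  (smoothMap_iwaM k₁).continuous continuous_entries
    (isInducing_entries.comp IsInducing.subtypeVal)

theorem spJ_conj_mem_levi {k₁ : ℕ} {m : Sp k F} (hm : m ∈ levi k k₁ F) :
    spJ k F * m * (spJ k F)⁻¹ ∈ levi k k₁ F := by
  intro i j h
  rw [spJ_conj_entry, hm _ _ (by rw [wt_swap, wt_swap]; omega), mul_zero]

theorem spJ_conj_mem_unip {k₁ : ℕ} {s : ℤ} {u : Sp k F} (hu : u ∈ unip k k₁ F s) :
    spJ k F * u * (spJ k F)⁻¹ ∈ unip k k₁ F (-s) := by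
  intro i j h
  rw [spJ_conj_entry, hu _ _ (by rw [wt_swap, wt_swap]; linarith)]
  by_cases e : i = j
  · subst e; simp
  · have : i.swap ≠ j.swap := fun e' => e (Sum.swap_leftInverse.injective e')
    rw [Matrix.one_apply_ne this, Matrix.one_apply_ne e, mul_zero]

/-- The Iwasawa decomposition `G = M Ū K` for the opposite parabolic subgroup. -/
theorem exists_opposite_iwasawa (k₁ : ℕ) (g : Sp k F) :
    ∃ (m : levi k k₁ F) (u : unip k k₁ F (-1)) (x : maxCompact k F),
      (m : Sp k F) * u * x = g := by
  set J := spJ k F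
  -- Conjugation by J preserves M and K and carries U into Ū, so a decomposition of J⁻¹ g J along P
  -- yields one of g along P̄.
  have hd := iwasawa k₁ (J⁻¹ * g * J)
  set u := iwaU k₁ (J⁻¹ * g * J)
  set m := iwaM k₁ (J⁻¹ * g * J)
  set x := iwaK (J⁻¹ * g * J)
  have hu : J * u * J⁻¹ ∈ unip k k₁ F (-1) := spJ_conj_mem_unip u.2
  have hm : J * m * J⁻¹ ∈ levi k k₁ F := spJ_conj_mem_levi m.2
  have hp : J * u * J⁻¹ * (J * m * J⁻¹) ∈ par k k₁ F (-1) :=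
    mul_mem (unip_le_par k₁ _ hu) (levi_le_par k₁ _ hm)
  -- The factors obtained stand in the order Ū M. The order M Ū results from decomposing the inverse
  -- of their product and inverting again.
  have hp' := inv_mem hp
  have hdec := unipPart_mul_leviPart (by norm_num) (⟨_, hp'⟩ : par k k₁ F (-1))
  refine ⟨(leviPart (by norm_num) ⟨_, hp'⟩)⁻¹, (unipPart (by norm_num) ⟨_, hp'⟩)⁻¹,
    ⟨J * x * J⁻¹, mul_mem (mul_mem spJ_mem_maxCompact x.2) (inv_mem spJ_mem_maxCompact)⟩, ?_⟩
  rw [Subgroup.coe_inv, Subgroup.coe_inv, ← _root_.mul_inv_rev, hdec]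
  simp only [inv_inv]
  calc J * u * J⁻¹ * (J * m * J⁻¹) * (J * x * J⁻¹) = J * (u * m * x) * J⁻¹ := by group
    _ = g := by rw [hd]; group

end Iwasawa

/-! ### Unimodularity -/

section Modular

open Measure
open scoped NNReal Pointwise

variable {Γ : Type*} [Group Γ] [TopologicalSpace Γ] [IsTopologicalGroup Γ] [LocallyCompactSpace Γ]
  [SecondCountableTopology Γ]

theorem map_mul_right_eq_modularCharacter_smul [MeasurableSpace Γ] [BorelSpace Γ] (μ : Measure Γ)
    [μ.IsHaarMeasure] (g : Γ) : μ.map (· * g) = modularCharacter g • μ := by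
  have := isMulLeftInvariant_eq_smul (μ.map (· * g)) μ
  rw [this]
  congr 1
  exact (modularCharacterFun_eq_haarScalarFactor μ g).symm

/-- The translates of a compact neighbourhood E by inverses of elements of C stay in the compact set
E C⁻¹, so the scaling factor is at most μ(E C⁻¹) / μ(E). With multiplicativity, this bound is enough
for the triviality results below. -/
theorem modularCharacter_bddAbove_of_isCompact {C : Set Γ} (hC : IsCompact C) :
    ∃ B : ℝ≥0, ∀ g ∈ C, modularCharacter g ≤ B := by
  borelize Γ
  obtain ⟨E, hE, hE1⟩ := exists_compact_mem_nhds (1 : Γ)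
  let μ : Measure Γ := haar
  have hpos : 0 < μ E := measure_pos_of_mem_nhds μ hE1
  have hfin : μ E < ⊤ := hE.measure_lt_top
  have hfin' : μ (E * C⁻¹) < ⊤ := (hE.mul hC.inv).measure_lt_top
  refine ⟨(μ (E * C⁻¹) / μ E).toNNReal, fun g hg => ?_⟩
  have h1 : modularCharacter g * μ E ≤ μ (E * C⁻¹) := by
    have h2 := congrArg (fun ν : Measure Γ => ν E) (map_mul_right_eq_modularCharacter_smul μ g)
    simp only [Measure.smul_apply] at h2
    change _ = (modularCharacter g : ENNReal) * μ E at h2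
    rw [← h2]
    have h3 : μ.map (· * g) E = μ ((· * g) ⁻¹' E) :=
      (Homeomorph.mulRight g).toMeasurableEquiv.map_apply E
    rw [h3]
    refine measure_mono fun x hx => ?_
    exact ⟨x * g, hx, g⁻¹, Set.inv_mem_inv.mpr hg, by simp⟩
  rw [← ENNReal.coe_le_coe, ENNReal.coe_toNNReal (ENNReal.div_lt_top hfin'.ne hpos.ne').ne]
  exact (ENNReal.le_div_iff_mul_le (Or.inl hpos.ne') (Or.inl hfin.ne)).mpr h1

/-- An automorphism carries Haar measure to Haar measure and intertwines translation by `g` with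
translation by `φ g`, so the scaling factors agree. -/
theorem modularCharacter_map (φ : Γ ≃ₜ* Γ) (g : Γ) :
    modularCharacter (φ g) = modularCharacter g := by
  borelize Γ
  let μ : Measure Γ := haar
  have hφ : Measurable φ := φ.continuous.measurable
  have : (μ.map φ).IsHaarMeasure := φ.isHaarMeasure_map μ
  have h1 := map_mul_right_eq_modularCharacter_smul (μ.map φ) (φ g)
  have h2 : (μ.map φ).map (· * φ g) = modularCharacter g • μ.map φ := by
    rw [Measure.map_map (measurable_mul_const _) hφ]
    have : (fun x => x * φ g) ∘ φ = φ ∘ fun x => x * g := by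
      funext x; simp
    rw [this, ← Measure.map_map hφ (measurable_mul_const _),
      map_mul_right_eq_modularCharacter_smul μ g, Measure.map_smul]
  rw [h1] at h2
  obtain ⟨E, hE, hE1⟩ := exists_compact_mem_nhds (1 : Γ)
  have hpos : μ.map φ E ≠ 0 := (measure_pos_of_mem_nhds _ hE1).ne'
  have hfin : μ.map φ E ≠ ⊤ := hE.measure_lt_top.ne
  have h3 := congrArg (fun ν : Measure Γ => ν E) h2
  change (modularCharacter (φ g) : ENNReal) * _ = (modularCharacter g : ENNReal) * _ at h3
  exact ENNReal.coe_injective ((ENNReal.mul_left_inj hpos hfin).mp h3)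

theorem isMulRightInvariant_of_modularCharacter_eq_one [MeasurableSpace Γ] [BorelSpace Γ]
    (μ : Measure Γ) [μ.IsHaarMeasure] (h : ∀ g : Γ, modularCharacter g = 1) :
    μ.IsMulRightInvariant :=
  ⟨fun g => by rw [map_mul_right_eq_modularCharacter_smul, h, one_smul]⟩

theorem le_one_of_forall_pow_le {x B : ℝ≥0} (h : ∀ n : ℕ, x ^ n ≤ B) : x ≤ 1 := by
  by_contra hx
  obtain ⟨n, hn⟩ := pow_unbounded_of_one_lt B (not_le.mp hx)
  exact absurd (h n) (not_le.mpr hn)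

theorem modularCharacter_eq_one_of_forall_le_one {S : Subgroup Γ}
    (h : ∀ x ∈ S, modularCharacter x ≤ 1) (x : Γ) (hx : x ∈ S) : modularCharacter x = 1 := by
  refine le_antisymm (h x hx) ?_
  have h1 := h x⁻¹ (S.inv_mem hx)
  have h2 : modularCharacter x * modularCharacter x⁻¹ = 1 := by
    rw [← map_mul, mul_inv_cancel, map_one]
  calc (1 : ℝ≥0) = modularCharacter x * modularCharacter x⁻¹ := h2.symm
    _ ≤ modularCharacter x * 1 := by gcongr
    _ = _ := mul_one _

theorem modularCharacter_eq_one_of_isCompact {S : Subgroup Γ} (hS : IsCompact (S : Set Γ))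
    (x : Γ) (hx : x ∈ S) : modularCharacter x = 1 := by
  obtain ⟨B, hB⟩ := modularCharacter_bddAbove_of_isCompact hS
  refine modularCharacter_eq_one_of_forall_le_one (S := S) (fun y hy => ?_) x hx
  refine le_one_of_forall_pow_le (B := B) fun n => ?_
  rw [← map_pow]
  exact hB _ (S.pow_mem hy n)

/-- The character is invariant under conjugation and bounded near 1. Contraction therefore bounds it
by one constant on all of `S`, in particular on all powers of a given element, and this forces it to
be trivial. -/
theorem modularCharacter_eq_one_of_contracted {S : Subgroup Γ} (a : ℕ → Γ)
    (ha : ∀ x ∈ S, Filter.Tendsto (fun n => a n * x * (a n)⁻¹) Filter.atTop (𝓝 1))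
    (x : Γ) (hx : x ∈ S) : modularCharacter x = 1 := by
  obtain ⟨E, hE, hE1⟩ := exists_compact_mem_nhds (1 : Γ)
  obtain ⟨B, hB⟩ := modularCharacter_bddAbove_of_isCompact hE
  have hconj : ∀ b y : Γ, modularCharacter (b * y * b⁻¹) = modularCharacter y := by
    intro b y
    rw [map_mul, map_mul, mul_comm (modularCharacter b), mul_assoc, ← map_mul, mul_inv_cancel,
      map_one, mul_one]
  refine modularCharacter_eq_one_of_forall_le_one (S := S) (fun y hy => ?_) x hx
  refine le_one_of_forall_pow_le (B := B) fun n => ?_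
  rw [← map_pow]
  obtain ⟨N, hN⟩ := ((ha _ (S.pow_mem hy n)).eventually hE1).exists
  rw [← hconj (a N)]
  exact hB _ hN

end Modular

/-! ### Unimodularity of the Levi subgroup and of Sp(k, F) -/

section LeviUnimodular

variable {k : ℕ} {F : Type*} [RCLike F]

theorem diagonal_mem_symplecticGroup {d : Fin k ⊕ Fin k → F} (hd : ∀ i, d i * d i.swap = 1) :
    Matrix.diagonal d ∈ Matrix.symplecticGroup (Fin k) F := by
  rw [SymplecticGroup.mem_iff, Matrix.diagonal_transpose]
  ext i j
  rw [Matrix.mul_diagonal, Matrix.diagonal_mul]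
  rcases i with i | i <;> rcases j with j | j <;>
    simp only [Matrix.J, Matrix.fromBlocks_apply₁₁, Matrix.fromBlocks_apply₁₂,
      Matrix.fromBlocks_apply₂₁, Matrix.fromBlocks_apply₂₂, Matrix.zero_apply, mul_zero, zero_mul,
      Matrix.neg_apply, Matrix.one_apply] <;> split_ifs with h
  · subst h
    have := hd (Sum.inl i)
    simp only [Sum.swap_inl] at this
    linear_combination -this
  · simp
  · subst h
    have := hd (Sum.inr i)
    simp only [Sum.swap_inr] at this
    linear_combination this
  · simp

/-- The element `diag(r^w)` of the diagonal torus, for the regular weight `w`. -/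
def torus (k : ℕ) (F : Type*) [RCLike F] (r : F) (hr : r ≠ 0) : Sp k F :=
  ⟨Matrix.diagonal fun i => r ^ regWt k i, diagonal_mem_symplecticGroup fun i => by
    rw [regWt_swap, ← zpow_add₀ hr, add_neg_cancel, zpow_zero]⟩

theorem torus_conj_entry (r : F) (hr : r ≠ 0) (g : Sp k F) (i j : Fin k ⊕ Fin k) :
    mat (torus k F r hr * g * (torus k F r hr)⁻¹) i j = r ^ (regWt k i - regWt k j) * mat g i j := by
  have hinv : mat (torus k F r hr)⁻¹ = Matrix.diagonal fun i => r ^ (-regWt k i) := by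
    ext i j
    rw [inv_entry]
    change _ * Matrix.diagonal (fun i => r ^ regWt k i) j.swap i.swap = _
    by_cases h : i = j
    · subst h; simp [regWt_swap]
    · have : j.swap ≠ i.swap := fun e' => h (Sum.swap_leftInverse.injective e').symm
      rw [Matrix.diagonal_apply_ne _ this, Matrix.diagonal_apply_ne _ h, mul_zero]
  rw [mat_mul, mat_mul, hinv, Matrix.mul_diagonal]
  change (Matrix.diagonal (fun i => r ^ regWt k i) * mat g) i j * _ = _
  rw [Matrix.diagonal_mul, sub_eq_add_neg, zpow_add₀ hr]
  ring

theorem torus_mem_levi (k₁ : ℕ) (r : F) (hr : r ≠ 0) : torus k F r hr ∈ levi k k₁ F := by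
  intro i j h
  exact Matrix.diagonal_apply_ne _ fun e => h (by rw [e])

theorem two_zpow_ne (n : ℕ) : ((2 : F) ^ (-(n : ℤ))) ≠ 0 := zpow_ne_zero _ two_ne_zero

theorem tendsto_torus_conj {g : Sp k F}
    (hg : ∀ i j, regWt k i ≤ regWt k j → mat g i j = (1 : Matrix _ _ F) i j) :
    Filter.Tendsto (fun n : ℕ => torus k F _ (two_zpow_ne n) * g * (torus k F _ (two_zpow_ne n))⁻¹)
      Filter.atTop (𝓝 1) := by
  rw [isInducing_entries.tendsto_nhds_iff]
  refine tendsto_pi_nhds.mpr fun i => tendsto_pi_nhds.mpr fun j => ?_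
  have h1 : ∀ n : ℕ, (entries ∘ fun n : ℕ => torus k F _ (two_zpow_ne n) * g *
      (torus k F _ (two_zpow_ne n))⁻¹) n i j =
      ((2 : F) ^ (-(n : ℤ))) ^ (regWt k i - regWt k j) * mat g i j := fun n =>
    torus_conj_entry _ _ g i j
  simp only [h1]
  change Filter.Tendsto _ _ (𝓝 ((1 : Matrix _ _ F) i j))
  by_cases h : regWt k i ≤ regWt k j
  · rw [hg i j h]
    by_cases e : i = j
    · subst e; simp
    · simp [Matrix.one_apply_ne e]
  · rw [Matrix.one_apply_ne fun e => h (by rw [e])]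
    obtain ⟨d, hd⟩ : ∃ d : ℕ, regWt k i - regWt k j = d + 1 :=
      ⟨(regWt k i - regWt k j - 1).toNat, by omega⟩
    have h2 : Filter.Tendsto (fun n : ℕ => (((2 : F)⁻¹ ^ (d + 1)) ^ n) * mat g i j)
        Filter.atTop (𝓝 (0 * mat g i j)) := by
      refine Filter.Tendsto.mul_const _ (tendsto_pow_atTop_nhds_zero_of_norm_lt_one ?_)
      rw [norm_pow, norm_inv, RCLike.norm_ofNat]
      exact pow_lt_one₀ (by norm_num) (by norm_num) (by omega)
    rw [zero_mul] at h2
    refine h2.congr fun n => ?_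
    rw [hd]
    congr 1
    rw [show (d : ℤ) + 1 = ((d + 1 : ℕ) : ℤ) by push_cast; rfl, zpow_natCast, _root_.zpow_neg,
      zpow_natCast, ← inv_pow, ← pow_mul, ← pow_mul, mul_comm]

/-- Conjugation by `J`, as an automorphism of the Levi subgroup. -/
def leviConjJ (k k₁ : ℕ) (F : Type*) [RCLike F] : levi k k₁ F ≃ₜ* levi k k₁ F where
  toFun m := ⟨spJ k F * m * (spJ k F)⁻¹, spJ_conj_mem_levi m.2⟩
  invFun m := ⟨(spJ k F)⁻¹ * m * spJ k F, by
    have h1 : (spJ k F)⁻¹ = spJ k F * (spJ k F * spJ k F)⁻¹ := by group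
    -- J² = -1 is central, so conjugation by J⁻¹ agrees with conjugation by J.
    have h2 : mat (spJ k F * spJ k F) = -1 := Matrix.J_squared _ _
    have h3 : ∀ g : Sp k F, (spJ k F * spJ k F)⁻¹ * g * (spJ k F * spJ k F) = g := by
      intro g
      rw [mul_assoc, inv_mul_eq_iff_eq_mul]
      refine Subtype.ext ?_
      change mat g * mat (spJ k F * spJ k F) = mat (spJ k F * spJ k F) * mat g
      rw [h2, Matrix.mul_neg, Matrix.neg_mul, Matrix.mul_one, Matrix.one_mul]
    have h4 : (spJ k F)⁻¹ * m * spJ k F = spJ k F * m * (spJ k F)⁻¹ := by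
      conv_rhs => rw [← h3 (spJ k F * m * (spJ k F)⁻¹)]
      group
    rw [h4]
    exact spJ_conj_mem_levi m.2⟩
  left_inv m := by ext1; simp only; group
  right_inv m := by ext1; simp only; group
  map_mul' a b := by ext1; simp only [Subgroup.coe_mul]; group
  continuous_toFun := by fun_prop
  continuous_invFun := by fun_prop

/-- The Iwasawa factors of m lie in M, and m = n d κ with n triangular unipotent, d diagonal and κ
in K ∩ M. The torus contracts n to 1; conjugation by J inverts d, so the positive value at d is its
own inverse; κ lies in a compact subgroup. -/
theorem levi_modularCharacter_eq_one {k₁ : ℕ} (m : levi k k₁ F) :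
    Measure.modularCharacter m = 1 := by
  have hb : iwaB (m : Sp k F) ∈ par k k₁ F 1 := iwaB_mem_par k₁ _
  have hdec := iwaB_mul_iwaK (m : Sp k F)
  have hκ : (iwaK (m : Sp k F) : Sp k F) ∈ levi k k₁ F := by
    refine mem_levi_of_mem_par_of_mem_maxCompact one_ne_zero (s := 1) ?_ (iwaK (m : Sp k F)).2
    have : (iwaK (m : Sp k F) : Sp k F) = (iwaB (m : Sp k F))⁻¹ * m := by
      rw [eq_inv_mul_iff_mul_eq, hdec]
    rw [this]
    exact mul_mem (inv_mem hb) (levi_le_par k₁ 1 m.2)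
  have hbm : iwaB (m : Sp k F) ∈ levi k k₁ F := by
    rw [eq_mul_inv_of_mul_eq hdec]
    exact mul_mem m.2 (inv_mem hκ)
  set b := iwaB (m : Sp k F) with hbdef
  have hup : IsUpper (regWt k) (mat b) := isUpper_iwaB _
  set d : Sp k F := diagElt regWt_swap hup with hd
  have hdentry : ∀ i j, i ≠ j → mat d i j = 0 := fun i j h => by
    rw [hd, mat_diagElt, diagPart_apply, if_neg fun e => h (regWt_injective e)]
  have hdm : d ∈ levi k k₁ F := fun i j h => hdentry i j fun e => h (by rw [e])
  have hnm : b * d⁻¹ ∈ levi k k₁ F := mul_mem hbm (inv_mem hdm)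
  have hn := unipotent_mul_diagElt_inv regWt_swap hup
  have hm : m = ⟨b * d⁻¹, hnm⟩ * ⟨d, hdm⟩ * ⟨_, hκ⟩ := by
    ext1
    simp only [Subgroup.coe_mul, inv_mul_cancel_right]
    exact hdec.symm
  rw [hm, map_mul, map_mul]
  have e1 : Measure.modularCharacter (⟨b * d⁻¹, hnm⟩ : levi k k₁ F) = 1 := by
    let S : Subgroup (levi k k₁ F) :=
      { carrier := {x | ∀ i j, regWt k i ≤ regWt k j →
          mat (x : Sp k F) i j = (1 : Matrix _ _ F) i j}
        one_mem' := fun i j _ => rfl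
        mul_mem' := by
          intro a b ha hb i j h
          have key : ∀ x, mat (a : Sp k F) i x * mat (b : Sp k F) x j =
              (1 : Matrix _ _ F) i x * (1 : Matrix _ _ F) x j := by
            intro x
            by_cases h1 : regWt k i ≤ regWt k x
            · by_cases h2 : regWt k x ≤ regWt k j
              · rw [ha _ _ h1, hb _ _ h2]
              · have hix : i ≠ x := by rintro rfl; exact h2 h
                rw [ha _ _ h1, Matrix.one_apply_ne hix, zero_mul, zero_mul]
            · have h2 : regWt k x ≤ regWt k j := by omega
              have hxj : x ≠ j := by rintro rfl; exact h1 h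
              rw [hb _ _ h2, Matrix.one_apply_ne hxj, mul_zero, mul_zero]
          rw [Subgroup.coe_mul, mat_mul, Matrix.mul_apply, Finset.sum_congr rfl fun x _ => key x,
            ← Matrix.mul_apply, Matrix.one_mul]
        inv_mem' := by
          intro g hg i j h
          rw [Subgroup.coe_inv, inv_entry, hg _ _ (by rw [regWt_swap, regWt_swap]; linarith)]
          by_cases e : i = j
          · subst e; simp
          · have : j.swap ≠ i.swap := fun e' => e (Sum.swap_leftInverse.injective e').symm
            rw [Matrix.one_apply_ne this, Matrix.one_apply_ne e, mul_zero] }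
    refine modularCharacter_eq_one_of_contracted (S := S)
      (fun n => ⟨torus k F _ (two_zpow_ne n), torus_mem_levi k₁ _ _⟩) (fun x hx => ?_) _ hn
    rw [IsInducing.subtypeVal.tendsto_nhds_iff]
    exact tendsto_torus_conj hx
  have e2 : Measure.modularCharacter (⟨d, hdm⟩ : levi k k₁ F) = 1 := by
    have h1 := modularCharacter_map (leviConjJ k k₁ F) ⟨d, hdm⟩
    have h2 : leviConjJ k k₁ F ⟨d, hdm⟩ = (⟨d, hdm⟩ : levi k k₁ F)⁻¹ := by
      ext1
      refine Subtype.ext (Matrix.ext fun i j => ?_)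
      change mat (spJ k F * d * (spJ k F)⁻¹) i j = mat d⁻¹ i j
      rw [spJ_conj_entry, inv_entry]
      by_cases e : i = j
      · rw [e]
      · have : j.swap ≠ i.swap := fun e' => e (Sum.swap_leftInverse.injective e').symm
        rw [hdentry _ _ this, hdentry _ _ this.symm]
    rw [h2] at h1
    have h3 : Measure.modularCharacter (⟨d, hdm⟩ : levi k k₁ F) *
        Measure.modularCharacter (⟨d, hdm⟩ : levi k k₁ F)⁻¹ = 1 := by
      rw [← map_mul, mul_inv_cancel, map_one]
    rw [h1, ← sq] at h3
    exact (pow_eq_one_iff_of_nonneg zero_le two_ne_zero).mp h3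
  have e3 : Measure.modularCharacter (⟨_, hκ⟩ : levi k k₁ F) = 1 :=
    modularCharacter_eq_one_of_isCompact
      (isCompact_iff_compactSpace.mpr (instCompactSpaceLeviCompact k₁)) _
      (show _ ∈ leviCompact k k₁ F from (iwaK (m : Sp k F)).2)
  rw [e1, e2, e3, mul_one, mul_one]

/-- For k₁ = 0 all weights vanish and the Levi subgroup is the whole group; the rest transports Haar
measure along this identification. -/
theorem sp_modularCharacter_eq_one (g : Sp k F) : Measure.modularCharacter g = 1 := by
  have htop : levi k 0 F = ⊤ := by
    refine eq_top_iff.mpr fun g _ i j h => absurd ?_ h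
    rcases i with i | i <;> rcases j with j | j <;> simp [wt]
  let φ : levi k 0 F ≃ₜ* Sp k F :=
    { toFun := fun m => m
      invFun := fun g => ⟨g, htop ▸ Subgroup.mem_top g⟩
      left_inv := fun m => rfl
      right_inv := fun g => rfl
      map_mul' := fun a b => rfl
      continuous_toFun := continuous_subtype_val
      continuous_invFun := continuous_id.subtype_mk _ }
  have hφ : Measurable φ := φ.continuous.measurable
  let μ : Measure (levi k 0 F) := Measure.haar
  have hμ : (μ.map φ).IsHaarMeasure := φ.isHaarMeasure_map μ
  have h1 := map_mul_right_eq_modularCharacter_smul (μ.map φ) g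
  have h2 : (μ.map φ).map (· * g) = μ.map φ := by
    rw [Measure.map_map (measurable_mul_const _) hφ]
    have : (fun x => x * g) ∘ φ = φ ∘ fun x => x * φ.symm g := by
      funext x; simp
    rw [this, ← Measure.map_map hφ (measurable_mul_const _),
      map_mul_right_eq_modularCharacter_smul μ, levi_modularCharacter_eq_one, one_smul]
  rw [h2] at h1
  obtain ⟨E, hE, hE1⟩ := exists_compact_mem_nhds (1 : Sp k F)
  have hpos : μ.map φ E ≠ 0 := (Measure.measure_pos_of_mem_nhds _ hE1).ne'
  have hfin : μ.map φ E ≠ ⊤ := hE.measure_lt_top.ne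
  have h3 := congrArg (fun ν : Measure (Sp k F) => ν E) h1
  change μ.map φ E = (Measure.modularCharacter g : ENNReal) * μ.map φ E at h3
  refine ENNReal.coe_injective ((ENNReal.mul_left_inj hpos hfin).mp ?_)
  rw [← h3, ENNReal.coe_one, one_mul]

end LeviUnimodular

/-! ### Uniqueness of invariant measures for transitive actions -/

section Uniqueness

open scoped ENNReal

variable {L X : Type*} [Group L] [MeasurableSpace L] [MeasurableSpace X]

/-- A measurable transitive action of `L` on `X`. -/
structure IsTransitiveAction (T : L → X → X) : Prop where
  measurable : Measurable fun p : L × X => T p.1 p.2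
  mul : ∀ a b x, T (a * b) x = T a (T b x)
  trans : ∀ x y, ∃ l, T l x = y

variable {T : L → X → X}

theorem IsTransitiveAction.one (hT : IsTransitiveAction T) (x : X) : T 1 x = x := by
  obtain ⟨l, hl⟩ := hT.trans x x
  conv_lhs => rw [← hl]
  rw [← hT.mul, one_mul, hl]

theorem IsTransitiveAction.measurable_apply (hT : IsTransitiveAction T) (l : L) :
    Measurable (T l) :=
  hT.measurable.comp measurable_prodMk_left

theorem IsTransitiveAction.measurable_orbit (hT : IsTransitiveAction T) (x : X) :
    Measurable fun l => T l x :=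
  hT.measurable.comp measurable_prodMk_right

variable {μ : Measure L} [SFinite μ]

theorem IsTransitiveAction.orbit_null (hT : IsTransitiveAction T)
    (hμ : ∀ l₀ N, MeasurableSet N → μ N = 0 → μ {l | l * l₀ ∈ N} = 0)
    {N : Set X} (hN : MeasurableSet N) {x₀ : X} (h : μ {l | T l x₀ ∈ N} = 0) (x : X) :
    μ {l | T l x ∈ N} = 0 := by
  obtain ⟨l₀, rfl⟩ := hT.trans x₀ x
  have := hμ l₀ _ (hT.measurable_orbit x₀ hN) h
  simpa only [Set.mem_preimage, hT.mul] using this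

/-- Fubini for the set of pairs (l, x) with l x in `N`: slices at fixed x are null by hypothesis,
while every slice at fixed l has measure ν(N) by invariance. -/
theorem IsTransitiveAction.null_of_orbit_null (hT : IsTransitiveAction T) (hμ0 : μ ≠ 0)
    {ν : Measure X} [SFinite ν] (hν : ∀ l, ν.map (T l) = ν)
    {N : Set X} (hN : MeasurableSet N) (h : ∀ x, μ {l | T l x ∈ N} = 0) : ν N = 0 := by
  have hS : MeasurableSet {p : L × X | T p.1 p.2 ∈ N} := hT.measurable hN
  have h1 : (μ.prod ν) {p : L × X | T p.1 p.2 ∈ N} = 0 := by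
    rw [Measure.prod_apply_symm hS]
    simp only [Set.preimage_ofPred_eq, h, lintegral_zero]
  have h2 : ∀ l, ν {x | T l x ∈ N} = ν N := fun l => by
    rw [← hν l, Measure.map_apply (hT.measurable_apply l) hN, hν l]; rfl
  rw [Measure.prod_apply hS] at h1
  simp only [Set.preimage_ofPred_eq, h2, lintegral_const] at h1
  exact (mul_eq_zero.mp h1).resolve_right (by simpa using hμ0)

/-- Fubini in the other order produces one base point whose orbit map pulls `N` back to a null set.
Transitivity, with the stability of μ-null sets under right translation, moves it to every point. -/
theorem IsTransitiveAction.orbit_null_of_null (hT : IsTransitiveAction T)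
    (hμ : ∀ l₀ N, MeasurableSet N → μ N = 0 → μ {l | l * l₀ ∈ N} = 0)
    {ν : Measure X} [SFinite ν] (hν : ∀ l, ν.map (T l) = ν) (hν0 : ν ≠ 0)
    {N : Set X} (hN : MeasurableSet N) (h : ν N = 0) (x : X) : μ {l | T l x ∈ N} = 0 := by
  have hS : MeasurableSet {p : L × X | T p.1 p.2 ∈ N} := hT.measurable hN
  have h2 : ∀ l, ν {x | T l x ∈ N} = 0 := fun l => by
    rw [← h, ← hν l, Measure.map_apply (hT.measurable_apply l) hN, hν l]; rfl
  have h1 : (μ.prod ν) {p : L × X | T p.1 p.2 ∈ N} = 0 := by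
    rw [Measure.prod_apply hS]
    simp only [Set.preimage_ofPred_eq, h2, lintegral_zero]
  rw [Measure.prod_apply_symm hS, lintegral_eq_zero_iff (measurable_measure_prodMk_right hS)] at h1
  haveI : (ae ν).NeBot := ae_neBot.mpr hν0
  obtain ⟨x₀, hx₀⟩ := h1.exists
  exact hT.orbit_null hμ hN hx₀ x

/-- Null sets of both invariant measures are detected by orbit maps into X, hence coincide. The
Radon–Nikodym derivative h is almost everywhere invariant under each l; by Fubini some x₀ satisfies
h(l x₀) = h(x₀) for almost all l, and transitivity makes h almost everywhere equal to h(x₀). -/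
theorem IsTransitiveAction.exists_eq_smul (hT : IsTransitiveAction T) (hμ0 : μ ≠ 0)
    (hμ : ∀ l₀ N, MeasurableSet N → μ N = 0 → μ {l | l * l₀ ∈ N} = 0)
    {ν₁ ν₂ : Measure X} [SigmaFinite ν₁] [SigmaFinite ν₂] (h₁ : ∀ l, ν₁.map (T l) = ν₁)
    (h₂ : ∀ l, ν₂.map (T l) = ν₂) (h₁0 : ν₁ ≠ 0) (h₂0 : ν₂ ≠ 0) :
    ∃ c : ℝ≥0∞, c ≠ 0 ∧ c ≠ ⊤ ∧ ν₁ = c • ν₂ := by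
  have hac : ν₁ ≪ ν₂ := by
    refine Measure.AbsolutelyContinuous.mk fun N hN h => ?_
    exact hT.null_of_orbit_null hμ0 h₁ hN (hT.orbit_null_of_null hμ h₂ h₂0 hN h)
  set h := ν₁.rnDeriv ν₂ with hh
  have hm : Measurable h := Measure.measurable_rnDeriv _ _
  have hd : ν₂.withDensity h = ν₁ := Measure.withDensity_rnDeriv_eq _ _ hac
  have hinv : ∀ l, (fun x => h (T l x)) =ᵐ[ν₂] h := by
    intro l
    have hml := hT.measurable_apply l
    have e : ν₂.withDensity (fun x => h (T l x)) = ν₂.withDensity h := by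
      rw [hd]
      ext s hs
      have hs' : MeasurableSet ((T l⁻¹) ⁻¹' s) := hT.measurable_apply l⁻¹ hs
      have e2 : (T l) ⁻¹' ((T l⁻¹) ⁻¹' s) = s := by
        ext x; simp only [Set.mem_preimage, ← hT.mul, inv_mul_cancel, hT.one]
      calc ν₂.withDensity (fun x => h (T l x)) s
          = ∫⁻ x in (T l) ⁻¹' ((T l⁻¹) ⁻¹' s), h (T l x) ∂ν₂ := by rw [withDensity_apply _ hs, e2]
        _ = ∫⁻ y in (T l⁻¹) ⁻¹' s, h y ∂(ν₂.map (T l)) := (setLIntegral_map hs' hm hml).symm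
        _ = ν₁ ((T l⁻¹) ⁻¹' s) := by rw [h₂, ← withDensity_apply _ hs', hd]
        _ = ν₁ s := by
          conv_rhs => rw [← h₁ l⁻¹]
          rw [Measure.map_apply (hT.measurable_apply _) hs]
    exact (withDensity_eq_iff_of_sigmaFinite (hm.comp hml).aemeasurable hm.aemeasurable).mp e
  have hS : MeasurableSet {p : L × X | h (T p.1 p.2) ≠ h p.2} :=
    (measurableSet_eq_fun (hm.comp hT.measurable) (hm.comp measurable_snd)).compl
  have hnull : (μ.prod ν₂) {p : L × X | h (T p.1 p.2) ≠ h p.2} = 0 := by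
    rw [Measure.prod_apply hS, lintegral_eq_zero_of_ae_eq_zero]
    exact Filter.Eventually.of_forall fun l => hinv l
  rw [Measure.prod_apply_symm hS,
    lintegral_eq_zero_iff (measurable_measure_prodMk_right hS)] at hnull
  haveI : (ae ν₂).NeBot := ae_neBot.mpr h₂0
  obtain ⟨x₀, hx₀, hfin⟩ := (hnull.and (Measure.rnDeriv_lt_top ν₁ ν₂)).exists
  have hN : MeasurableSet {y | h y ≠ h x₀} := (measurableSet_eq_fun hm measurable_const).compl
  have hconst : h =ᵐ[ν₂] fun _ => h x₀ :=
    hT.null_of_orbit_null hμ0 h₂ hN (hT.orbit_null hμ hN hx₀)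
  have heq : ν₁ = h x₀ • ν₂ := by
    rw [← hd, withDensity_congr_ae hconst, withDensity_const]
  refine ⟨h x₀, fun h0 => h₁0 ?_, hfin.ne, heq⟩
  rw [heq, h0, zero_smul]

end Uniqueness

/-! ### Haar measure in the coordinates `M × Ū × K` -/

section HaarDecomposition

open scoped ENNReal Pointwise

variable {k k₁ : ℕ} {F : Type*} [RCLike F]

theorem continuous_leviPart {s : ℤ} (hs : s ≠ 0) :
    Continuous fun p : par k k₁ F s => leviPart hs p := by
  refine Continuous.subtype_mk (Continuous.subtype_mk ?_ _) _
  refine continuous_matrix fun i j => ?_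
  simp only [diagPart_apply]
  split_ifs
  · exact (continuous_entry i j).comp continuous_subtype_val
  · exact continuous_const

theorem conj_mem_unip {s : ℤ} {m u : Sp k F} (hm : m ∈ levi k k₁ F) (hu : u ∈ unip k k₁ F s) :
    m * u * m⁻¹ ∈ unip k k₁ F s := by
  have hm' := (levi k k₁ F).inv_mem hm
  intro i j hij
  have h1 : (1 : Matrix _ _ F) i j = (mat m * 1 * mat m⁻¹ : Matrix _ _ F) i j := by
    rw [Matrix.mul_one, ← mat_mul, mul_inv_cancel, mat_one]
  rw [h1, mat_mul, mat_mul, Matrix.mul_apply, Matrix.mul_apply]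
  refine Finset.sum_congr rfl fun b _ => ?_
  by_cases hb : wt k k₁ b = wt k k₁ j
  · rw [Matrix.mul_apply, Matrix.mul_apply]
    congr 1
    refine Finset.sum_congr rfl fun a _ => ?_
    by_cases ha : wt k k₁ i = wt k k₁ a
    · rw [hu a b (by rw [← ha, hb]; exact hij)]
    · rw [hm i a ha, zero_mul, zero_mul]
  · rw [hm' b j hb, mul_zero, mul_zero]

/-- Conjugation of an element of `Ū` (or `U`) by an element of `M`. -/
def unipConj {s : ℤ} (m : levi k k₁ F) (u : unip k k₁ F s) : unip k k₁ F s :=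
  ⟨m * u * (m : Sp k F)⁻¹, conj_mem_unip m.2 u.2⟩

/-- The multiplication map `M × Ū × K → G`. -/
def mukMap (k k₁ : ℕ) (F : Type*) [RCLike F] :
    levi k k₁ F × unip k k₁ F (-1) × maxCompact k F → Sp k F :=
  fun p => p.1 * p.2.1 * p.2.2

theorem continuous_mukMap : Continuous (mukMap k k₁ F) := by
  unfold mukMap
  fun_prop

variable (μM : Measure (levi k k₁ F)) [μM.IsHaarMeasure]
  (μU : Measure (unip k k₁ F (-1))) [μU.IsHaarMeasure]
  (μK : Measure (maxCompact k F)) [μK.IsHaarMeasure]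

/-- The image on `G` of the product of Haar measures on `M`, `Ū` and `K`. -/
def mukMeasure : Measure (Sp k F) := (μM.prod (μU.prod μK)).map (mukMap k k₁ F)

theorem mukMeasure_map_levi (m : levi k k₁ F) :
    (mukMeasure μM μU μK).map (fun g : Sp k F => (m : Sp k F) * g) = mukMeasure μM μU μK := by
  have h : MeasurePreserving (Prod.map (fun x => m * x) id) (μM.prod (μU.prod μK))
      (μM.prod (μU.prod μK)) :=
    (measurePreserving_mul_left μM m).prod (MeasurePreserving.id _)
  rw [mukMeasure, Measure.map_map (measurable_const_mul _) continuous_mukMap.measurable]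
  conv_rhs => rw [← h.map_eq, Measure.map_map continuous_mukMap.measurable h.measurable]
  congr 1
  funext p
  simp [mukMap, mul_assoc]

/-- Since u m v κ = m (m⁻¹ u m) v κ, translation by u is a skew product that translates the variable
in Ū over each m. With the coordinates in the order M, Ū no modulus factor appears. -/
theorem mukMeasure_map_unip (u : unip k k₁ F (-1)) :
    (mukMeasure μM μU μK).map (fun g : Sp k F => (u : Sp k F) * g) = mukMeasure μM μU μK := by
  have hm : Measurable (Function.uncurry fun (m : levi k k₁ F)
      (q : unip k k₁ F (-1) × maxCompact k F) => (unipConj m⁻¹ u * q.1, q.2)) := by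
    refine Continuous.measurable ?_
    unfold Function.uncurry
    refine Continuous.prodMk (Continuous.mul ?_ (by fun_prop)) (by fun_prop)
    exact Continuous.subtype_mk (by fun_prop) _
  have h : MeasurePreserving (fun p : levi k k₁ F × unip k k₁ F (-1) × maxCompact k F =>
      (id p.1, (unipConj p.1⁻¹ u * p.2.1, p.2.2))) (μM.prod (μU.prod μK))
      (μM.prod (μU.prod μK)) :=
    (MeasurePreserving.id μM).skew_product hm (Filter.Eventually.of_forall fun m =>
      ((measurePreserving_mul_left μU (unipConj m⁻¹ u)).prod (MeasurePreserving.id μK)).map_eq)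
  rw [mukMeasure, Measure.map_map (measurable_const_mul _) continuous_mukMap.measurable]
  conv_rhs => rw [← h.map_eq, Measure.map_map continuous_mukMap.measurable h.measurable]
  congr 1
  funext p
  simp [mukMap, mul_assoc, unipConj]

theorem isMulRightInvariant_maxCompact : μK.IsMulRightInvariant :=
  isMulRightInvariant_of_modularCharacter_eq_one μK fun x =>
    modularCharacter_eq_one_of_isCompact (S := ⊤) isCompact_univ x trivial

theorem mukMeasure_map_maxCompact (x : maxCompact k F) :
    (mukMeasure μM μU μK).map (fun g : Sp k F => g * (x : Sp k F)) = mukMeasure μM μU μK := by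
  haveI := isMulRightInvariant_maxCompact μK
  have h : MeasurePreserving (Prod.map id (Prod.map id fun y => y * x)) (μM.prod (μU.prod μK))
      (μM.prod (μU.prod μK)) :=
    (MeasurePreserving.id _).prod ((MeasurePreserving.id _).prod (measurePreserving_mul_right μK x))
  rw [mukMeasure, Measure.map_map (measurable_mul_const _) continuous_mukMap.measurable]
  conv_rhs => rw [← h.map_eq, Measure.map_map continuous_mukMap.measurable h.measurable]
  congr 1
  funext p
  simp [mukMap, mul_assoc]

/-- If m u κ lies in E, then m u lies in the compact set E K⁻¹ ∩ P̄, and m and u depend continuously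
on their product. -/
theorem isFiniteMeasureOnCompacts_mukMeasure :
    IsFiniteMeasureOnCompacts (mukMeasure μM μU μK) := by
  refine ⟨fun E hE => ?_⟩
  rw [mukMeasure, Measure.map_apply continuous_mukMap.measurable hE.measurableSet]
  have hs : (-1 : ℤ) ≠ 0 := by norm_num
  let E' : Set (par k k₁ F (-1)) :=
    Subtype.val ⁻¹' (E * ((maxCompact k F : Set (Sp k F)))⁻¹)
  have hE' : IsCompact E' := (isClosed_par k₁ (-1)).isClosedEmbedding_subtypeVal.isCompact_preimage
    (hE.mul (isCompact_maxCompact k).inv)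
  -- For p = m u the unipotent part of p⁻¹ = u⁻¹ m⁻¹ is u⁻¹, whereas that of p itself is m u m⁻¹.
  let Ψ : par k k₁ F (-1) × maxCompact k F →
      levi k k₁ F × unip k k₁ F (-1) × maxCompact k F :=
    fun q => (leviPart hs q.1, (unipPart hs q.1⁻¹)⁻¹, q.2)
  have hΨ : Continuous Ψ := by
    refine Continuous.prodMk ((continuous_leviPart hs).comp continuous_fst)
      (Continuous.prodMk (Continuous.inv ?_) continuous_snd)
    refine Continuous.subtype_mk ?_ _
    have h1 := (continuous_leviPart (k := k) (k₁ := k₁) (F := F) hs)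
    exact (continuous_subtype_val.comp continuous_fst.inv).mul
      (continuous_subtype_val.comp (h1.comp continuous_fst.inv)).inv
  refine lt_of_le_of_lt (measure_mono ?_)
    ((hE'.prod (isCompact_univ (X := maxCompact k F))).image hΨ).measure_lt_top
  rintro ⟨m, u, x⟩ hmem
  have hm := levi_le_par k₁ (-1) m.2
  have hu := unip_le_par k₁ (-1) u.2
  refine ⟨(⟨m, hm⟩ * ⟨u, hu⟩, x), ⟨?_, trivial⟩, ?_⟩
  · refine ⟨m * u * x, hmem, (x : Sp k F)⁻¹, Set.inv_mem_inv.mpr x.2, ?_⟩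
    simp
  · have h1 : leviPart hs (⟨m, hm⟩ * ⟨u, hu⟩ : par k k₁ F (-1)) = m := by
      rw [leviPart_mul, leviPart_levi, leviPart_unip, mul_one]
    have h2 : leviPart hs (⟨m, hm⟩ * ⟨u, hu⟩ : par k k₁ F (-1))⁻¹ = m⁻¹ := by
      have h3 := leviPart_mul hs (⟨m, hm⟩ * ⟨u, hu⟩ : par k k₁ F (-1)) (⟨m, hm⟩ * ⟨u, hu⟩)⁻¹
      rw [mul_inv_cancel, h1] at h3
      have h4 : leviPart hs (1 : par k k₁ F (-1)) = 1 := leviPart_unip hs 1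
      rw [h4] at h3
      exact eq_inv_of_mul_eq_one_right h3.symm
    refine Prod.ext h1 (Prod.ext ?_ rfl)
    ext1
    change ((((⟨m, hm⟩ * ⟨u, hu⟩ : par k k₁ F (-1))⁻¹ : par k k₁ F (-1)) : Sp k F) *
      (leviPart hs (⟨m, hm⟩ * ⟨u, hu⟩ : par k k₁ F (-1))⁻¹ : Sp k F)⁻¹)⁻¹ = u
    rw [h2]
    simp

/-- The action of `P̄ × K` on `G` by left and right multiplication. -/
theorem isTransitiveAction_par_maxCompact :
    IsTransitiveAction fun (l : par k k₁ F (-1) × maxCompact k F) (g : Sp k F) =>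
      (l.1 : Sp k F) * g * (l.2 : Sp k F)⁻¹ where
  measurable := by
    refine Continuous.measurable ?_
    fun_prop
  mul a b x := by simp [mul_assoc]
  trans x y := by
    obtain ⟨m, u, κ, rfl⟩ := exists_opposite_iwasawa k₁ x
    obtain ⟨m', u', κ', rfl⟩ := exists_opposite_iwasawa k₁ y
    refine ⟨(⟨m' * u' * (m * u : Sp k F)⁻¹, mul_mem (mul_mem (levi_le_par k₁ _ m'.2)
      (unip_le_par k₁ _ u'.2)) (inv_mem (mul_mem (levi_le_par k₁ _ m.2)
      (unip_le_par k₁ _ u.2)))⟩, κ'⁻¹ * κ), ?_⟩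
    simp only [Subgroup.coe_mul, Subgroup.coe_inv]
    group

/-- Haar measure of G and the image of dm dū dk are both invariant under the transitive action of P̄
× K, hence proportional, and G is unimodular. -/
theorem mukMeasure_map_mul_right (g : Sp k F) :
    (mukMeasure μM μU μK).map (fun h => h * g) = mukMeasure μM μU μK := by
  let L := par k k₁ F (-1) × maxCompact k F
  let lam : Measure (Sp k F) := Measure.haar
  haveI : lam.IsMulRightInvariant :=
    isMulRightInvariant_of_modularCharacter_eq_one lam sp_modularCharacter_eq_one
  let μL : Measure L := Measure.haar
  haveI := isFiniteMeasureOnCompacts_mukMeasure μM μU μK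
  have hne : mukMeasure μM μU μK ≠ 0 := by
    rw [mukMeasure, Ne, Measure.map_eq_zero_iff continuous_mukMap.measurable.aemeasurable]
    exact NeZero.ne _
  -- Unimodularity of P̄ is not needed: right translation multiplies the Haar measure of P̄ × K by a
  -- scalar, which already preserves null sets.
  have hL : ∀ l₀ N, MeasurableSet N → μL N = 0 → μL {l | l * l₀ ∈ N} = 0 := fun l₀ N hN h0 => by
    have h1 := congrArg (fun ν : Measure L => ν N) (map_mul_right_eq_modularCharacter_smul μL l₀)
    simp only [Measure.smul_apply, h0, smul_zero] at h1
    rwa [Measure.map_apply (measurable_mul_const _) hN] at h1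
  have h₁ : ∀ l : L, (mukMeasure μM μU μK).map (fun g : Sp k F =>
      (l.1 : Sp k F) * g * (l.2 : Sp k F)⁻¹) = mukMeasure μM μU μK := fun l => by
    have hs : (-1 : ℤ) ≠ 0 := by norm_num
    have hl := unipPart_mul_leviPart hs l.1
    have e : (fun g : Sp k F => (l.1 : Sp k F) * g * (l.2 : Sp k F)⁻¹) =
        (fun g => g * ((l.2⁻¹ : maxCompact k F) : Sp k F)) ∘
          (fun g => (unipPart hs l.1 : Sp k F) * g) ∘ fun g => (leviPart hs l.1 : Sp k F) * g := by
      funext g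
      simp only [Function.comp_apply, Subgroup.coe_inv, ← mul_assoc, hl]
    rw [e, ← Measure.map_map (measurable_mul_const _)
      ((measurable_const_mul _).comp (measurable_const_mul _)),
      ← Measure.map_map (measurable_const_mul _) (measurable_const_mul _), mukMeasure_map_levi,
      mukMeasure_map_unip, mukMeasure_map_maxCompact]
  have h₂ : ∀ l : L, lam.map (fun g : Sp k F => (l.1 : Sp k F) * g * (l.2 : Sp k F)⁻¹) = lam :=
    fun l => by
    have e : (fun g : Sp k F => (l.1 : Sp k F) * g * (l.2 : Sp k F)⁻¹) =
        (fun g => g * (l.2 : Sp k F)⁻¹) ∘ fun g => (l.1 : Sp k F) * g := rfl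
    rw [e, ← Measure.map_map (measurable_mul_const _) (measurable_const_mul _),
      map_mul_left_eq_self, map_mul_right_eq_self]
  obtain ⟨c, -, -, hc⟩ := isTransitiveAction_par_maxCompact.exists_eq_smul (NeZero.ne μL) hL h₁ h₂
    hne (NeZero.ne lam)
  rw [hc, Measure.map_smul, map_mul_right_eq_self]

end HaarDecomposition

/-! ### The invariant measure on `M \ G` -/

section LeviQuotMeasure

open scoped ENNReal Pointwise

variable {k k₁ : ℕ} {F : Type*} [RCLike F]

/-- The projection `G → M \ G`. -/
def LeviQuot.mk (k₁ : ℕ) (h : Sp k F) : LeviQuot k k₁ F :=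
  Quotient.mk (QuotientGroup.rightRel (levi k k₁ F)) h

theorem LeviQuot.continuous_mk : Continuous (LeviQuot.mk k₁ : Sp k F → LeviQuot k k₁ F) :=
  continuous_quotient_mk'

theorem LeviQuot.surjective_mk : Function.Surjective (LeviQuot.mk k₁ : Sp k F → _) :=
  Quotient.mk_surjective

theorem LeviQuot.isOpenMap_mk : IsOpenMap (LeviQuot.mk k₁ : Sp k F → LeviQuot k k₁ F) := by
  haveI : ContinuousConstSMul (levi k k₁ F) (Sp k F) :=
    ⟨fun m => continuous_const.mul continuous_id⟩
  exact isOpenMap_quotient_mk'_mul (Γ := levi k k₁ F) (T := Sp k F)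

theorem LeviQuot.isOpenQuotientMap_mk :
    IsOpenQuotientMap (LeviQuot.mk k₁ : Sp k F → LeviQuot k k₁ F) :=
  ⟨LeviQuot.surjective_mk, LeviQuot.continuous_mk, LeviQuot.isOpenMap_mk⟩

theorem LeviQuot.mk_eq_mk {a b : Sp k F} :
    LeviQuot.mk k₁ a = LeviQuot.mk k₁ b ↔ b * a⁻¹ ∈ levi k k₁ F := by
  rw [← QuotientGroup.rightRel_apply]
  exact Quotient.eq (r := QuotientGroup.rightRel (levi k k₁ F))

theorem LeviQuot.mk_levi_mul (m : levi k k₁ F) (h : Sp k F) :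
    LeviQuot.mk k₁ ((m : Sp k F) * h) = LeviQuot.mk k₁ h := by
  rw [eq_comm, LeviQuot.mk_eq_mk]
  simp

theorem LeviQuot.translate_mk (g h : Sp k F) :
    LeviQuot.translate g (LeviQuot.mk k₁ h) = LeviQuot.mk k₁ (h * g) := rfl

instance LeviQuot.instSecondCountable : SecondCountableTopology (LeviQuot k k₁ F) :=
  LeviQuot.isOpenQuotientMap_mk.isQuotientMap.secondCountableTopology LeviQuot.isOpenMap_mk

instance LeviQuot.instT1 : T1Space (LeviQuot k k₁ F) := by
  refine ⟨fun x => ?_⟩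
  obtain ⟨a, rfl⟩ := LeviQuot.surjective_mk x
  rw [← LeviQuot.isOpenQuotientMap_mk.isQuotientMap.isClosed_preimage]
  have : LeviQuot.mk k₁ ⁻¹' {LeviQuot.mk k₁ a} =
      (fun b : Sp k F => a * b⁻¹) ⁻¹' (levi k k₁ F : Set (Sp k F)) := by
    ext b
    exact LeviQuot.mk_eq_mk
  rw [this]
  exact (isClosed_levi k k₁).preimage (by fun_prop)

instance LeviQuot.instLocallyCompact : LocallyCompactSpace (LeviQuot k k₁ F) :=
  LeviQuot.isOpenQuotientMap_mk.locallyCompactSpace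

instance instPolishMatrix : PolishSpace (Matrix (Fin k ⊕ Fin k) (Fin k ⊕ Fin k) F) :=
  inferInstanceAs (PolishSpace (Fin k ⊕ Fin k → Fin k ⊕ Fin k → F))

instance instPolishSp : PolishSpace (Sp k F) :=
  isClosed_symplecticGroup.polishSpace

/-- A continuous surjection from a Polish space onto a second countable T₁ space induces the Borel
structure of its target, so measurability may be tested on G. -/
theorem LeviQuot.measurable_of_comp {β : Type*} [MeasurableSpace β] {φ : LeviQuot k k₁ F → β}
    (h : Measurable fun g => φ (LeviQuot.mk k₁ g)) : Measurable φ := by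
  intro s hs
  have h1 := LeviQuot.continuous_mk.map_borel_eq (LeviQuot.surjective_mk (k := k) (k₁ := k₁) (F := F))
  change @MeasurableSet _ (borel _) _
  rw [← h1]
  exact h hs

theorem LeviQuot.continuous_translate :
    Continuous fun p : Sp k F × LeviQuot k k₁ F => LeviQuot.translate p.1 p.2 := by
  have h := (IsOpenQuotientMap.id (X := Sp k F)).prodMap
    (LeviQuot.isOpenQuotientMap_mk (k := k) (k₁ := k₁) (F := F))
  rw [h.isQuotientMap.continuous_iff]
  exact LeviQuot.continuous_mk.comp (continuous_snd.mul continuous_fst)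

theorem LeviQuot.isTransitiveAction :
    IsTransitiveAction fun (g : Sp k F) (x : LeviQuot k k₁ F) => LeviQuot.translate g⁻¹ x where
  measurable := by
    exact (LeviQuot.continuous_translate.comp
      (continuous_fst.inv.prodMk continuous_snd)).measurable
  mul a b x := by
    obtain ⟨h, rfl⟩ := LeviQuot.surjective_mk x
    simp [LeviQuot.translate_mk, mul_assoc]
  trans x y := by
    obtain ⟨a, rfl⟩ := LeviQuot.surjective_mk x
    obtain ⟨b, rfl⟩ := LeviQuot.surjective_mk y
    exact ⟨b⁻¹ * a, by simp [LeviQuot.translate_mk]⟩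

theorem LeviQuot.measurable_translate (g : Sp k F) :
    Measurable (LeviQuot.translate g : LeviQuot k k₁ F → _) :=
  (LeviQuot.continuous_translate.comp (Continuous.prodMk_right g)).measurable

variable (μM : Measure (levi k k₁ F)) [μM.IsHaarMeasure]
  (μU : Measure (unip k k₁ F (-1))) [μU.IsHaarMeasure]
  (μK : Measure (maxCompact k F)) [μK.IsHaarMeasure]

/-- A weight function on `G` whose integrals over the cosets of `M` are positive and finite, and
which is integrable with respect to a given measure. -/
theorem exists_weight (lam : Measure (Sp k F)) [IsFiniteMeasureOnCompacts lam] :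
    ∃ β : Sp k F → ℝ≥0∞, Measurable β ∧ ∫⁻ g, β g ∂lam ≠ ⊤ ∧
      ∀ g, ∫⁻ m : levi k k₁ F, β (m * g) ∂μM ≠ 0 ∧ ∫⁻ m : levi k k₁ F, β (m * g) ∂μM ≠ ⊤ := by
  haveI : μM.IsMulRightInvariant :=
    isMulRightInvariant_of_modularCharacter_eq_one μM levi_modularCharacter_eq_one
  let E : CompactExhaustion (Sp k F) := default
  -- If m₀ g and m g lie in `E n`, then m m₀⁻¹ lies in `S n`. So μM (`S n`) bounds the measure of {m
  -- | m g ∈ `E n`} uniformly in g.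
  let S : ℕ → Set (levi k k₁ F) := fun n => Subtype.val ⁻¹' (E n * (E n)⁻¹)
  have hS : ∀ n, IsCompact (S n) := fun n =>
    (isClosed_levi k k₁).isClosedEmbedding_subtypeVal.isCompact_preimage
      ((E.isCompact n).mul (E.isCompact n).inv)
  let d : ℕ → ℝ≥0∞ := fun n => 1 + μM (S n) + lam (E n)
  have hd : ∀ n, d n ≠ ⊤ := fun n => ENNReal.add_ne_top.mpr
    ⟨ENNReal.add_ne_top.mpr ⟨ENNReal.one_ne_top, (hS n).measure_lt_top.ne⟩,
      (E.isCompact n).measure_lt_top.ne⟩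
  have hd1 : ∀ n, d n ≠ 0 := fun n => by simp [d]
  -- The coefficient is chosen so that `E n` contributes at most 2⁻ⁿ both to the total integral and
  -- to the integral over each coset.
  let a : ℕ → ℝ≥0∞ := fun n => 2⁻¹ ^ n * (d n)⁻¹
  have ha : ∀ n, a n ≠ 0 := fun n =>
    mul_ne_zero (pow_ne_zero _ (by simp)) (ENNReal.inv_ne_zero.mpr (hd n))
  have hbound : ∀ n x, x ≤ d n → a n * x ≤ 2⁻¹ ^ n := fun n x hx => by
    calc a n * x ≤ 2⁻¹ ^ n * (d n)⁻¹ * d n := by gcongr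
      _ = 2⁻¹ ^ n := by rw [mul_assoc, ENNReal.inv_mul_cancel (hd1 n) (hd n), mul_one]
  have hgeom : ∑' n : ℕ, (2⁻¹ : ℝ≥0∞) ^ n ≠ ⊤ := by
    rw [ENNReal.tsum_geometric]
    simp
  have hmE : ∀ n, MeasurableSet (E n) := fun n => (E.isCompact n).measurableSet
  refine ⟨fun g => ∑' n, a n * (E n).indicator 1 g, ?_, ?_, fun g => ?_⟩
  · exact Measurable.tsum fun n => (measurable_one.indicator (hmE n)).const_mul _
  · rw [lintegral_tsum fun n => ((measurable_one.indicator (hmE n)).const_mul _).aemeasurable]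
    refine ne_top_of_le_ne_top hgeom (ENNReal.tsum_le_tsum fun n => ?_)
    rw [lintegral_const_mul _ (measurable_one.indicator (hmE n)), lintegral_indicator_one (hmE n)]
    exact hbound n _ le_add_self
  · have hmg : Measurable fun m : levi k k₁ F => (m : Sp k F) * g :=
      measurable_subtype_coe.mul_const g
    have h1 : ∫⁻ m : levi k k₁ F, ∑' n, a n * (E n).indicator 1 ((m : Sp k F) * g) ∂μM =
        ∑' n, a n * μM ((fun m : levi k k₁ F => (m : Sp k F) * g) ⁻¹' E n) := by
      have h2 : ∀ n, Measurable fun m : levi k k₁ F =>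
          (E n).indicator (1 : Sp k F → ℝ≥0∞) ((m : Sp k F) * g) := fun n =>
        (measurable_one.indicator (hmE n)).comp hmg
      rw [lintegral_tsum fun n => ((h2 n).const_mul _).aemeasurable]
      congr 1
      funext n
      rw [lintegral_const_mul _ (h2 n), ← lintegral_indicator_one (hmg (hmE n))]
      rfl
    rw [h1]
    constructor
    · obtain ⟨n, hn⟩ := E.exists_mem_nhds g
      intro h0
      have h2 := (ENNReal.tsum_eq_zero.mp h0) n
      refine mul_ne_zero (ha n) (Measure.measure_pos_of_mem_nhds (x := 1) _ ?_).ne' h2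
      have hc : Continuous fun m : levi k k₁ F => (m : Sp k F) * g := by fun_prop
      exact hc.continuousAt.preimage_mem_nhds (by simpa using hn)
    · refine ne_top_of_le_ne_top hgeom (ENNReal.tsum_le_tsum fun n => hbound n _ ?_)
      refine le_trans ?_ (le_trans (le_add_self (b := 1)) le_self_add)
      by_cases hne : ((fun m : levi k k₁ F => (m : Sp k F) * g) ⁻¹' E n).Nonempty
      · obtain ⟨m₀, hm₀⟩ := hne
        rw [← measure_preimage_mul_right μM m₀⁻¹ (S n)]
        refine measure_mono fun m hm => ?_
        refine ⟨(m : Sp k F) * g, hm, ((m₀ : Sp k F) * g)⁻¹, Set.inv_mem_inv.mpr hm₀, ?_⟩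
        simp
      · rw [Set.not_nonempty_iff_eq_empty.mp hne, measure_empty]
        exact zero_le

/-- The image on `M \ G` of the product of Haar measures on `Ū` and `K`. -/
def ukMeasure : Measure (LeviQuot k k₁ F) :=
  (μU.prod μK).map fun p => LeviQuot.mk k₁ ((p.1 : Sp k F) * p.2)

theorem continuous_ukMap : Continuous fun p : unip k k₁ F (-1) × maxCompact k F =>
    LeviQuot.mk k₁ ((p.1 : Sp k F) * (p.2 : Sp k F)) :=
  LeviQuot.continuous_mk.comp ((continuous_subtype_val.comp continuous_fst).mul
    (continuous_subtype_val.comp continuous_snd))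

/-- The integral of a function on `G` over the cosets of `M`. -/
def cosetIntegral (β : Sp k F → ℝ≥0∞) : LeviQuot k k₁ F → ℝ≥0∞ := fun x =>
  ∫⁻ m : levi k k₁ F, β (m * Quotient.out (s := QuotientGroup.rightRel (levi k k₁ F)) x) ∂μM

/-- The chosen representative is an M-multiple of `h` on the left, which amounts to a right
translation of the variable m; unimodularity of M makes this harmless. -/
theorem cosetIntegral_mk (β : Sp k F → ℝ≥0∞) (h : Sp k F) :
    cosetIntegral μM β (LeviQuot.mk k₁ h) = ∫⁻ m : levi k k₁ F, β (m * h) ∂μM := by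
  haveI : μM.IsMulRightInvariant :=
    isMulRightInvariant_of_modularCharacter_eq_one μM levi_modularCharacter_eq_one
  set h' := Quotient.out (s := QuotientGroup.rightRel (levi k k₁ F)) (LeviQuot.mk k₁ h) with hh'
  have h1 : LeviQuot.mk k₁ h = LeviQuot.mk k₁ h' :=
    (Quotient.out_eq (s := QuotientGroup.rightRel (levi k k₁ F)) (LeviQuot.mk k₁ h)).symm
  rw [LeviQuot.mk_eq_mk] at h1
  have h2 : h' = h' * h⁻¹ * h := by group
  change ∫⁻ m : levi k k₁ F, β (m * h') ∂μM = _
  rw [← lintegral_mul_right_eq_self (fun m : levi k k₁ F => β (m * h)) ⟨h' * h⁻¹, h1⟩]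
  refine lintegral_congr fun m => ?_
  simp [mul_assoc]

theorem measurable_cosetIntegral {β : Sp k F → ℝ≥0∞} (hβ : Measurable β) :
    Measurable (cosetIntegral μM β) := by
  refine LeviQuot.measurable_of_comp ?_
  simp only [cosetIntegral_mk]
  refine Measurable.lintegral_prod_left' (f := fun p : levi k k₁ F × Sp k F => β (p.1 * p.2)) ?_
  exact hβ.comp (by fun_prop)

/-- Tonelli in the coordinates M × Ū × K: φ is constant along M, so integrating β over m alone
produces the coset integral. This is the bridge between measures on M \ G and on G. -/
theorem lintegral_ukMeasure_mul_cosetIntegral {β : Sp k F → ℝ≥0∞} (hβ : Measurable β)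
    {φ : LeviQuot k k₁ F → ℝ≥0∞} (hφ : Measurable φ) :
    ∫⁻ x, φ x * cosetIntegral μM β x ∂(ukMeasure μU μK) =
      ∫⁻ h, φ (LeviQuot.mk k₁ h) * β h ∂(mukMeasure μM μU μK) := by
  have hmk : Measurable (LeviQuot.mk k₁ : Sp k F → LeviQuot k k₁ F) :=
    LeviQuot.continuous_mk.measurable
  have h1 : Measurable fun x => φ x * cosetIntegral μM β x :=
    hφ.mul (measurable_cosetIntegral μM hβ)
  have h2 : Measurable fun h => φ (LeviQuot.mk k₁ h) * β h := (hφ.comp hmk).mul hβ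
  have h3 : Measurable fun p : levi k k₁ F × unip k k₁ F (-1) × maxCompact k F =>
      φ (LeviQuot.mk k₁ (mukMap k k₁ F p)) * β (mukMap k k₁ F p) :=
    h2.comp continuous_mukMap.measurable
  rw [ukMeasure, lintegral_map h1 continuous_ukMap.measurable, mukMeasure,
    lintegral_map h2 continuous_mukMap.measurable,
    lintegral_prod_symm _ h3.aemeasurable]
  refine lintegral_congr fun p => ?_
  have h4 : Measurable fun m : levi k k₁ F =>
      β ((m : Sp k F) * ((p.1 : Sp k F) * (p.2 : Sp k F))) :=
    hβ.comp (measurable_subtype_coe.mul_const _)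
  rw [cosetIntegral_mk, ← lintegral_const_mul _ h4]
  refine lintegral_congr fun m => ?_
  simp only [mukMap, mul_assoc, LeviQuot.mk_levi_mul]

theorem ukMeasure_ne_zero : ukMeasure μU μK ≠ 0 := by
  rw [ukMeasure, Ne, Measure.map_eq_zero_iff continuous_ukMap.measurable.aemeasurable]
  exact NeZero.ne _

/-- The coset integral b of a weight β is positive and finite everywhere. Integrals of φ b on M \ G
become integrals of φ β on G, where right invariance is known. The measure with density b is finite,
and division by b gives σ-finiteness. -/
theorem ukMeasure_invariant_and_sigmaFinite :
    IsRightInvariant (ukMeasure (k₁ := k₁) μU μK) ∧ SigmaFinite (ukMeasure (k₁ := k₁) μU μK) := by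
  let μM : Measure (levi k k₁ F) := Measure.haar
  haveI := isFiniteMeasureOnCompacts_mukMeasure μM μU μK
  obtain ⟨β, hβ, hβint, hβM⟩ := exists_weight μM (mukMeasure μM μU μK)
  set b := cosetIntegral μM β with hb
  have hbm : Measurable b := measurable_cosetIntegral μM hβ
  have hb0 : ∀ x, b x ≠ 0 := fun x => by
    obtain ⟨h, rfl⟩ := LeviQuot.surjective_mk x
    rw [hb, cosetIntegral_mk]; exact (hβM h).1
  have hbt : ∀ x, b x ≠ ⊤ := fun x => by
    obtain ⟨h, rfl⟩ := LeviQuot.surjective_mk x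
    rw [hb, cosetIntegral_mk]; exact (hβM h).2
  constructor
  · intro g
    have hg := LeviQuot.measurable_translate (k₁ := k₁) g
    have key : ∀ φ : LeviQuot k k₁ F → ℝ≥0∞, Measurable φ →
        ∫⁻ x, φ (LeviQuot.translate g x) * b (LeviQuot.translate g x) ∂(ukMeasure μU μK) =
        ∫⁻ x, φ x * b x ∂(ukMeasure μU μK) := by
      intro φ hφ
      have h1 : ∀ x, b (LeviQuot.translate g x) = cosetIntegral μM (fun h => β (h * g)) x := by
        intro x
        obtain ⟨h, rfl⟩ := LeviQuot.surjective_mk x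
        rw [LeviQuot.translate_mk, hb, cosetIntegral_mk, cosetIntegral_mk]
        simp only [mul_assoc]
      simp only [h1]
      rw [lintegral_ukMeasure_mul_cosetIntegral μM μU μK (β := fun h => β (h * g))
        (φ := fun x => φ (LeviQuot.translate g x)) (hβ.comp (measurable_mul_const g))
        (hφ.comp hg), lintegral_ukMeasure_mul_cosetIntegral μM μU μK hβ hφ]
      conv_rhs => rw [← mukMeasure_map_mul_right μM μU μK g]
      have h2 : Measurable fun h => φ (LeviQuot.mk k₁ h) * β h :=
        (hφ.comp LeviQuot.continuous_mk.measurable).mul hβ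
      rw [lintegral_map h2 (measurable_mul_const g)]
      rfl
    ext s hs
    rw [Measure.map_apply hg hs, ← lintegral_indicator_one (hg hs), ← lintegral_indicator_one hs]
    -- The factor b⁻¹ cancels b on both sides of `key`, since on each side the two are evaluated at
    -- the same point.
    have h2 := key (fun x => s.indicator 1 x * (b x)⁻¹)
      ((measurable_one.indicator hs).mul hbm.inv)
    simp only [mul_assoc, ENNReal.inv_mul_cancel (hb0 _) (hbt _), mul_one] at h2
    exact h2
  · have h1 : ∫⁻ x, b x ∂(ukMeasure μU μK) ≠ ⊤ := by
      have := lintegral_ukMeasure_mul_cosetIntegral μM μU μK hβ (φ := fun _ => 1) measurable_const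
      simp only [one_mul] at this
      rw [← hb] at this
      rw [this]
      exact hβint
    haveI : IsFiniteMeasure ((ukMeasure (k₁ := k₁) μU μK).withDensity b) :=
      isFiniteMeasure_withDensity h1
    have h2 := withDensity_inv_same (μ := ukMeasure (k₁ := k₁) μU μK) hbm
      (Filter.Eventually.of_forall hb0) (Filter.Eventually.of_forall hbt)
    rw [← h2]
    exact SigmaFinite.withDensity_of_ne_top
      (Filter.Eventually.of_forall fun x => ENNReal.inv_ne_top.mpr (hb0 x))

/-- An invariant measure on `M \ G` is the image of a product of Haar measures on `Ū` and `K`. -/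
theorem exists_eq_smul_ukMeasure (ν : Measure (LeviQuot k k₁ F)) [ν.Regular]
    (hν : IsRightInvariant ν) (hν0 : ν ≠ 0) :
    ∃ c : ℝ≥0∞, c ≠ 0 ∧ c ≠ ⊤ ∧ ν = c • ukMeasure μU μK := by
  obtain ⟨h1, h2⟩ := ukMeasure_invariant_and_sigmaFinite (k₁ := k₁) μU μK
  let lam : Measure (Sp k F) := Measure.haar
  haveI : lam.IsMulRightInvariant :=
    isMulRightInvariant_of_modularCharacter_eq_one lam sp_modularCharacter_eq_one
  refine LeviQuot.isTransitiveAction.exists_eq_smul (NeZero.ne lam) (fun l₀ N hN h0 => ?_)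
    (fun l => hν l⁻¹) (fun l => h1 l⁻¹) hν0 (ukMeasure_ne_zero μU μK)
  rw [← h0]
  exact measure_preimage_mul_right lam l₀ N

end LeviQuotMeasure

/-! ### Weak integrals and sums in complete locally convex spaces -/

section WeakIntegral

variable {V : Type*} [AddCommGroup V] [Module ℂ V] [UniformSpace V] [IsUniformAddGroup V]
  [ContinuousSMul ℂ V] [LocallyConvexSpace ℝ V]

theorem eq_zero_of_forall_functional [T2Space V] {v : V} (h : ∀ l : V →L[ℂ] ℂ, l v = 0) :
    v = 0 := by
  by_contra hv
  obtain ⟨l, hl⟩ := RCLike.geometric_hahn_banach_point_point (𝕜 := ℂ) hv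
  simp [h l] at hl

instance instContinuousSMulReal : ContinuousSMul ℝ V :=
  IsScalarTower.continuousSMul (M := ℝ) (N := ℂ) (α := V)

/-- The barycentre of f. The closed convex hull of C is compact because V is complete. Finitely many
functionals map it onto a compact convex set containing the vector of their integrals, and the
finite intersection property yields one w for all functionals. -/
theorem exists_weakIntegral [CompleteSpace V] {Q : Type*} [MeasurableSpace Q] (μ : Measure Q)
    [IsProbabilityMeasure μ] (f : Q → V) {C : Set V} (hC : IsCompact C) (hf : ∀ q, f q ∈ C)
    (hm : ∀ l : V →L[ℂ] ℂ, AEStronglyMeasurable (fun q => l (f q)) μ) :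
    ∃ w : V, ∀ l : V →L[ℂ] ℂ, l w = ∫ q, l (f q) ∂μ := by
  have hint : ∀ l : V →L[ℂ] ℂ, Integrable (fun q => l (f q)) μ := fun l => by
    obtain ⟨B, hB⟩ := (hC.image l.continuous).isBounded.exists_norm_le
    exact Integrable.of_bound (hm l) B
      (Filter.Eventually.of_forall fun q => hB _ ⟨_, hf q, rfl⟩)
  set S := closure (convexHull ℝ C) with hS
  have hSc : IsCompact S := isCompact_iff_totallyBounded_isComplete.mpr
    ⟨hC.totallyBounded.convexHull.closure, isClosed_closure.isComplete⟩
  have hSconv : Convex ℝ S := (convex_convexHull ℝ C).closure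
  have hfS : ∀ q, f q ∈ S := fun q => subset_closure (subset_convexHull ℝ C (hf q))
  obtain ⟨w, -, hw⟩ := hSc.inter_iInter_nonempty
    (fun l : V →L[ℂ] ℂ => {w | l w = ∫ q, l (f q) ∂μ})
    (fun l => isClosed_eq l.continuous continuous_const) (fun u => by
      let Φ : V →L[ℂ] (u → ℂ) := ContinuousLinearMap.pi fun l => l.1
      have h1 : Convex ℝ (Φ '' S) := hSconv.linear_image (Φ.toLinearMap.restrictScalars ℝ)
      have h2 : IsClosed (Φ '' S) := (hSc.image Φ.continuous).isClosed
      have h3 : Integrable (fun q => Φ (f q)) μ := Integrable.of_eval fun l => hint l.1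
      obtain ⟨w, hw, hw'⟩ := h1.integral_mem h2
        (Filter.Eventually.of_forall fun q => ⟨_, hfS q, rfl⟩) h3
      refine ⟨w, hw, Set.mem_iInter₂.mpr fun l hl => ?_⟩
      have h4 := congrFun hw' ⟨l, hl⟩
      exact h4.trans ((ContinuousLinearMap.proj (R := ℂ) (φ := fun _ : u => ℂ)
        ⟨l, hl⟩).integral_comp_comm h3).symm)
  exact ⟨w, fun l => Set.mem_iInter.mp hw l⟩

theorem exists_weakIntegral_of_continuous [CompleteSpace V] {Q : Type*} [TopologicalSpace Q]
    [CompactSpace Q] [MeasurableSpace Q] [OpensMeasurableSpace Q] (μ : Measure Q)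
    [IsProbabilityMeasure μ] {f : Q → V} (hf : Continuous f) :
    ∃ w : V, ∀ l : V →L[ℂ] ℂ, l w = ∫ q, l (f q) ∂μ :=
  exists_weakIntegral μ f (isCompact_range hf) Set.mem_range_self fun l =>
    (l.continuous.comp hf).aestronglyMeasurable_of_compactSpace

theorem seminorm_sum_le {ι : Type*} (p : Seminorm ℝ V) (t : Finset ι) (a : ι → V) :
    p (∑ n ∈ t, a n) ≤ ∑ n ∈ t, p (a n) :=
  Finset.le_sum_of_subadditive p (map_zero p).le (map_add_le_add p) t a

theorem continuous_finset_sup_gauge (s : Finset (AbsConvexOpenSets ℝ V)) :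
    Continuous (s.sup (gaugeSeminormFamily ℝ V) : Seminorm ℝ V) :=
  Seminorm.continuous_finsetSup fun i _ =>
    (with_gaugeSeminormFamily (𝕜 := ℝ) (E := V)).continuous_seminorm i

theorem summable_smul_of_isCompact [CompleteSpace V] {c : ℕ → ℝ} (hc : Summable fun n => |c n|)
    {y : ℕ → V} {C : Set V} (hC : IsCompact C) (hy : ∀ n, y n ∈ C) :
    Summable fun n => c n • y n := by
  rw [summable_iff_vanishing]
  intro e he
  have hb := with_gaugeSeminormFamily (𝕜 := ℝ) (E := V)
  obtain ⟨⟨s, r⟩, hr, hsub⟩ := hb.hasBasis_zero_ball.mem_iff.mp he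
  set p : Seminorm ℝ V := s.sup (gaugeSeminormFamily ℝ V) with hp
  have hpc : Continuous p := continuous_finset_sup_gauge s
  obtain ⟨B, hB⟩ := (hC.image hpc).isBounded.exists_norm_le
  have hB' : ∀ n, p (y n) ≤ |B| + 1 := fun n => by
    have := hB _ ⟨_, hy n, rfl⟩
    rw [Real.norm_eq_abs, abs_of_nonneg (apply_nonneg p _)] at this
    linarith [le_abs_self B]
  have hpos : 0 < |B| + 1 := by positivity
  obtain ⟨t, ht⟩ := summable_iff_vanishing.mp hc (Metric.ball 0 (r / (|B| + 1)))
    (Metric.ball_mem_nhds _ (by positivity))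
  refine ⟨t, fun t' ht' => hsub ?_⟩
  rw [Seminorm.mem_ball_zero]
  calc p (∑ n ∈ t', c n • y n) ≤ ∑ n ∈ t', p (c n • y n) := seminorm_sum_le p _ _
    _ ≤ ∑ n ∈ t', |c n| * (|B| + 1) := by
        refine Finset.sum_le_sum fun n _ => ?_
        rw [map_smul_eq_mul, Real.norm_eq_abs]
        exact mul_le_mul_of_nonneg_left (hB' n) (abs_nonneg _)
    _ = (∑ n ∈ t', |c n|) * (|B| + 1) := (Finset.sum_mul _ _ _).symm
    _ < r := by
        have := ht t' ht'
        rw [Metric.mem_ball, dist_zero_right, Real.norm_eq_abs] at this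
        rw [← lt_div_iff₀ hpos]
        exact lt_of_abs_lt this

theorem seminorm_tsum_le {p : Seminorm ℝ V} (hp : Continuous p) {a : ℕ → V} (ha : Summable a)
    {b : ℕ → ℝ} (hb : Summable b) (hab : ∀ n, p (a n) ≤ b n) [T2Space V] :
    p (∑' n, a n) ≤ ∑' n, b n := by
  have h1 := (hp.tendsto _).comp ha.hasSum
  refine le_of_tendsto h1 (Filter.Eventually.of_forall fun t => ?_)
  refine (seminorm_sum_le p t a).trans ((Finset.sum_le_sum fun n _ => hab n).trans ?_)
  exact hb.sum_le_tsum t fun n _ => (apply_nonneg p _).trans (hab n)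

/-- By compactness of C, φ(x, q) - φ(x₀, q) is small in any given continuous seminorm for x near x₀,
uniformly in q; summability of c preserves the estimate. -/
theorem continuous_tsum_smul [CompleteSpace V] [T2Space V] {X Y : Type*} [TopologicalSpace X]
    [TopologicalSpace Y] {φ : X × Y → V} (hφ : Continuous φ) {c : ℕ → ℝ}
    (hc : Summable fun n => |c n|) {y : ℕ → Y} {C : Set Y} (hC : IsCompact C)
    (hy : ∀ n, y n ∈ C) : Continuous fun x => ∑' n, c n • φ (x, y n) := by
  have hsum : ∀ x, Summable fun n => c n • φ (x, y n) := fun x =>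
    summable_smul_of_isCompact hc (hC.image (hφ.comp (Continuous.prodMk_right x)))
      fun n => ⟨y n, hy n, rfl⟩
  rw [continuous_iff_continuousAt]
  intro x₀
  rw [ContinuousAt, ← tendsto_sub_nhds_zero_iff]
  have hb := with_gaugeSeminormFamily (𝕜 := ℝ) (E := V)
  rw [hb.hasBasis_zero_ball.tendsto_right_iff]
  rintro ⟨s, r⟩ hr
  set p : Seminorm ℝ V := s.sup (gaugeSeminormFamily ℝ V) with hp
  have hpc : Continuous p := continuous_finset_sup_gauge s
  set D := ∑' n, |c n| with hD
  have hD0 : 0 ≤ D := tsum_nonneg fun n => abs_nonneg _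
  have hε : 0 < r / (D + 1) := div_pos hr (by positivity)
  have htube : ∀ᶠ x in 𝓝 x₀, ∀ q ∈ C, p (φ (x, q) - φ (x₀, q)) < r / (D + 1) := by
    refine hC.eventually_forall_of_forall_eventually fun q _ => ?_
    have hcont : Continuous fun z : X × Y => p (φ z - φ (x₀, z.2)) := by fun_prop
    refine hcont.continuousAt.eventually (Iio_mem_nhds ?_)
    simpa using hε
  filter_upwards [htube] with x hx
  rw [Seminorm.mem_ball_zero, ← (hsum x).tsum_sub (hsum x₀)]
  refine lt_of_le_of_lt (seminorm_tsum_le hpc ((hsum x).sub (hsum x₀))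
    (hc.mul_right (r / (D + 1))) fun n => ?_) ?_
  · rw [← smul_sub, map_smul_eq_mul, Real.norm_eq_abs]
    exact mul_le_mul_of_nonneg_left (hx _ (hy n)).le (abs_nonneg _)
  · rw [tsum_mul_right, ← hD, mul_div_assoc', div_lt_iff₀ (by positivity)]
    nlinarith

end WeakIntegral

/-! ### The modulus of the parabolic subgroup -/

section Modulus

variable {k k₁ : ℕ} {F : Type*} [RCLike F]

/-- The adjoint action of an element of the Levi subgroup on the nilpotent radical. -/
def adNilrad (k k₁ : ℕ) (F : Type*) [RCLike F] (s : ℤ) (m : levi k k₁ F) :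
    nilrad k k₁ F s →ₗ[ℝ] nilrad k k₁ F s :=
  (conjBy (m : Sp k F)).restrict (conj_mem_nilrad s m)

theorem modulus_eq (s : ℤ) (m : levi k k₁ F) :
    modulus k k₁ F s m = |LinearMap.det (adNilrad k k₁ F s m)| := rfl

theorem adNilrad_mul (s : ℤ) (m m' : levi k k₁ F) :
    adNilrad k k₁ F s (m * m') = adNilrad k k₁ F s m ∘ₗ adNilrad k k₁ F s m' := by
  ext1 X
  refine Subtype.ext ?_
  change mat (m * m' : Sp k F) * X.1 * mat (m * m' : Sp k F)⁻¹ =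
    mat (m : Sp k F) * (mat (m' : Sp k F) * X.1 * mat (m' : Sp k F)⁻¹) * mat (m : Sp k F)⁻¹
  rw [_root_.mul_inv_rev, mat_mul, mat_mul]
  simp only [Matrix.mul_assoc]

theorem adNilrad_one (s : ℤ) : adNilrad k k₁ F s 1 = LinearMap.id := by
  ext1 X
  refine Subtype.ext ?_
  change mat (1 : Sp k F) * X.1 * mat (1 : Sp k F)⁻¹ = X.1
  rw [inv_one, mat_one, Matrix.one_mul, Matrix.mul_one]

theorem modulus_mul (s : ℤ) (m m' : levi k k₁ F) :
    modulus k k₁ F s (m * m') = modulus k k₁ F s m * modulus k k₁ F s m' := by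
  rw [modulus_eq, adNilrad_mul, LinearMap.det_comp, abs_mul]
  rfl

theorem modulus_one (s : ℤ) : modulus k k₁ F s 1 = 1 := by
  rw [modulus_eq, adNilrad_one, LinearMap.det_id, abs_one]

theorem modulus_pos (s : ℤ) (m : levi k k₁ F) : 0 < modulus k k₁ F s m := by
  refine lt_of_le_of_ne (abs_nonneg _) fun h => ?_
  have h1 := modulus_mul s m m⁻¹
  rw [mul_inv_cancel, modulus_one, ← h, zero_mul] at h1
  exact one_ne_zero h1

/-- Since m⁻¹ = -J mᵀ J, conjugation by m is polynomial in the matrix entries. A linear retraction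
`P` onto the nilradical lets its matrix coefficients, and so the determinant, make sense for all
matrices. -/
theorem exists_contDiff_det_adNilrad (k k₁ : ℕ) (F : Type*) [RCLike F] (s : ℤ) :
    ∃ D : (Fin k ⊕ Fin k → Fin k ⊕ Fin k → F) → ℝ, ContDiff ℝ ∞ D ∧
      ∀ m : levi k k₁ F, LinearMap.det (adNilrad k k₁ F s m) = D (entries (m : Sp k F)) := by
  classical
  haveI : FiniteDimensional ℝ (Matrix (Fin k ⊕ Fin k) (Fin k ⊕ Fin k) F) :=
    inferInstanceAs (FiniteDimensional ℝ (Fin k ⊕ Fin k → Fin k ⊕ Fin k → F))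
  obtain ⟨P, hP⟩ := LinearMap.exists_leftInverse_of_injective (nilrad k k₁ F s).subtype
    (Submodule.ker_subtype _)
  let b := Module.finBasis ℝ (nilrad k k₁ F s)
  let R : Matrix (Fin k ⊕ Fin k) (Fin k ⊕ Fin k) F → (Fin k ⊕ Fin k → Fin k ⊕ Fin k → F) →
      (Fin k ⊕ Fin k → Fin k ⊕ Fin k → F) := fun X e =>
    Matrix.of e * X * (-Matrix.J (Fin k) F * (Matrix.of e)ᵀ * Matrix.J (Fin k) F)
  have hR : ∀ X, ContDiff ℝ ∞ (R X) := by
    intro X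
    refine contDiff_pi.mpr fun i => contDiff_pi.mpr fun j => ?_
    simp only [R, Matrix.mul_apply, Matrix.of_apply, Matrix.transpose_apply]
    refine ContDiff.sum fun a _ => ContDiff.mul (ContDiff.sum fun c _ => ?_)
      (ContDiff.sum fun c _ => ContDiff.mul (ContDiff.sum fun d _ => ?_) contDiff_const)
    · exact (contDiff_apply_apply ℝ F i c).mul contDiff_const
    · exact contDiff_const.mul (contDiff_apply_apply ℝ F c d)
  let ψ : ∀ i, (Fin k ⊕ Fin k → Fin k ⊕ Fin k → F) →ₗ[ℝ] ℝ := fun i =>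
    b.coord i ∘ₗ P ∘ₗ (Matrix.ofLinearEquiv ℝ).toLinearMap
  refine ⟨fun e => Matrix.det (Matrix.of fun i j => ψ i (R (b j) e)), ?_, fun m => ?_⟩
  · simp only [Matrix.det_apply, Matrix.of_apply]
    refine ContDiff.sum fun p _ => ContDiff.const_smul _ (contDiff_prod fun i _ => ?_)
    exact (LinearMap.toContinuousLinearMap (ψ (p i))).contDiff.comp (hR (b i))
  · rw [← LinearMap.det_toMatrix b]
    congr 1
    ext i j
    rw [LinearMap.toMatrix_apply]
    have h1 := LinearMap.congr_fun hP (adNilrad k k₁ F s m (b j))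
    exact (congrArg (fun v => b.repr v i) h1).symm

theorem smoothAlong_sqrt_modulus (s : ℤ) :
    SmoothAlong (fun m : levi k k₁ F => entries (m : Sp k F))
      fun m => ((√(modulus k k₁ F s m) : ℝ) : ℂ) := by
  intro m
  obtain ⟨D, hD, hDm⟩ := exists_contDiff_det_adNilrad k k₁ F s
  have hne : D (entries (m : Sp k F)) ≠ 0 := by
    rw [← hDm, ← abs_pos]
    exact modulus_pos s m
  refine ⟨fun e => ((√|D e| : ℝ) : ℂ), ?_, Filter.Eventually.of_forall fun m' => ?_⟩
  · refine Complex.ofRealCLM.contDiff.contDiffAt.comp _ ?_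
    exact ((contDiffAt_abs hne).comp _ hD.contDiffAt).sqrt (abs_ne_zero.mpr hne)
  · simp only [modulus_eq, hDm]

theorem continuous_entries_levi : Continuous fun m : levi k k₁ F => entries (m : Sp k F) :=
  continuous_entries.comp continuous_subtype_val

theorem continuous_modulus (s : ℤ) : Continuous (modulus k k₁ F s) := by
  obtain ⟨D, hD, hDm⟩ := exists_contDiff_det_adNilrad k k₁ F s
  have : modulus k k₁ F s = fun m : levi k k₁ F => |D (entries (m : Sp k F))| := by
    funext m; rw [modulus_eq, hDm]
  rw [this]
  exact (hD.continuous.comp continuous_entries_levi).abs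

/-- The modulus is a homomorphism to the positive reals that is bounded on a compact group, hence
trivial there. -/
theorem modulus_leviCompact (s : ℤ) {c : levi k k₁ F} (hc : c ∈ leviCompact k k₁ F) :
    modulus k k₁ F s c = 1 := by
  have hbd : ∃ B, ∀ x ∈ leviCompact k k₁ F, modulus k k₁ F s x ≤ B := by
    obtain ⟨B, hB⟩ := (isCompact_iff_compactSpace.mpr
      (instCompactSpaceLeviCompact (k := k) (F := F) k₁)).bddAbove_image
        (continuous_modulus s).continuousOn
    exact ⟨B, fun x hx => hB ⟨x, hx, rfl⟩⟩
  obtain ⟨B, hB⟩ := hbd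
  have key : ∀ x ∈ leviCompact k k₁ F, modulus k k₁ F s x ≤ 1 := by
    intro x hx
    by_contra h
    obtain ⟨n, hn⟩ := pow_unbounded_of_one_lt B (not_le.mp h)
    have : ∀ n : ℕ, modulus k k₁ F s (x ^ n) = modulus k k₁ F s x ^ n := by
      intro n
      induction n with
      | zero => simp [modulus_one]
      | succ n ih => rw [pow_succ, modulus_mul, ih, pow_succ]
    exact absurd (hB _ ((leviCompact k k₁ F).pow_mem hx n)) (by rw [this]; exact not_le.mpr hn)
  refine le_antisymm (key c hc) ?_
  have h1 := key _ ((leviCompact k k₁ F).inv_mem hc)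
  have h2 := modulus_mul s c c⁻¹
  rw [mul_inv_cancel, modulus_one] at h2
  nlinarith [modulus_pos s c]

end Modulus

/-! ### Finite-dimensional spaces of kernels -/

section KernelBasis

/-- A finite-dimensional space of functions is determined by finitely many evaluations. -/
theorem exists_evaluation_expansion {X : Type*} (W : Submodule ℂ (X → ℂ))
    [FiniteDimensional ℂ W] :
    ∃ (n : ℕ) (x : Fin n → X) (h : Fin n → X → ℂ), (∀ i, h i ∈ W) ∧
      ∀ f ∈ W, ∀ y, f y = ∑ i, f (x i) * h i y := by
  classical
  let ev : X → Module.Dual ℂ W := fun y => (LinearMap.proj y).comp W.subtype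
  have hfg : (Submodule.span ℂ (Set.range ev)).FG := IsNoetherian.noetherian _
  obtain ⟨t, ht, hspan⟩ := Submodule.fg_span_iff_fg_span_finset_subset _ |>.mp hfg
  choose x hx using fun τ : t => ht τ.2
  let e := t.equivFin
  -- Finitely many evaluations span all the others, so together they are injective on `W`. The
  -- functions `h i` are the images of the unit vectors under a left inverse of `L`.
  let L : W →ₗ[ℂ] (Fin t.card → ℂ) := LinearMap.pi fun i => ev (x (e.symm i))
  have hL : LinearMap.ker L = ⊥ := by
    refine LinearMap.ker_eq_bot'.mpr fun f hf => Subtype.ext (funext fun y => ?_)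
    have h1 : ev y ∈ Submodule.span ℂ (t : Set (Module.Dual ℂ W)) := by
      rw [← hspan]; exact Submodule.subset_span ⟨y, rfl⟩
    have h2 : ∀ φ ∈ Submodule.span ℂ (t : Set (Module.Dual ℂ W)), φ f = 0 := by
      intro φ hφ
      induction hφ using Submodule.span_induction with
      | mem τ hτ =>
        have h3 := congrFun hf (e ⟨τ, hτ⟩)
        have h4 : ev (x (e.symm (e ⟨τ, hτ⟩))) f = 0 := h3
        rwa [e.symm_apply_apply, hx] at h4
      | zero => rfl
      | add a b _ _ ha hb => rw [LinearMap.add_apply, ha, hb, add_zero]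
      | smul c a _ ha => rw [LinearMap.smul_apply, ha, smul_zero]
    exact h2 _ h1
  obtain ⟨R, hR⟩ := LinearMap.exists_leftInverse_of_injective L hL
  refine ⟨t.card, fun i => x (e.symm i), fun i => (R (Pi.single i 1)).1,
    fun i => (R (Pi.single i 1)).2, fun f hf y => ?_⟩
  have h1 := LinearMap.congr_fun hR ⟨f, hf⟩
  rw [LinearMap.comp_apply, LinearMap.pi_apply_eq_sum_univ R (L ⟨f, hf⟩)] at h1
  have h2 := congrFun (congrArg Subtype.val h1) y
  simp only [Submodule.coe_sum, Finset.sum_apply, LinearMap.id_apply] at h2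
  refine h2.symm.trans (Finset.sum_congr rfl fun i _ => ?_)
  simp only [Submodule.coe_smul, Pi.smul_apply, smul_eq_mul]
  have h3 : (fun j => if i = j then (1 : ℂ) else 0) = Pi.single i 1 := by
    ext j; simp [Pi.single_apply, eq_comm]
  rw [h3]
  rfl

variable {k k₁ : ℕ} {F : Type*} [RCLike F]
variable {V : Type*} [AddCommGroup V] [Module ℂ V] [TopologicalSpace V]

/-- Finitely many kernels with the invariance and coefficient properties, whose right translates
by `K × K` are expressed through each other. -/
structure KernelBasis (σ : levi k k₁ F →* (V →L[ℂ] V)) (n : ℕ) where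
  /-- The kernels. -/
  h : Fin n → Sp k F → Sp k F → ℂ
  /-- The matrix of right translation in the first variable. -/
  A : Fin n → Fin n → Sp k F → ℂ
  /-- The matrix of right translation in the second variable. -/
  B : Fin n → Fin n → Sp k F → ℂ
  invariant : ∀ q (u₁ : unip k k₁ F 1) (u₂ : unip k k₁ F (-1)) (m : levi k k₁ F) (g₁ g₂ : Sp k F),
    h q (u₁ * m * g₁) (u₂ * m * g₂) = h q g₁ g₂
  coefficient : ∀ q (g₁ g₂ : Sp k F), ∃ φ ∈ coefficients σ, ∀ m : levi k k₁ F,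
    h q (m * g₁) g₂ = ((√(modulus k k₁ F 1 m) : ℝ) : ℂ) * φ m
  smooth_A : ∀ q i, SmoothAlong entries (A q i)
  smooth_B : ∀ q i, SmoothAlong entries (B q i)
  translate_A : ∀ q (x : maxCompact k F) (g₁ g₂ : Sp k F),
    h q (g₁ * x) g₂ = ∑ i, A q i x * h i g₁ g₂
  translate_B : ∀ q (x : maxCompact k F) (g₁ g₂ : Sp k F),
    h q g₁ (g₂ * x) = ∑ i, B q i x * h i g₁ g₂
  A_mul : ∀ q j (x y : maxCompact k F), A q j (x * y) = ∑ i, A q i y * A i j x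
  B_mul : ∀ q j (x y : maxCompact k F), B q j (x * y) = ∑ i, B q i y * B i j x

theorem smoothMap_const_mul (a : Sp k F) :
    SmoothMapAlong entries entries fun x : Sp k F => a * x := by
  refine fun x => ⟨fun e i j => ∑ b, mat a i b * e b j, ContDiff.contDiffAt ?_,
    Filter.Eventually.of_forall fun y => by
      funext i j; simp [entries, Matrix.mul_apply]⟩
  refine contDiff_pi.mpr fun i => contDiff_pi.mpr fun j => ContDiff.sum fun b _ => ?_
  exact contDiff_const.mul (contDiff_apply_apply ℝ F b j)

theorem smoothMap_mul_const (a : Sp k F) :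
    SmoothMapAlong entries entries fun x : Sp k F => x * a := by
  refine fun x => ⟨fun e i j => ∑ b, e i b * mat a b j, ContDiff.contDiffAt ?_,
    Filter.Eventually.of_forall fun y => by
      funext i j; simp [entries, Matrix.mul_apply]⟩
  refine contDiff_pi.mpr fun i => contDiff_pi.mpr fun j => ContDiff.sum fun b _ => ?_
  exact (contDiff_apply_apply ℝ F i b).mul contDiff_const

theorem SmoothMapAlong.prodMap {X Y X' Y' E E₁ E' E₁' : Type*}
    [TopologicalSpace X] [TopologicalSpace Y] [TopologicalSpace X'] [TopologicalSpace Y']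
    [NormedAddCommGroup E] [NormedSpace ℝ E] [NormedAddCommGroup E₁] [NormedSpace ℝ E₁]
    [NormedAddCommGroup E'] [NormedSpace ℝ E'] [NormedAddCommGroup E₁'] [NormedSpace ℝ E₁']
    {ι : X → E} {ι₁ : Y → E₁} {ι' : X' → E'} {ι₁' : Y' → E₁'} {τ : X → Y} {τ' : X' → Y'}
    (h : SmoothMapAlong ι ι₁ τ) (h' : SmoothMapAlong ι' ι₁' τ') :
    SmoothMapAlong (fun p : X × X' => (ι p.1, ι' p.2)) (fun p : Y × Y' => (ι₁ p.1, ι₁' p.2))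
      fun p => (τ p.1, τ' p.2) := by
  rintro ⟨x, x'⟩
  obtain ⟨T, hT, hx⟩ := h x
  obtain ⟨T', hT', hx'⟩ := h' x'
  refine ⟨fun e => (T e.1, T' e.2), (ContDiffAt.comp (f := Prod.fst) (ι x, ι' x') hT
    contDiffAt_fst).prodMk (ContDiffAt.comp (f := Prod.snd) (ι x, ι' x') hT' contDiffAt_snd),
    ?_⟩
  filter_upwards [hx.prod_nhds hx'] with p hp
  rw [hp.1, hp.2]

theorem smoothMap_prodMk_const {E X : Type*} [TopologicalSpace X] [NormedAddCommGroup E]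
    [NormedSpace ℝ E] (ι : X → E) {Y E' : Type*} [TopologicalSpace Y] [NormedAddCommGroup E']
    [NormedSpace ℝ E'] (ι' : Y → E') (b : Y) :
    SmoothMapAlong ι (fun p : X × Y => (ι p.1, ι' p.2)) fun x => (x, b) :=
  fun _ => ⟨fun e => (e, ι' b), contDiffAt_id.prodMk contDiffAt_const,
    Filter.Eventually.of_forall fun _ => rfl⟩

theorem smoothMap_const_prodMk {E X : Type*} [TopologicalSpace X] [NormedAddCommGroup E]
    [NormedSpace ℝ E] (ι : X → E) {Y E' : Type*} [TopologicalSpace Y] [NormedAddCommGroup E']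
    [NormedSpace ℝ E'] (ι' : Y → E') (b : Y) :
    SmoothMapAlong ι (fun p : Y × X => (ι' p.1, ι p.2)) fun x => (b, x) :=
  fun _ => ⟨fun e => (ι' b, e), contDiffAt_const.prodMk contDiffAt_id,
    Filter.Eventually.of_forall fun _ => rfl⟩

theorem IsCoeffKernel.exists_kernelBasis {σ : levi k k₁ F →* (V →L[ℂ] V)}
    {H : Sp k F → Sp k F → ℂ} (hH : IsCoeffKernel σ H) :
    ∃ (n : ℕ) (b : KernelBasis σ n) (a : Fin n → ℂ), ∀ g₁ g₂, H g₁ g₂ = ∑ q, a q * b.h q g₁ g₂ := by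
  set W := Submodule.span ℂ
    (Set.range fun (x : maxCompact k F × maxCompact k F) (p : Sp k F × Sp k F) =>
      H (p.1 * x.1) (p.2 * x.2)) with hW
  haveI : FiniteDimensional ℂ W := hH.finite
  have hinv : ∀ f ∈ W, ∀ (u₁ : unip k k₁ F 1) (u₂ : unip k k₁ F (-1)) (m : levi k k₁ F)
      (g₁ g₂ : Sp k F), f (u₁ * m * g₁, u₂ * m * g₂) = f (g₁, g₂) := by
    intro f hf u₁ u₂ m g₁ g₂
    induction hf using Submodule.span_induction with
    | mem f hf =>
      obtain ⟨x, rfl⟩ := hf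
      simpa [mul_assoc] using hH.invariant u₁ u₂ m (g₁ * x.1) (g₂ * x.2)
    | zero => rfl
    | add a b _ _ ha hb => rw [Pi.add_apply, Pi.add_apply, ha, hb]
    | smul c a _ ha => rw [Pi.smul_apply, Pi.smul_apply, ha]
  have hcoef : ∀ f ∈ W, ∀ (g₁ g₂ : Sp k F), ∃ φ ∈ coefficients σ, ∀ m : levi k k₁ F,
      f (m * g₁, g₂) = ((√(modulus k k₁ F 1 m) : ℝ) : ℂ) * φ m := by
    intro f hf g₁ g₂
    induction hf using Submodule.span_induction with
    | mem f hf =>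
      obtain ⟨x, rfl⟩ := hf
      simpa [mul_assoc] using hH.coefficient (g₁ * x.1) (g₂ * x.2)
    | zero => exact ⟨0, zero_mem _, fun m => by simp⟩
    | add a b _ _ ha hb =>
      obtain ⟨φ, hφ, h1⟩ := ha
      obtain ⟨φ', hφ', h2⟩ := hb
      exact ⟨φ + φ', add_mem hφ hφ', fun m => by
        rw [Pi.add_apply, Pi.add_apply, h1, h2, mul_add]⟩
    | smul c a _ ha =>
      obtain ⟨φ, hφ, h1⟩ := ha
      exact ⟨c • φ, Submodule.smul_mem _ c hφ, fun m => by
        rw [Pi.smul_apply, Pi.smul_apply, h1, smul_eq_mul, smul_eq_mul]; ring⟩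
  have hsm : ∀ f ∈ W, SmoothAlong (fun p : Sp k F × Sp k F => (entries p.1, entries p.2)) f := by
    intro f hf
    induction hf using Submodule.span_induction with
    | mem f hf =>
      obtain ⟨x, rfl⟩ := hf
      exact hH.smooth.comp ((smoothMap_mul_const (x.1 : Sp k F)).prodMap
        (smoothMap_mul_const (x.2 : Sp k F))) (by fun_prop)
    | zero => exact smoothAlong_const _ 0
    | add a b _ _ ha hb =>
      intro x
      obtain ⟨α, hα, hα'⟩ := ha x
      obtain ⟨β, hβ, hβ'⟩ := hb x
      exact ⟨fun e => α e + β e, hα.add hβ, by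
        filter_upwards [hα', hβ'] with y h1 h2; rw [Pi.add_apply, h1, h2]⟩
    | smul c a _ ha => exact (smoothAlong_const _ c).mul ha
  have htr : ∀ f ∈ W, ∀ x y : maxCompact k F, (fun p => f (p.1 * x, p.2 * y)) ∈ W := by
    intro f hf x y
    induction hf using Submodule.span_induction with
    | mem f hf =>
      obtain ⟨z, rfl⟩ := hf
      refine Submodule.subset_span ⟨(x * z.1, y * z.2), ?_⟩
      funext p
      simp [mul_assoc]
    | zero => exact zero_mem _
    | add a b _ _ ha hb => exact add_mem ha hb
    | smul c a _ ha => exact Submodule.smul_mem _ c ha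
  obtain ⟨n, x, h, hmem, hexp⟩ := exists_evaluation_expansion W
  -- Translates by K stay in `W` and are expanded through evaluation at the points `x i`. The
  -- coefficients are values of `h q`, which makes them smooth functions on all of G.
  have hA : ∀ q (y : maxCompact k F) (g₁ g₂ : Sp k F), h q (g₁ * y, g₂) =
      ∑ i, h q ((x i).1 * y, (x i).2) * h i (g₁, g₂) := fun q y g₁ g₂ => by
    simpa using hexp _ (htr _ (hmem q) y 1) (g₁, g₂)
  have hB : ∀ q (y : maxCompact k F) (g₁ g₂ : Sp k F), h q (g₁, g₂ * y) =
      ∑ i, h q ((x i).1, (x i).2 * y) * h i (g₁, g₂) := fun q y g₁ g₂ => by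
    simpa using hexp _ (htr _ (hmem q) 1 y) (g₁, g₂)
  refine ⟨n,
    { h := fun q g₁ g₂ => h q (g₁, g₂)
      A := fun q i y => h q ((x i).1 * y, (x i).2)
      B := fun q i y => h q ((x i).1, (x i).2 * y)
      invariant := fun q => hinv _ (hmem q)
      coefficient := fun q => hcoef _ (hmem q)
      smooth_A := fun q i => ((hsm _ (hmem q)).comp
        (smoothMap_prodMk_const entries entries (x i).2) (by fun_prop)).comp
          (smoothMap_const_mul (x i).1) (by fun_prop)
      smooth_B := fun q i => ((hsm _ (hmem q)).comp
        (smoothMap_const_prodMk entries entries (x i).1) (by fun_prop)).comp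
          (smoothMap_const_mul (x i).2) (by fun_prop)
      translate_A := hA
      translate_B := hB
      A_mul := fun q j y z => by
        simpa [mul_assoc] using hA q z ((x j).1 * y) (x j).2
      B_mul := fun q j y z => by
        simpa [mul_assoc] using hB q z (x j).1 ((x j).2 * y) },
    fun q => H (x q).1 (x q).2, fun g₁ g₂ => ?_⟩
  have hHW : (fun p : Sp k F × Sp k F => H p.1 p.2) ∈ W :=
    Submodule.subset_span ⟨(1, 1), by funext p; simp⟩
  exact hexp _ hHW (g₁, g₂)

theorem exists_eq_sum_of_mem_coefficients {Γ : Type*} [Group Γ] [TopologicalSpace Γ]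
    {ρ : Γ →* (V →L[ℂ] V)} {φ : Γ → ℂ} (hφ : φ ∈ coefficients ρ) :
    ∃ (N : ℕ) (v : Fin N → V) (l : Fin N → V →L[ℂ] ℂ), ∀ g, φ g = ∑ j, l j (ρ g (v j)) := by
  induction hφ using Submodule.span_induction with
  | mem φ h =>
    obtain ⟨v, l, rfl⟩ := h
    exact ⟨1, fun _ => v, fun _ => l, fun g => by simp⟩
  | zero => exact ⟨0, Fin.elim0, Fin.elim0, fun g => by simp⟩
  | add a b _ _ ha hb =>
    obtain ⟨N, v, l, h⟩ := ha
    obtain ⟨N', v', l', h'⟩ := hb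
    refine ⟨N + N', Fin.append v v', Fin.append l l', fun g => ?_⟩
    rw [Pi.add_apply, h, h', Fin.sum_univ_add]
    simp
  | smul c a _ ha =>
    obtain ⟨N, v, l, h⟩ := ha
    refine ⟨N, fun j => c • v j, l, fun g => ?_⟩
    rw [Pi.smul_apply, h, Finset.smul_sum]
    simp

end KernelBasis

/-! ### Averaging over a compact group -/

section Averaging

/-- Continuity of the integral comes from compactness of Q: for v near v₀ the values `Θ q v` and `Θ
q v₀` are close uniformly in q. -/
theorem exists_integral_functional {Q : Type*} [TopologicalSpace Q] [CompactSpace Q]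
    [MeasurableSpace Q] [OpensMeasurableSpace Q] (μ : Measure Q) [IsFiniteMeasure μ]
    {E : Type*} [AddCommGroup E] [Module ℂ E] [TopologicalSpace E] (Θ : Q → E →L[ℂ] ℂ)
    (hΘ : Continuous fun p : Q × E => Θ p.1 p.2) :
    ∃ lam : E →L[ℂ] ℂ, ∀ v, lam v = ∫ q, Θ q v ∂μ := by
  have hc : ∀ v, Continuous fun q => Θ q v := fun v => hΘ.comp (Continuous.prodMk_left v)
  have hint : ∀ v, Integrable (fun q => Θ q v) μ := fun v => by
    obtain ⟨C, hC⟩ := (isCompact_range (hc v)).isBounded.exists_norm_le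
    exact Integrable.of_bound (hc v).aestronglyMeasurable_of_compactSpace C
      (Filter.Eventually.of_forall fun q => hC _ ⟨q, rfl⟩)
  refine ⟨⟨⟨⟨fun v => ∫ q, Θ q v ∂μ, fun v w => ?_⟩, fun a v => ?_⟩, ?_⟩, fun v => rfl⟩
  · simp only [map_add]
    exact integral_add (hint v) (hint w)
  · simp only [map_smul]
    exact integral_smul a _
  · change Continuous fun v => ∫ q, Θ q v ∂μ
    rw [continuous_iff_continuousAt]
    intro v₀
    rw [ContinuousAt, Metric.tendsto_nhds]
    intro ε hε
    have hpos : 0 < ε / (μ.real Set.univ + 1) := by positivity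
    have htube : ∀ᶠ v in 𝓝 v₀, ∀ q ∈ (Set.univ : Set Q),
        ‖Θ q v - Θ q v₀‖ < ε / (μ.real Set.univ + 1) := by
      refine isCompact_univ.eventually_forall_of_forall_eventually fun q _ => ?_
      have hcont : Continuous fun z : E × Q => ‖Θ z.2 z.1 - Θ z.2 v₀‖ :=
        ((hΘ.comp (continuous_snd.prodMk continuous_fst)).sub
          ((hc v₀).comp continuous_snd)).norm
      refine hcont.continuousAt.eventually (Iio_mem_nhds ?_)
      simpa using hpos
    filter_upwards [htube] with v hv
    rw [dist_eq_norm, ← integral_sub (hint v) (hint v₀)]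
    refine lt_of_le_of_lt (norm_integral_le_of_norm_le_const
      (Filter.Eventually.of_forall fun q => (hv q trivial).le)) ?_
    rw [div_mul_eq_mul_div, div_lt_iff₀ (by positivity)]
    nlinarith

variable {k k₁ : ℕ} {F : Type*} [RCLike F]
variable {V : Type*} [AddCommGroup V] [Module ℂ V]

instance instSecondCountableLeviCompact : SecondCountableTopology (leviCompact k k₁ F) :=
  TopologicalSpace.Subtype.secondCountableTopology _

/-- The normalised Haar measure of `K ∩ M`. -/
def leviCompactHaar (k k₁ : ℕ) (F : Type*) [RCLike F] : Measure (leviCompact k k₁ F) :=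
  Measure.haarMeasure ⊤

instance instIsHaarLeviCompactHaar : (leviCompactHaar k k₁ F).IsHaarMeasure :=
  inferInstanceAs (Measure.haarMeasure ⊤).IsHaarMeasure

instance instIsProbabilityLeviCompactHaar : IsProbabilityMeasure (leviCompactHaar k k₁ F) :=
  ⟨by simpa [leviCompactHaar] using Measure.haarMeasure_self (K₀ := (⊤ : TopologicalSpace.PositiveCompacts
    (leviCompact k k₁ F)))⟩

instance instRightInvariantLeviCompactHaar : (leviCompactHaar k k₁ F).IsMulRightInvariant :=
  isMulRightInvariant_of_modularCharacter_eq_one _ fun x =>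
    modularCharacter_eq_one_of_isCompact (S := ⊤) isCompact_univ x trivial

theorem isFiniteFunctional_of_sum {Γ : Type*} [Group Γ] [TopologicalSpace Γ] [TopologicalSpace V]
    {ρ : Γ →* (V →L[ℂ] V)}
    {L : Subgroup Γ} {ι : Type*} [Finite ι] {l : V →L[ℂ] ℂ} (e : ι → V →L[ℂ] ℂ)
    (h : ∀ x : L, l.comp (ρ x) ∈ Submodule.span ℂ (Set.range e)) :
    IsFiniteFunctional ρ L l := by
  haveI : FiniteDimensional ℂ (Submodule.span ℂ (Set.range e)) :=
    FiniteDimensional.span_of_finite ℂ (Set.finite_range e)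
  exact Submodule.finiteDimensional_of_le (Submodule.span_le.mpr (Set.range_subset_iff.mpr h))

theorem isFiniteVec_of_sum {Γ : Type*} [Group Γ] [TopologicalSpace Γ] [TopologicalSpace V]
    {ρ : Γ →* (V →L[ℂ] V)}
    {L : Subgroup Γ} {ι : Type*} [Finite ι] {v : V} (e : ι → V)
    (h : ∀ x : L, ρ x v ∈ Submodule.span ℂ (Set.range e)) : IsFiniteVec ρ L v := by
  haveI : FiniteDimensional ℂ (Submodule.span ℂ (Set.range e)) :=
    FiniteDimensional.span_of_finite ℂ (Set.finite_range e)
  exact Submodule.finiteDimensional_of_le (Submodule.span_le.mpr (Set.range_subset_iff.mpr h))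

/-- An element of `K ∩ M` as an element of `K`. -/
def toMaxCompact (c : leviCompact k k₁ F) : maxCompact k F := ⟨((c : levi k k₁ F) : Sp k F), c.2⟩

theorem coe_toMaxCompact (c : leviCompact k k₁ F) :
    ((toMaxCompact c : maxCompact k F) : Sp k F) = ((c : levi k k₁ F) : Sp k F) := rfl

variable [UniformSpace V] [IsUniformAddGroup V]
    [ContinuousSMul ℂ V] [LocallyConvexSpace ℝ V] [T2Space V] [CompleteSpace V]
  {σ : levi k k₁ F →* (V →L[ℂ] V)} {n : ℕ}

theorem integrable_leviCompactHaar {φ : leviCompact k k₁ F → ℂ} (hφ : Continuous φ) :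
    Integrable φ (leviCompactHaar k k₁ F) := by
  obtain ⟨C, hC⟩ := (isCompact_range hφ).isBounded.exists_norm_le
  exact Integrable.of_bound hφ.aestronglyMeasurable_of_compactSpace C
    (Filter.Eventually.of_forall fun q => hC _ ⟨q, rfl⟩)

theorem KernelBasis.continuous_A (b : KernelBasis σ n) (q i : Fin n) : Continuous (b.A q i) :=
  (b.smooth_A q i).continuous continuous_entries

theorem KernelBasis.continuous_B (b : KernelBasis σ n) (q i : Fin n) : Continuous (b.B q i) :=
  (b.smooth_B q i).continuous continuous_entries

theorem eq_of_forall_functional_eq {v w : V} (h : ∀ l : V →L[ℂ] ℂ, l v = l w) : v = w :=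
  sub_eq_zero.mp (eq_zero_of_forall_functional fun l => by rw [map_sub, h, sub_self])

/-- Let φ_r(m) = δ_P(m)^{-1/2} h_r(m, 1). For c in K ∩ M, where δ_P is trivial, invariance under (c,
c) gives φ_r(m) = ∑ B_{ri}(c) φ_i(c m), and right translation gives φ_r(m) = ∑ A_{rs}(c) φ_s(m c⁻¹).
Averaging the former over c makes the functionals K ∩ M-finite; averaging the latter makes the
vectors transform through A. -/
theorem KernelBasis.exists_matrix_coefficients (b : KernelBasis σ n) (hσ : IsContRep σ) :
    ∃ (ι : Type) (_ : Fintype ι) (ℓ : ι → V →L[ℂ] ℂ) (w : Fin n → ι → V),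
      (∀ J, IsFiniteFunctional σ (leviCompact k k₁ F) (ℓ J)) ∧
      (∀ r J (c : leviCompact k k₁ F), σ c (w r J) = ∑ s, b.A r s (c : levi k k₁ F) • w s J) ∧
      ∀ r (m : levi k k₁ F), b.h r m 1 = ((√(modulus k k₁ F 1 m) : ℝ) : ℂ) *
        ∑ J, ℓ J (σ m (w r J)) := by
  choose φ hφ hφm using fun i => b.coefficient i 1 1
  choose N v l hl using fun i => exists_eq_sum_of_mem_coefficients (hφ i)
  simp only [mul_one] at hφm
  have hne : ∀ m : levi k k₁ F, ((√(modulus k k₁ F 1 m) : ℝ) : ℂ) ≠ 0 := fun m => by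
    exact_mod_cast (Real.sqrt_pos.mpr (modulus_pos 1 m)).ne'
  have hσc : Continuous fun p : leviCompact k k₁ F × V => σ p.1 p.2 :=
    hσ.comp ((continuous_subtype_val.comp continuous_fst).prodMk continuous_snd)
  have hBφ : ∀ r (c : leviCompact k k₁ F) m,
      φ r m = ∑ i, b.B r i (c : levi k k₁ F) * φ i (c * m) := by
    intro r c m
    have h1 := b.invariant r 1 1 c m 1
    have h2 := b.translate_B r (toMaxCompact c) ((c : levi k k₁ F) * m : levi k k₁ F) 1
    simp only [OneMemClass.coe_one, one_mul, mul_one, coe_toMaxCompact, Subgroup.coe_mul] at h1 h2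
    rw [h1, hφm] at h2
    refine mul_left_cancel₀ (hne m) (h2.trans ?_)
    rw [Finset.mul_sum]
    refine Finset.sum_congr rfl fun i _ => ?_
    have h3 := hφm i (c * m)
    rw [modulus_mul, modulus_leviCompact 1 c.2, one_mul] at h3
    rw [← Subgroup.coe_mul, h3]
    ring
  have hAφ : ∀ r (c : leviCompact k k₁ F) m,
      φ r m = ∑ s, b.A r s (c : levi k k₁ F) * φ s (m * (c : levi k k₁ F)⁻¹) := by
    intro r c m
    have h2 := b.translate_A r (toMaxCompact c) (m * (c : levi k k₁ F)⁻¹ : levi k k₁ F) 1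
    have h4 : ((m * (c : levi k k₁ F)⁻¹ : levi k k₁ F) : Sp k F) * toMaxCompact c = m := by
      rw [coe_toMaxCompact, ← Subgroup.coe_mul, inv_mul_cancel_right]
    rw [h4, hφm] at h2
    refine mul_left_cancel₀ (hne m) (h2.trans ?_)
    rw [Finset.mul_sum]
    refine Finset.sum_congr rfl fun i _ => ?_
    have h3 := hφm i (m * (c : levi k k₁ F)⁻¹)
    rw [modulus_mul, modulus_leviCompact 1 ((leviCompact k k₁ F).inv_mem c.2), mul_one] at h3
    rw [h3, coe_toMaxCompact]
    ring
  have hBc : ∀ r i, Continuous fun c : leviCompact k k₁ F => b.B r i (c : levi k k₁ F) :=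
    fun r i => (b.continuous_B r i).comp (continuous_subtype_val.comp continuous_subtype_val)
  have hAc : ∀ r i, Continuous fun c : leviCompact k k₁ F => b.A r i (c : levi k k₁ F) :=
    fun r i => (b.continuous_A r i).comp (continuous_subtype_val.comp continuous_subtype_val)
  -- the averaged functionals
  have hex : ∀ (r : Fin n) (β : Σ i, Fin (N i)), ∃ lam : V →L[ℂ] ℂ, ∀ x,
      lam x = ∫ c : leviCompact k k₁ F, b.B r β.1 (c : levi k k₁ F) * l β.1 β.2 (σ c x)
        ∂leviCompactHaar k k₁ F := fun r β => by
    obtain ⟨lam, hlam⟩ := exists_integral_functional (leviCompactHaar k k₁ F)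
      (fun c : leviCompact k k₁ F => b.B r β.1 (c : levi k k₁ F) • (l β.1 β.2).comp (σ c))
      (((hBc r β.1).comp continuous_fst).smul ((l β.1 β.2).continuous.comp hσc))
    exact ⟨lam, fun x => by rw [hlam]; simp⟩
  choose lam hlam using hex
  have hcont : ∀ r (β : Σ i, Fin (N i)) x, Continuous fun c : leviCompact k k₁ F =>
      b.B r β.1 (c : levi k k₁ F) * l β.1 β.2 (σ c x) := fun r β x =>
    (hBc r β.1).mul ((l β.1 β.2).continuous.comp (hσc.comp (Continuous.prodMk_left x)))
  have hlamfin : ∀ r β, IsFiniteFunctional σ (leviCompact k k₁ F) (lam r β) := by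
    intro r β
    refine isFiniteFunctional_of_sum (fun s => lam s β) fun x => ?_
    have : (lam r β).comp (σ x) =
        ∑ s, b.B r s (x⁻¹ : leviCompact k k₁ F).1 • lam s β := by
      ext y
      rw [ContinuousLinearMap.comp_apply, hlam,
        ← integral_mul_right_eq_self _ (x⁻¹ : leviCompact k k₁ F)]
      simp only [_root_.sum_apply, _root_.smul_apply, hlam, smul_eq_mul,
        ← integral_const_mul]
      rw [← integral_finsetSum _ fun s _ => (integrable_leviCompactHaar (hcont s β y)).const_mul _]
      refine integral_congr_ae (Filter.Eventually.of_forall fun c => ?_)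
      have h1 := b.B_mul r β.1 (toMaxCompact c) (toMaxCompact x⁻¹)
      have h2 : σ ((c * x⁻¹ : leviCompact k k₁ F) : levi k k₁ F) (σ x y) = σ c y := by
        rw [← mul_apply_eq_comp, ← map_mul, Subgroup.coe_mul, mul_assoc,
          ← Subgroup.coe_mul, inv_mul_cancel]
        simp
      have h3 : b.B r β.1 ((c * x⁻¹ : leviCompact k k₁ F) : levi k k₁ F) =
        ∑ i, b.B r i (x⁻¹ : leviCompact k k₁ F).1 * b.B i β.1 (c : levi k k₁ F) := h1
      simp only [h2, h3, Finset.sum_mul, mul_assoc]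
    rw [this]
    exact Submodule.sum_mem _ fun s _ =>
      Submodule.smul_mem _ _ (Submodule.subset_span ⟨s, rfl⟩)
  have hφ1 : ∀ r m, φ r m = ∑ β : (Σ i, Fin (N i)), lam r β (σ m (v β.1 β.2)) := by
    intro r m
    have h1 : φ r m = ∫ c : leviCompact k k₁ F, φ r m ∂leviCompactHaar k k₁ F := by simp
    rw [h1]
    simp only [hlam]
    rw [← integral_finsetSum _ fun β _ => integrable_leviCompactHaar (hcont r β _)]
    refine integral_congr_ae (Filter.Eventually.of_forall fun c => ?_)
    simp only
    rw [hBφ r c m, Fintype.sum_sigma]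
    refine Finset.sum_congr rfl fun i _ => ?_
    rw [hl, Finset.mul_sum]
    refine Finset.sum_congr rfl fun j _ => ?_
    rw [map_mul]
    rfl
  -- the averaged vectors
  have hvc : ∀ r s (β : Σ i, Fin (N i)), Continuous fun c : leviCompact k k₁ F =>
      b.A r s (c : levi k k₁ F) • σ (c⁻¹ : leviCompact k k₁ F) (v β.1 β.2) := fun r s β =>
    (hAc r s).smul (hσc.comp (continuous_inv.prodMk continuous_const))
  choose w hw using fun r s β =>
    exists_weakIntegral_of_continuous (leviCompactHaar k k₁ F) (hvc r s β)
  -- The index (s, β) carries the functional λ_{s,β} and the vectors w_{r,s,β} = ∫ A_{rs}(c) σ(c)⁻¹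
  -- v_β dc: s is the summation index of the second averaging, β that of the original coefficients.
  refine ⟨Fin n × (Σ i, Fin (N i)), inferInstance, fun J => lam J.1 J.2, fun r J => w r J.1 J.2,
    fun J => hlamfin _ _, fun r J x => ?_, fun r m => ?_⟩
  · refine eq_of_forall_functional_eq fun L => ?_
    have h0 := hw r J.1 J.2 (L.comp (σ x))
    rw [ContinuousLinearMap.comp_apply] at h0
    rw [h0, map_sum, ← integral_mul_right_eq_self _ x]
    simp only [map_smul, hw, smul_eq_mul, ← integral_const_mul]
    rw [← integral_finsetSum _ fun s _ => (integrable_leviCompactHaar ?_).const_mul _]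
    · refine integral_congr_ae (Filter.Eventually.of_forall fun c => ?_)
      have h1 : b.A r J.1 ((c * x : leviCompact k k₁ F) : levi k k₁ F) =
        ∑ i, b.A r i (x : levi k k₁ F) * b.A i J.1 (c : levi k k₁ F) :=
          b.A_mul r J.1 (toMaxCompact c) (toMaxCompact x)
      have h2 : ∀ y, σ x (σ ((c * x)⁻¹ : leviCompact k k₁ F) y) = σ (c⁻¹ : leviCompact k k₁ F) y := by
        intro y
        rw [← mul_apply_eq_comp, ← map_mul, ← Subgroup.coe_mul, _root_.mul_inv_rev,
          mul_inv_cancel_left]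
      simp only [ContinuousLinearMap.comp_apply, h2, h1, Finset.sum_mul, mul_assoc]
    · simpa [Function.comp_def] using L.continuous.comp (hvc s J.1 J.2)
  · rw [hφm]
    congr 1
    have h1 : φ r m = ∫ c : leviCompact k k₁ F, φ r m ∂leviCompactHaar k k₁ F := by simp
    have h2 : ∀ J : Fin n × (Σ i, Fin (N i)), lam J.1 J.2 (σ m (w r J.1 J.2)) =
        ∫ c : leviCompact k k₁ F, lam J.1 J.2 (σ m (b.A r J.1 (c : levi k k₁ F) •
          σ (c⁻¹ : leviCompact k k₁ F) (v J.2.1 J.2.2))) ∂leviCompactHaar k k₁ F :=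
      fun J => hw r J.1 J.2 ((lam J.1 J.2).comp (σ m))
    rw [h1, Finset.sum_congr rfl fun J _ => h2 J, ← integral_finsetSum _ fun J _ =>
      integrable_leviCompactHaar (((lam J.1 J.2).comp (σ m)).continuous.comp (hvc r J.1 J.2))]
    refine integral_congr_ae (Filter.Eventually.of_forall fun c => ?_)
    simp only
    rw [hAφ r c m, Fintype.sum_prod_type]
    refine Finset.sum_congr rfl fun s _ => ?_
    rw [hφ1, Finset.mul_sum]
    refine Finset.sum_congr rfl fun β _ => ?_
    rw [map_mul, map_smul, map_smul]
    rfl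

end Averaging

/-! ### Sections of the induced representation -/

section Sections

variable {k k₁ : ℕ} {F : Type*} [RCLike F]

/-- Uniqueness in the Iwasawa decomposition, up to `K ∩ M`. -/
theorem exists_iwasawa_eq (u : unip k k₁ F 1) (m : levi k k₁ F) (x : maxCompact k F) :
    ∃ c : leviCompact k k₁ F,
      iwaK ((u : Sp k F) * (m : Sp k F) * (x : Sp k F)) = toMaxCompact c * x ∧
      iwaM k₁ ((u : Sp k F) * (m : Sp k F) * (x : Sp k F)) * (c : levi k k₁ F) = m := by
  set g := (u : Sp k F) * (m : Sp k F) * (x : Sp k F) with hg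
  have h := iwasawa k₁ g
  have hum : ∀ (u : unip k k₁ F 1) (m : levi k k₁ F), (u : Sp k F) * m ∈ par k k₁ F 1 :=
    fun u m => mul_mem (unip_le_par k₁ 1 u.2) (levi_le_par k₁ 1 m.2)
  set p : par k k₁ F 1 := ⟨_, hum u m⟩ with hp
  set p' : par k k₁ F 1 := ⟨_, hum (iwaU k₁ g) (iwaM k₁ g)⟩ with hp'
  have hc : (iwaK g : Sp k F) * (x : Sp k F)⁻¹ = ((p'⁻¹ * p : par k k₁ F 1) : Sp k F) := by
    have h1 : (p' : Sp k F) * iwaK g = p * x := h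
    rw [Subgroup.coe_mul, Subgroup.coe_inv, eq_inv_mul_iff_mul_eq, ← mul_assoc, h1,
      mul_inv_cancel_right]
  have hcK : (iwaK g : Sp k F) * (x : Sp k F)⁻¹ ∈ maxCompact k F :=
    mul_mem (iwaK g).2 (inv_mem x.2)
  have hcM : (iwaK g : Sp k F) * (x : Sp k F)⁻¹ ∈ levi k k₁ F :=
    mem_levi_of_mem_par_of_mem_maxCompact one_ne_zero (by rw [hc]; exact (p'⁻¹ * p).2) hcK
  have hpart : ∀ (u : unip k k₁ F 1) (m : levi k k₁ F),
      leviPart one_ne_zero (⟨_, hum u m⟩ : par k k₁ F 1) = m := by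
    intro u m
    have : (⟨_, hum u m⟩ : par k k₁ F 1) =
      ⟨(u : Sp k F), unip_le_par k₁ 1 u.2⟩ * ⟨(m : Sp k F), levi_le_par k₁ 1 m.2⟩ := rfl
    rw [this, leviPart_mul, leviPart_unip, leviPart_levi, one_mul]
  refine ⟨⟨⟨_, hcM⟩, hcK⟩, Subtype.ext ?_, ?_⟩
  · change (iwaK g : Sp k F) = (iwaK g : Sp k F) * (x : Sp k F)⁻¹ * x
    rw [inv_mul_cancel_right]
  · have h2 : p = p' * ⟨_, levi_le_par k₁ 1 hcM⟩ := by
      refine Subtype.ext ?_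
      rw [Subgroup.coe_mul]
      simp only [hc]
      rw [← Subgroup.coe_mul, mul_inv_cancel_left]
    have h3 := congrArg (leviPart one_ne_zero) h2
    rw [leviPart_mul, hpart, hpart] at h3
    rw [h3]
    congr 1
    exact (leviPart_levi one_ne_zero (⟨_, hcM⟩ : levi k k₁ F)).symm

variable {V : Type*} [AddCommGroup V] [Module ℂ V] [TopologicalSpace V]
  [IsTopologicalAddGroup V] [ContinuousSMul ℂ V]
  {σ : levi k k₁ F →* (V →L[ℂ] V)} {n : ℕ}

/-- The section `u m x ↦ δ(m)^{1/2} σ(m) ∑ᵣ A_{qr}(x) wᵣ` of the induced representation. -/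
def sectionFun (b : KernelBasis σ n) (w : Fin n → V) (q : Fin n) (g : Sp k F) : V :=
  ((√(modulus k k₁ F 1 (iwaM k₁ g)) : ℝ) : ℂ) •
    σ (iwaM k₁ g) (∑ r, b.A q r (iwaK g) • w r)

variable {b : KernelBasis σ n} {w : Fin n → V}

/-- The factors m and x are determined up to an element c of K ∩ M passed between them. The relation
A(c x) = A(x) A(c), the equivariance of w and the triviality of the modulus at c make the value
independent of this choice. -/
theorem sectionFun_apply
    (hw : ∀ r (c : leviCompact k k₁ F), σ c (w r) = ∑ s, b.A r s (c : levi k k₁ F) • w s)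
    (q : Fin n) (u : unip k k₁ F 1) (m : levi k k₁ F) (x : maxCompact k F) :
    sectionFun b w q ((u : Sp k F) * m * x) =
      ((√(modulus k k₁ F 1 m) : ℝ) : ℂ) • σ m (∑ r, b.A q r x • w r) := by
  obtain ⟨c, h1, h2⟩ := exists_iwasawa_eq u m x
  have hmod : modulus k k₁ F 1 m = modulus k k₁ F 1 (iwaM k₁ ((u : Sp k F) * m * x)) := by
    conv_lhs => rw [← h2]
    rw [modulus_mul, modulus_leviCompact 1 c.2, mul_one]
  rw [sectionFun, h1, ← hmod]
  have hσm : σ m = σ (iwaM k₁ ((u : Sp k F) * m * x)) * σ c := by rw [← map_mul, h2]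
  rw [hσm, mul_apply_eq_comp]
  refine congrArg (fun y : V => ((√(modulus k k₁ F 1 m) : ℝ) : ℂ) •
    σ (iwaM k₁ ((u : Sp k F) * m * x)) y) ?_
  simp only [map_sum, map_smul, hw, Finset.smul_sum, smul_smul]
  rw [Finset.sum_comm]
  refine Finset.sum_congr rfl fun s _ => ?_
  rw [Subgroup.coe_mul, b.A_mul, Finset.sum_smul]
  rfl

theorem sectionFun_equivariant
    (hw : ∀ r (c : leviCompact k k₁ F), σ c (w r) = ∑ s, b.A r s (c : levi k k₁ F) • w s)
    (q : Fin n) (u : unip k k₁ F 1) (m : levi k k₁ F) (g : Sp k F) :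
    sectionFun b w q ((u : Sp k F) * m * g) =
      ((√(modulus k k₁ F 1 m) : ℝ) : ℂ) • σ m (sectionFun b w q g) := by
  have h1 := conj_mem_unip m.2 (iwaU k₁ g).2
  have h2 : (u : Sp k F) * m * g =
      ((u * ⟨_, h1⟩ : unip k k₁ F 1) : Sp k F) * (m * iwaM k₁ g : levi k k₁ F) * iwaK g := by
    conv_lhs => rw [← iwasawa k₁ g]
    simp [mul_assoc]
  rw [h2, sectionFun_apply hw, sectionFun, modulus_mul, Real.sqrt_mul (modulus_pos 1 m).le,
    Complex.ofReal_mul, map_smul, smul_smul, map_mul, mul_apply_eq_comp]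

theorem sectionFun_mul_maxCompact
    (hw : ∀ r (c : leviCompact k k₁ F), σ c (w r) = ∑ s, b.A r s (c : levi k k₁ F) • w s)
    (q : Fin n) (g : Sp k F) (x : maxCompact k F) :
    sectionFun b w q (g * x) = ∑ i, b.A q i x • sectionFun b w i g := by
  have h2 : g * x = (iwaU k₁ g : Sp k F) * iwaM k₁ g * (iwaK g * x : maxCompact k F) := by
    conv_lhs => rw [← iwasawa k₁ g]
    simp [mul_assoc]
  rw [h2, sectionFun_apply hw]
  simp only [sectionFun, Subgroup.coe_mul, b.A_mul, Finset.sum_smul, map_sum, map_smul,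
    Finset.smul_sum, smul_smul]
  rw [Finset.sum_comm]
  refine Finset.sum_congr rfl fun i _ => Finset.sum_congr rfl fun r _ => ?_
  congr 1
  ring

theorem continuous_sectionFun (hσ : IsContRep σ) (q : Fin n) :
    Continuous (sectionFun b w q) := by
  have h1 : Continuous fun g : Sp k F => ((√(modulus k k₁ F 1 (iwaM k₁ g)) : ℝ) : ℂ) :=
    Complex.continuous_ofReal.comp
      (((continuous_modulus 1).comp (continuous_iwaM k₁)).sqrt)
  have h2 : ∀ r, Continuous (b.A q r) := fun r => (b.smooth_A q r).continuous continuous_entries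
  have h3 : Continuous fun g : Sp k F => ∑ r, b.A q r (iwaK g) • w r :=
    continuous_finsetSum _ fun r _ => ((h2 r).comp continuous_iwaK).smul continuous_const
  exact h1.smul (hσ.comp ((continuous_iwaM k₁).prodMk h3))

theorem smoothAlongVec_sectionFun (hσ : IsSmoothRep σ) (q : Fin n) :
    SmoothAlongVec entries (sectionFun b w q) := by
  intro l
  have h : (fun g : Sp k F => l (sectionFun b w q g)) = fun g =>
      ((√(modulus k k₁ F 1 (iwaM k₁ g)) : ℝ) : ℂ) *
        ∑ r, b.A q r (iwaK g) * l (σ (iwaM k₁ g) (w r)) := by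
    funext g
    simp [sectionFun, map_sum]
  rw [h]
  refine ((smoothAlong_sqrt_modulus 1).comp (smoothMap_iwaM k₁) (continuous_iwaM k₁)).mul
    (SmoothAlong.sum _ fun r _ => ?_)
  exact ((b.smooth_A q r).comp smoothMap_iwaK continuous_iwaK).mul
    ((hσ (w r) l).comp (smoothMap_iwaM k₁) (continuous_iwaM k₁))

/-- `sectionFun` as a continuous map. -/
def sectionMap (hσ : IsContRep σ) (b : KernelBasis σ n) (w : Fin n → V) (q : Fin n) :
    C(Sp k F, V) := ⟨sectionFun b w q, continuous_sectionFun hσ q⟩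

theorem sectionMap_mem_smoothInd (hσ : IsContRep σ) (hσ' : IsSmoothRep σ)
    (hw : ∀ r (c : leviCompact k k₁ F), σ c (w r) = ∑ s, b.A r s (c : levi k k₁ F) • w s)
    (q : Fin n) : sectionMap hσ b w q ∈ smoothInd σ 1 :=
  ⟨smoothAlongVec_sectionFun hσ' q, sectionFun_equivariant hw q⟩

/-- The Iwasawa decomposition reduces the identity to M: the factor in U acts trivially on both
sides, and the factor in K acts through the same matrix A. -/
theorem KernelBasis.h_eq_sum_sectionFun {ι : Type*} [Fintype ι] {ℓ : ι → V →L[ℂ] ℂ}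
    {w : Fin n → ι → V}
    (hℓ : ∀ r (m : levi k k₁ F), b.h r m 1 = ((√(modulus k k₁ F 1 m) : ℝ) : ℂ) *
        ∑ J, ℓ J (σ m (w r J))) (q : Fin n) (g : Sp k F) :
    b.h q g 1 = ∑ J, ℓ J (sectionFun b (fun r => w r J) q g) := by
  have h1 := b.translate_A q (iwaK g) ((iwaU k₁ g : Sp k F) * iwaM k₁ g) 1
  rw [iwasawa] at h1
  rw [h1]
  simp only [sectionFun, map_sum, map_smul, smul_eq_mul]
  have h2 : ∀ i, b.h i ((iwaU k₁ g : Sp k F) * iwaM k₁ g) 1 = b.h i (iwaM k₁ g) 1 := fun i => by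
    have := b.invariant i (iwaU k₁ g) 1 1 (iwaM k₁ g) 1
    simpa using this
  simp only [h2, hℓ]
  simp only [Finset.mul_sum]
  rw [Finset.sum_comm]
  refine Finset.sum_congr rfl fun i _ => Finset.sum_congr rfl fun r _ => ?_
  ring

end Sections

/-! ### Smooth functions on `Sp(k, F)` extend smoothly to open sets of matrices -/

section Retraction

variable {E : Type*} [NormedAddCommGroup E] [NormedSpace ℝ E] {ι : Type*} [Fintype ι]
  [DecidableEq ι] {F : Type*} [RCLike F]

theorem contDiffAt_matrix_mul {M N : E → Matrix ι ι F} {e : E}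
    (hM : ∀ i j, ContDiffAt ℝ ∞ (fun x => M x i j) e)
    (hN : ∀ i j, ContDiffAt ℝ ∞ (fun x => N x i j) e) (i j : ι) :
    ContDiffAt ℝ ∞ (fun x => (M x * N x) i j) e := by
  simp only [Matrix.mul_apply]
  exact ContDiffAt.sum fun a _ => (hM i a).mul (hN a j)

theorem contDiffAt_matrix_det {M : E → Matrix ι ι F} {e : E}
    (hM : ∀ i j, ContDiffAt ℝ ∞ (fun x => M x i j) e) :
    ContDiffAt ℝ ∞ (fun x => (M x).det) e := by
  simp only [Matrix.det_apply]
  exact ContDiffAt.sum fun p _ => ContDiffAt.const_smul _ (contDiffAt_prod fun i _ => hM _ _)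

theorem contDiffAt_matrix_inv {M : E → Matrix ι ι F} {e : E}
    (hM : ∀ i j, ContDiffAt ℝ ∞ (fun x => M x i j) e) (hdet : (M e).det ≠ 0) (i j : ι) :
    ContDiffAt ℝ ∞ (fun x => (M x)⁻¹ i j) e := by
  simp only [Matrix.inv_def, Ring.inverse_eq_inv', Matrix.smul_apply, smul_eq_mul,
    Matrix.adjugate_apply]
  refine ((contDiffAt_matrix_det hM).inv hdet).mul (contDiffAt_matrix_det fun a b => ?_)
  simp only [Matrix.updateRow_apply]
  split_ifs
  · exact contDiffAt_const
  · exact hM a b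

variable {k : ℕ}

/-- The projection of the space of matrices onto the symplectic Lie algebra. -/
def spProj (X : Matrix (Fin k ⊕ Fin k) (Fin k ⊕ Fin k) F) :
    Matrix (Fin k ⊕ Fin k) (Fin k ⊕ Fin k) F :=
  (2⁻¹ : F) • (X + Matrix.J (Fin k) F * Xᵀ * Matrix.J (Fin k) F)

theorem spProj_mul_J (X : Matrix (Fin k ⊕ Fin k) (Fin k ⊕ Fin k) F) :
    spProj X * Matrix.J (Fin k) F + Matrix.J (Fin k) F * (spProj X)ᵀ = 0 := by
  have hJ : Matrix.J (Fin k) F * Matrix.J (Fin k) F = -1 := Matrix.J_squared _ _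
  simp only [spProj, Matrix.transpose_smul, Matrix.transpose_add, Matrix.transpose_mul,
    Matrix.J_transpose, Matrix.transpose_transpose, Matrix.smul_mul, Matrix.mul_smul,
    Matrix.add_mul, Matrix.mul_add, ← smul_add]
  have h1 : Matrix.J (Fin k) F * Xᵀ * Matrix.J (Fin k) F * Matrix.J (Fin k) F =
      -(Matrix.J (Fin k) F * Xᵀ) := by
    rw [Matrix.mul_assoc _ _ (Matrix.J (Fin k) F), hJ]; simp
  have h2 : Matrix.J (Fin k) F * (-Matrix.J (Fin k) F * (X * -Matrix.J (Fin k) F)) =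
      -(X * Matrix.J (Fin k) F) := by
    rw [← Matrix.mul_assoc, Matrix.mul_neg, hJ]; simp
  rw [h1, h2]
  simp only [smul_eq_zero]
  right
  abel

theorem spProj_eq_self {X : Matrix (Fin k ⊕ Fin k) (Fin k ⊕ Fin k) F}
    (hX : X * Matrix.J (Fin k) F + Matrix.J (Fin k) F * Xᵀ = 0) : spProj X = X := by
  have hJ : Matrix.J (Fin k) F * Matrix.J (Fin k) F = -1 := Matrix.J_squared _ _
  have h1 : Matrix.J (Fin k) F * Xᵀ = -(X * Matrix.J (Fin k) F) := by
    rw [eq_neg_iff_add_eq_zero, add_comm, hX]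
  rw [spProj, h1, Matrix.neg_mul, Matrix.mul_assoc, hJ, Matrix.mul_neg, neg_neg, Matrix.mul_one,
    ← two_smul F X, smul_smul, inv_mul_cancel₀ two_ne_zero, one_smul]

/-- From XJ + JXᵀ = 0 both (1 + X) J (1 + X)ᵀ and (1 - X) J (1 - X)ᵀ are equal to J + X J Xᵀ. -/
theorem cayley_mem {X : Matrix (Fin k ⊕ Fin k) (Fin k ⊕ Fin k) F}
    (hX : X * Matrix.J (Fin k) F + Matrix.J (Fin k) F * Xᵀ = 0) (hdet : (1 - X).det ≠ 0) :
    (1 - X)⁻¹ * (1 + X) ∈ Matrix.symplecticGroup (Fin k) F := by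
  rw [SymplecticGroup.mem_iff]
  have hu : IsUnit (1 - X).det := isUnit_iff_ne_zero.mpr hdet
  have h1 : (1 + X) * Matrix.J (Fin k) F * (1 + X)ᵀ =
      (1 - X) * Matrix.J (Fin k) F * (1 - X)ᵀ := by
    simp only [Matrix.transpose_add, Matrix.transpose_sub, Matrix.transpose_one, Matrix.add_mul,
      Matrix.mul_add, Matrix.sub_mul, Matrix.mul_sub, Matrix.one_mul, Matrix.mul_one]
    have h2 : Matrix.J (Fin k) F * Xᵀ = -(X * Matrix.J (Fin k) F) := by
      rw [eq_neg_iff_add_eq_zero, add_comm, hX]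
    rw [h2]
    abel
  rw [Matrix.transpose_mul]
  calc (1 - X)⁻¹ * (1 + X) * Matrix.J (Fin k) F * ((1 + X)ᵀ * ((1 - X)⁻¹)ᵀ)
      = (1 - X)⁻¹ * ((1 + X) * Matrix.J (Fin k) F * (1 + X)ᵀ) * ((1 - X)⁻¹)ᵀ := by
        simp only [Matrix.mul_assoc]
    _ = ((1 - X)⁻¹ * (1 - X)) * Matrix.J (Fin k) F * ((1 - X)⁻¹ * (1 - X))ᵀ := by
        rw [h1, Matrix.transpose_mul]; simp only [Matrix.mul_assoc]
    _ = Matrix.J (Fin k) F := by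
        rw [Matrix.nonsing_inv_mul _ hu, Matrix.transpose_one, Matrix.one_mul, Matrix.mul_one]

/-- The inverse Cayley transform. -/
def invCayley (A : Matrix (Fin k ⊕ Fin k) (Fin k ⊕ Fin k) F) :
    Matrix (Fin k ⊕ Fin k) (Fin k ⊕ Fin k) F := (A - 1) * (A + 1)⁻¹

theorem invCayley_mem {A : Matrix (Fin k ⊕ Fin k) (Fin k ⊕ Fin k) F}
    (hA : A ∈ Matrix.symplecticGroup (Fin k) F) (hdet : (A + 1).det ≠ 0) :
    invCayley A * Matrix.J (Fin k) F + Matrix.J (Fin k) F * (invCayley A)ᵀ = 0 := by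
  have hu : IsUnit (A + 1).det := isUnit_iff_ne_zero.mpr hdet
  have hAJ := SymplecticGroup.mem_iff.mp hA
  set X := invCayley A with hX
  have h1 : (A + 1) * X = A - 1 := by
    have hc : (A + 1) * (A - 1) = (A - 1) * (A + 1) := by noncomm_ring
    rw [hX, invCayley, ← Matrix.mul_assoc, hc, Matrix.mul_assoc, Matrix.mul_nonsing_inv _ hu,
      Matrix.mul_one]
  have h2 : (A + 1) * (X * Matrix.J (Fin k) F + Matrix.J (Fin k) F * Xᵀ) * (A + 1)ᵀ = 0 := by
    have h3 : (A + 1) * (X * Matrix.J (Fin k) F + Matrix.J (Fin k) F * Xᵀ) * (A + 1)ᵀ =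
        ((A + 1) * X) * Matrix.J (Fin k) F * (A + 1)ᵀ +
          (A + 1) * Matrix.J (Fin k) F * ((A + 1) * X)ᵀ := by
      rw [Matrix.transpose_mul]; simp only [Matrix.mul_add, Matrix.add_mul, Matrix.mul_assoc]
    rw [h3, h1]
    simp only [Matrix.transpose_add, Matrix.transpose_sub, Matrix.transpose_one, Matrix.add_mul,
      Matrix.mul_add, Matrix.sub_mul, Matrix.mul_sub, Matrix.one_mul, Matrix.mul_one, hAJ]
    abel
  have hut : IsUnit ((A + 1)ᵀ).det := by rwa [Matrix.det_transpose]
  have h4 := congrArg (fun Y => (A + 1)⁻¹ * Y * ((A + 1)ᵀ)⁻¹) h2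
  simp only [Matrix.mul_zero, Matrix.zero_mul] at h4
  rw [← h4, Matrix.mul_assoc, Matrix.mul_assoc _ _ ((A + 1)ᵀ), Matrix.mul_assoc _ _ (((A + 1)ᵀ)⁻¹),
    Matrix.mul_assoc _ _ (((A + 1)ᵀ)⁻¹), Matrix.mul_nonsing_inv _ hut, Matrix.mul_one,
    ← Matrix.mul_assoc, Matrix.nonsing_inv_mul _ hu, Matrix.one_mul]

theorem cayley_invCayley {A : Matrix (Fin k ⊕ Fin k) (Fin k ⊕ Fin k) F}
    (hdet : (A + 1).det ≠ 0) (hdet' : (1 - invCayley A).det ≠ 0) :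
    (1 - invCayley A)⁻¹ * (1 + invCayley A) = A := by
  have hu : IsUnit (A + 1).det := isUnit_iff_ne_zero.mpr hdet
  have h1 : invCayley A * (A + 1) = A - 1 := by
    rw [invCayley, Matrix.mul_assoc, Matrix.nonsing_inv_mul _ hu, Matrix.mul_one]
  have h2 : (1 - invCayley A) * A = 1 + invCayley A := by
    rw [Matrix.mul_add, Matrix.mul_one] at h1
    rw [Matrix.sub_mul, Matrix.one_mul, eq_sub_of_add_eq h1]
    abel
  rw [← h2, ← Matrix.mul_assoc, Matrix.nonsing_inv_mul _ (isUnit_iff_ne_zero.mpr hdet'),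
    Matrix.one_mul]

/-- The open set of matrices on which `spRetract` is given by the Cayley transform. -/
def cayleyDomain (k : ℕ) (F : Type*) [RCLike F] :
    Set (Matrix (Fin k ⊕ Fin k) (Fin k ⊕ Fin k) F) :=
  {A | (A + 1).det ≠ 0 ∧ (1 - spProj (invCayley A)).det ≠ 0}

open Classical in
/-- A smooth retraction of a neighbourhood of `1` in the space of matrices onto a neighbourhood
of `1` in `Sp(k, F)`. -/
def spRetract (A : Matrix (Fin k ⊕ Fin k) (Fin k ⊕ Fin k) F) : Sp k F :=
  if h : A ∈ cayleyDomain k F then ⟨_, cayley_mem (spProj_mul_J (invCayley A)) h.2⟩ else 1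

theorem mat_spRetract {A : Matrix (Fin k ⊕ Fin k) (Fin k ⊕ Fin k) F} (h : A ∈ cayleyDomain k F) :
    mat (spRetract A) = (1 - spProj (invCayley A))⁻¹ * (1 + spProj (invCayley A)) := by
  rw [spRetract, dif_pos h]

/-- On the group the inverse Cayley transform already lies in the Lie algebra, so the projection
does nothing and the Cayley transform undoes it. -/
theorem spRetract_mat {g : Sp k F} (h : mat g ∈ cayleyDomain k F) : spRetract (mat g) = g := by
  refine Subtype.ext ((mat_spRetract h).trans ?_)
  have h1 := spProj_eq_self (invCayley_mem g.2 h.1)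
  have h2 := h.2
  rw [h1] at h2 ⊢
  exact cayley_invCayley h.1 h2

theorem one_mem_cayleyDomain : (1 : Matrix (Fin k ⊕ Fin k) (Fin k ⊕ Fin k) F) ∈ cayleyDomain k F := by
  have h0 : invCayley (1 : Matrix (Fin k ⊕ Fin k) (Fin k ⊕ Fin k) F) = 0 := by simp [invCayley]
  refine ⟨?_, ?_⟩
  · rw [← two_smul F (1 : Matrix (Fin k ⊕ Fin k) (Fin k ⊕ Fin k) F), Matrix.det_smul]
    simp
  · rw [h0]; simp [spProj]

theorem contDiffAt_invCayley {M : E → Matrix (Fin k ⊕ Fin k) (Fin k ⊕ Fin k) F} {e : E}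
    (hM : ∀ i j, ContDiffAt ℝ ∞ (fun x => M x i j) e) (h : (M e + 1).det ≠ 0)
    (i j : Fin k ⊕ Fin k) : ContDiffAt ℝ ∞ (fun x => invCayley (M x) i j) e := by
  refine contDiffAt_matrix_mul (M := fun x => M x - 1) (fun a b => ?_)
    (contDiffAt_matrix_inv (M := fun x => M x + 1) (fun a b => ?_) h) i j
  · exact (hM a b).sub contDiffAt_const
  · exact (hM a b).add contDiffAt_const

theorem contDiffAt_spProj {M : E → Matrix (Fin k ⊕ Fin k) (Fin k ⊕ Fin k) F} {e : E}
    (hM : ∀ i j, ContDiffAt ℝ ∞ (fun x => M x i j) e) (i j : Fin k ⊕ Fin k) :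
    ContDiffAt ℝ ∞ (fun x => spProj (M x) i j) e := by
  have h : (fun x => spProj (M x) i j) = fun x => (2⁻¹ : F) * (M x i j +
      (Matrix.J (Fin k) F * (M x)ᵀ * Matrix.J (Fin k) F) i j) := by
    funext x
    rw [spProj, Matrix.smul_apply, Matrix.add_apply, smul_eq_mul]
  rw [h]
  refine contDiffAt_const.mul ((hM i j).add ?_)
  exact contDiffAt_matrix_mul (M := fun x => Matrix.J (Fin k) F * (M x)ᵀ)
    (N := fun _ => Matrix.J (Fin k) F)
    (contDiffAt_matrix_mul (M := fun _ => Matrix.J (Fin k) F) (N := fun x => (M x)ᵀ)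
      (fun _ _ => contDiffAt_const) fun a b => hM b a)
    (fun _ _ => contDiffAt_const) i j

theorem contDiffAt_spRetract {M : E → Matrix (Fin k ⊕ Fin k) (Fin k ⊕ Fin k) F} {e : E}
    (hM : ∀ i j, ContDiffAt ℝ ∞ (fun x => M x i j) e) (h : M e ∈ cayleyDomain k F)
    (i j : Fin k ⊕ Fin k) :
    ContDiffAt ℝ ∞ (fun x => ((1 - spProj (invCayley (M x)))⁻¹ *
      (1 + spProj (invCayley (M x)))) i j) e := by
  have h1 := contDiffAt_spProj (contDiffAt_invCayley hM h.1)
  refine contDiffAt_matrix_mul (M := fun x => (1 - spProj (invCayley (M x)))⁻¹)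
    (contDiffAt_matrix_inv (M := fun x => 1 - spProj (invCayley (M x))) (fun a b => ?_) h.2)
    (fun a b => ?_) i j
  · exact contDiffAt_const.sub (h1 a b)
  · exact contDiffAt_const.add (h1 a b)

theorem isOpen_preimage_cayleyDomain {M : E → Matrix (Fin k ⊕ Fin k) (Fin k ⊕ Fin k) F}
    (hM : ∀ e i j, ContDiffAt ℝ ∞ (fun x => M x i j) e) : IsOpen (M ⁻¹' cayleyDomain k F) := by
  rw [isOpen_iff_mem_nhds]
  intro e he
  have h1 : ContinuousAt (fun x => (M x + 1).det) e :=
    (contDiffAt_matrix_det (M := fun x => M x + 1)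
      fun i j => (hM e i j).add contDiffAt_const).continuousAt
  have h2 : ContinuousAt (fun x => (1 - spProj (invCayley (M x))).det) e :=
    (contDiffAt_matrix_det (M := fun x => 1 - spProj (invCayley (M x))) fun i j =>
      contDiffAt_const.sub
        (contDiffAt_spProj (contDiffAt_invCayley (hM e) he.1) i j)).continuousAt
  filter_upwards [h1.eventually_ne he.1, h2.eventually_ne he.2] with x hx hx' using ⟨hx, hx'⟩

/-- A smooth function on `Sp(k, F)` is, near each point, the restriction of a function which is
smooth on an open set of matrices. -/
theorem SmoothAlong.exists_contDiffAt {f : Sp k F → ℂ} (hf : SmoothAlong entries f) (g : Sp k F) :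
    ∃ (f' : (Fin k ⊕ Fin k → Fin k ⊕ Fin k → F) → ℂ) (O : Set (Fin k ⊕ Fin k → Fin k ⊕ Fin k → F)),
      IsOpen O ∧ entries g ∈ O ∧ (∀ e ∈ O, ContDiffAt ℝ ∞ f' e) ∧
      ∀ y : Sp k F, entries y ∈ O → f y = f' (entries y) := by
  -- `SmoothAlong` gives an extension that is smooth at a single point, where derivatives of
  -- different orders may have no common neighbourhood. Composition of f with the retraction onto G,
  -- moved from 1 to g, is smooth at every point of an open set.
  let M : (Fin k ⊕ Fin k → Fin k ⊕ Fin k → F) → Matrix (Fin k ⊕ Fin k) (Fin k ⊕ Fin k) F :=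
    fun e => Matrix.of e * mat g⁻¹
  have hM : ∀ e i j, ContDiffAt ℝ ∞ (fun x => M x i j) e := fun e =>
    contDiffAt_matrix_mul (M := fun x => Matrix.of x)
      (fun a b => (contDiff_apply_apply ℝ F a b).contDiffAt) fun _ _ => contDiffAt_const
  have hMy : ∀ y : Sp k F, M (entries y) = mat (y * g⁻¹) := fun y => rfl
  let τ : (Fin k ⊕ Fin k → Fin k ⊕ Fin k → F) → Sp k F := fun e => spRetract (M e) * g
  have hO : IsOpen (M ⁻¹' cayleyDomain k F) := isOpen_preimage_cayleyDomain hM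
  have hτ : ∀ e ∈ M ⁻¹' cayleyDomain k F, ∃ T : (Fin k ⊕ Fin k → Fin k ⊕ Fin k → F) →
      (Fin k ⊕ Fin k → Fin k ⊕ Fin k → F), ContDiffAt ℝ ∞ T e ∧
      ∀ᶠ e' in 𝓝 e, entries (τ e') = T e' := by
    intro e he
    refine ⟨fun e' => ((1 - spProj (invCayley (M e')))⁻¹ * (1 + spProj (invCayley (M e'))) * mat g :
      Matrix (Fin k ⊕ Fin k) (Fin k ⊕ Fin k) F),
      ?_, ?_⟩
    · exact contDiffAt_pi.mpr fun i => contDiffAt_pi.mpr fun j =>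
        contDiffAt_matrix_mul (N := fun _ => mat g) (contDiffAt_spRetract (hM e) he)
          (fun _ _ => contDiffAt_const) i j
    · filter_upwards [hO.mem_nhds he] with e' he'
      change mat (spRetract (M e') * g) = _
      rw [mat_mul, mat_spRetract he']
  refine ⟨fun e => f (τ e), M ⁻¹' cayleyDomain k F, hO, ?_, fun e he => ?_, fun y hy => ?_⟩
  · rw [Set.mem_preimage, hMy, mul_inv_cancel, mat_one]
    exact one_mem_cayleyDomain
  · obtain ⟨T, hT, hTe⟩ := hτ e he
    obtain ⟨f', hf', hfe⟩ := hf (τ e)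
    have hcont : ContinuousAt τ e := by
      rw [isInducing_entries.continuousAt_iff]
      exact hT.continuousAt.congr (hTe.mono fun _ h => h.symm)
    have hTe0 : entries (τ e) = T e := hTe.self_of_nhds
    rw [hTe0] at hf'
    refine (hf'.comp e hT).congr_of_eventuallyEq ?_
    filter_upwards [hcont.eventually hfe, hTe] with e' h1 h2
    rw [h1, h2]
    rfl
  · have h1 : mat (y * g⁻¹) ∈ cayleyDomain k F := hy
    change f y = f (spRetract (mat (y * g⁻¹)) * g)
    rw [spRetract_mat h1, inv_mul_cancel_right]

end Retraction

/-! ### Absolutely convergent series of translates -/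

section Series

/-- A smooth function near a point is the germ of a compactly supported smooth function. -/
theorem exists_compactSupport_eq {E : Type*} [NormedAddCommGroup E] [NormedSpace ℝ E]
    [FiniteDimensional ℝ E] {f : E → ℂ} {O : Set E} (hO : IsOpen O) {e₀ : E} (he : e₀ ∈ O)
    (hf : ∀ e ∈ O, ContDiffAt ℝ ∞ f e) :
    ∃ a : E → ℂ, ContDiff ℝ ∞ a ∧ HasCompactSupport a ∧ ∀ᶠ e in 𝓝 e₀, f e = a e := by
  obtain ⟨r, hr, hrO⟩ := Metric.nhds_basis_closedBall.mem_iff.mp (hO.mem_nhds he)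
  -- The outer radius r keeps the support inside `O`, so the product with f vanishes near every
  -- point outside `O`.
  let χ : ContDiffBump e₀ := ⟨r / 2, r, by positivity, by linarith⟩
  refine ⟨fun e => χ e • f e, contDiff_iff_contDiffAt.mpr fun e => ?_,
    χ.hasCompactSupport.smul_right, ?_⟩
  · by_cases h : e ∈ O
    · exact χ.contDiff.contDiffAt.smul (hf e h)
    · have h1 : e ∉ tsupport χ := by
        rw [χ.tsupport_eq]
        exact fun h2 => h (hrO h2)
      have h2 : (fun e => χ e • f e) =ᶠ[𝓝 e] fun _ => 0 := by
        filter_upwards [(notMem_tsupport_iff_eventuallyEq.mp h1)] with x hx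
        rw [hx]; simp
      exact contDiffAt_const.congr_of_eventuallyEq h2
  · filter_upwards [χ.eventuallyEq_one] with x hx
    rw [hx]; simp

variable {k : ℕ} {F : Type*} [RCLike F]

/-- Right multiplication on matrices, as a continuous linear map. -/
def rightMulCLM (x : Sp k F) :
    (Fin k ⊕ Fin k → Fin k ⊕ Fin k → F) →L[ℝ] (Fin k ⊕ Fin k → Fin k ⊕ Fin k → F) :=
  LinearMap.mkContinuous
    { toFun := fun e i j => ∑ b, e i b * mat x b j
      map_add' := fun e e' => by
        funext i j; simp [add_mul, Finset.sum_add_distrib]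
      map_smul' := fun c e => by
        funext i j; simp [Finset.smul_sum] }
    (Fintype.card (Fin k ⊕ Fin k) * ‖entries x‖) fun e => by
      refine (pi_norm_le_iff_of_nonneg (by positivity)).mpr fun i =>
        (pi_norm_le_iff_of_nonneg (by positivity)).mpr fun j => ?_
      rw [mul_assoc, ← nsmul_eq_mul]
      change ‖∑ b, e i b * mat x b j‖ ≤ _
      refine (norm_sum_le _ _).trans (Finset.sum_le_card_nsmul _ _ (‖entries x‖ * ‖e‖)
        fun b _ => ?_)
      rw [norm_mul, mul_comm]
      exact mul_le_mul ((norm_le_pi_norm _ _).trans (norm_le_pi_norm (entries x) b))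
        ((norm_le_pi_norm _ _).trans (norm_le_pi_norm e i)) (norm_nonneg _) (norm_nonneg _)

theorem rightMulCLM_entries (x y : Sp k F) : rightMulCLM x (entries y) = entries (y * x) := by
  funext i j
  simp [rightMulCLM, entries, Matrix.mul_apply]

theorem norm_rightMulCLM_le (x : Sp k F) :
    ‖rightMulCLM x‖ ≤ Fintype.card (Fin k ⊕ Fin k) * ‖entries x‖ :=
  LinearMap.mkContinuous_norm_le _ (by positivity) _

/-- Compact support bounds each derivative of `a`; the chain rule multiplies the bound of order j by
at most D^j, uniformly in n, so the series may be differentiated termwise. -/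
theorem contDiff_tsum_rightMul {a : (Fin k ⊕ Fin k → Fin k ⊕ Fin k → F) → ℂ}
    (ha : ContDiff ℝ ∞ a) (hs : HasCompactSupport a) {c : ℕ → ℝ} (hc : Summable fun n => |c n|)
    {x : ℕ → Sp k F} {D : ℝ} (hD : ∀ n, ‖rightMulCLM (x n)‖ ≤ D) :
    ContDiff ℝ ∞ fun e => ∑' n, c n • a (rightMulCLM (x n) e) := by
  have hb : ∀ j : ℕ, ∃ C, ∀ e, ‖iteratedFDeriv ℝ j a e‖ ≤ C := fun j =>
    (hs.iteratedFDeriv j).exists_bound_of_continuous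
      (ha.continuous_iteratedFDeriv (by exact_mod_cast le_top))
  choose C hC using hb
  have hcomp : ∀ n, ContDiff ℝ ∞ (a ∘ rightMulCLM (x n)) := fun n =>
    ha.comp (rightMulCLM (x n)).contDiff
  refine contDiff_tsum (N := ⊤) (v := fun j n => |c n| * (C j * D ^ j))
    (fun n => (hcomp n).const_smul (c n)) (fun j _ => hc.mul_right _) fun j n e _ => ?_
  have h1 := iteratedFDeriv_const_smul_apply (i := j) (a := c n) (x := e)
    ((hcomp n).of_le (by exact_mod_cast le_top)).contDiffAt
  change ‖iteratedFDeriv ℝ j (c n • (a ∘ rightMulCLM (x n))) e‖ ≤ _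
  rw [h1, norm_smul, Real.norm_eq_abs]
  refine mul_le_mul_of_nonneg_left ?_ (abs_nonneg _)
  rw [(rightMulCLM (x n)).iteratedFDeriv_comp_right ha e (by exact_mod_cast le_top)]
  refine (ContinuousMultilinearMap.norm_compContinuousLinearMap_le _ _).trans ?_
  rw [Finset.prod_const, Finset.card_univ, Fintype.card_fin]
  exact mul_le_mul (hC j _) (pow_le_pow_left₀ (norm_nonneg _) (hD n) j) (by positivity)
    ((norm_nonneg _).trans (hC j 0))

/-- For y near g and n large, y x_n stays near g x₀, where f agrees with a compactly supported
smooth function of the matrix. The tail is then a series of translates of that function, and the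
head is a finite sum of smooth functions. -/
theorem SmoothAlong.tsum {f : Sp k F → ℂ} (hf : SmoothAlong entries f) {c : ℕ → ℝ}
    (hc : Summable fun n => |c n|) {x : ℕ → Sp k F} {x₀ : Sp k F}
    (hx : Filter.Tendsto x Filter.atTop (𝓝 x₀)) :
    SmoothAlong entries fun g => ∑' n, c n • f (g * x n) := by
  intro g
  obtain ⟨f', O, hO, hgO, hf', hff'⟩ := hf.exists_contDiffAt (g * x₀)
  obtain ⟨a, ha, hs, hfa⟩ := exists_compactSupport_eq hO hgO hf'
  have hev : ∀ᶠ y in 𝓝 (g * x₀), f y = a (entries y) := by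
    filter_upwards [continuous_entries.continuousAt.eventually hfa,
      continuous_entries.continuousAt.eventually (hO.mem_nhds hgO)] with y h1 h2
    rw [hff' y h2, h1]
  have hev2 : ∀ᶠ p : Sp k F × Sp k F in 𝓝 g ×ˢ 𝓝 x₀, f (p.1 * p.2) = a (entries (p.1 * p.2)) := by
    rw [← nhds_prod_eq]
    exact (continuous_mul.tendsto (g, x₀)).eventually hev
  obtain ⟨P, hP, Q, hQ, hPQ⟩ := Filter.eventually_prod_iff.mp hev2
  obtain ⟨n₀, hn₀⟩ := Filter.eventually_atTop.mp (hx.eventually hQ)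
  have hcpt := hx.isCompact_insert_range
  have hmem : ∀ n, x n ∈ insert x₀ (Set.range x) := fun n => Set.mem_insert_of_mem _ ⟨n, rfl⟩
  obtain ⟨B, hB⟩ := (hcpt.image continuous_entries).isBounded.exists_norm_le
  have hfc : Continuous f := hf.continuous continuous_entries
  have hsum : ∀ y, Summable fun n => c n • f (y * x n) := fun y =>
    summable_smul_of_isCompact hc (hcpt.image (hfc.comp (continuous_const_mul y)))
      fun n => ⟨x n, hmem n, rfl⟩
  have hhead : SmoothAlong entries fun y : Sp k F =>
      ∑ n ∈ Finset.range n₀, ((c n : ℝ) : ℂ) * f (y * x n) :=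
    SmoothAlong.sum _ fun n _ => (smoothAlong_const _ _).mul
      (hf.comp (smoothMap_mul_const (x n)) (by fun_prop))
  obtain ⟨h, hh, hhe⟩ := hhead g
  have htail := contDiff_tsum_rightMul ha hs ((summable_nat_add_iff n₀).mpr hc)
    (x := fun n => x (n + n₀)) (D := Fintype.card (Fin k ⊕ Fin k) * B) fun n =>
      (norm_rightMulCLM_le _).trans (mul_le_mul_of_nonneg_left
        (hB _ ⟨_, hmem _, rfl⟩) (by positivity))
  refine ⟨fun e => h e + ∑' n, c (n + n₀) • a (rightMulCLM (x (n + n₀)) e),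
    hh.add htail.contDiffAt, ?_⟩
  filter_upwards [hhe, hP] with y h1 h2
  rw [← h1, ← (hsum y).sum_add_tsum_nat_add n₀]
  congr 1
  refine tsum_congr fun n => ?_
  rw [rightMulCLM_entries, hPQ h2 (hn₀ (n + n₀) (Nat.le_add_left _ _))]

variable {k₁ : ℕ} {V : Type*} [AddCommGroup V] [Module ℂ V] [UniformSpace V] [IsUniformAddGroup V]
    [ContinuousSMul ℂ V] [LocallyConvexSpace ℝ V] [T2Space V] [CompleteSpace V]
  {σ : levi k k₁ F →* (V →L[ℂ] V)}

theorem summable_smul_translate (f : C(Sp k F, V)) {c : ℕ → ℝ} (hc : Summable fun n => |c n|)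
    {x : ℕ → Sp k F} {x₀ : Sp k F} (hx : Filter.Tendsto x Filter.atTop (𝓝 x₀)) (g : Sp k F) :
    Summable fun n => c n • f (g * x n) :=
  summable_smul_of_isCompact hc (hx.isCompact_insert_range.image
    (f.continuous.comp (continuous_const_mul g)))
      fun n => ⟨x n, Set.mem_insert_of_mem _ ⟨n, rfl⟩, rfl⟩

theorem map_tsum_smul (l : V →L[ℂ] ℂ) {c : ℕ → ℝ} {v : ℕ → V} (h : Summable fun n => c n • v n) :
    l (∑' n, c n • v n) = ∑' n, c n • l (v n) := by
  rw [l.map_tsum h]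
  exact tsum_congr fun n => (l.toLinearMap.restrictScalars ℝ).map_smul (c n) (v n)

/-- Completeness of V and the preceding smoothness keep such series inside the induced space. They
are the vectors to which the convergence hypothesis on J is applied in the closed graph argument. -/
theorem exists_tsum_mem_smoothInd {s : ℤ} {f : C(Sp k F, V)} (hf : f ∈ smoothInd σ s) {c : ℕ → ℝ}
    (hc : Summable fun n => |c n|) {x : ℕ → Sp k F} {x₀ : Sp k F}
    (hx : Filter.Tendsto x Filter.atTop (𝓝 x₀)) :
    ∃ Ψ ∈ smoothInd σ s, ∀ g, Ψ g = ∑' n, c n • f (g * x n) := by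
  have hsum := fun g => summable_smul_translate f hc hx g
  have hcont : Continuous fun g => ∑' n, c n • f (g * x n) :=
    continuous_tsum_smul (φ := fun p : Sp k F × Sp k F => f (p.1 * p.2)) (by fun_prop) hc
      hx.isCompact_insert_range fun n => Set.mem_insert_of_mem _ ⟨n, rfl⟩
  refine ⟨⟨_, hcont⟩, ⟨fun l => ?_, fun u m g => ?_⟩, fun g => rfl⟩
  · have h1 := (hf.1 l).tsum hc hx
    have h2 : (fun g => ∑' n, c n • l (f (g * x n))) = fun g => l (∑' n, c n • f (g * x n)) :=
      funext fun g => (map_tsum_smul l (hsum g)).symm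
    rw [h2] at h1
    exact h1
  · change ∑' n, c n • f (u * m * g * x n) = _ • σ m (∑' n, c n • f (g * x n))
    rw [(σ m).map_tsum (hsum g), ← tsum_const_smul'']
    refine tsum_congr fun n => ?_
    rw [mul_assoc _ g, hf.2, smul_comm]
    congr 1
    exact ((σ m).toLinearMap.restrictScalars ℝ).map_smul (c n) _ |>.symm

end Series

/-! ### Uniform integrability of translates -/

section UniformBound

theorem summable_abs_lp (c : lp (fun _ : ℕ => ℝ) 1) : Summable fun n => |c n| := by
  have h := (lp.memℓp c).summable (by norm_num)
  simpa using h

theorem norm_lp_one (c : lp (fun _ : ℕ => ℝ) 1) : ‖c‖ = ∑' n, |c n| := by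
  rw [lp.norm_eq_tsum_rpow (by norm_num)]
  simp

/-- If all absolutely convergent series in `z n` are integrable, the `z n` are bounded in mean. -/
theorem exists_bound_integral_norm {Ω : Type*} [MeasurableSpace Ω] {μ : Measure Ω}
    {z : ℕ → Ω → ℂ} (hz : ∀ t, ∃ C, ∀ n, ‖z n t‖ ≤ C)
    (hint : ∀ c : ℕ → ℝ, (Summable fun n => |c n|) → Integrable (fun t => ∑' n, c n • z n t) μ) :
    ∃ B, ∀ n, ∫ t, ‖z n t‖ ∂μ ≤ B := by
  choose C hC using hz
  have hle : ∀ (c : lp (fun _ : ℕ => ℝ) 1) t n, ‖c n • z n t‖ ≤ |c n| * C t := fun c t n => by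
    rw [norm_smul, Real.norm_eq_abs]
    exact mul_le_mul_of_nonneg_left (hC t n) (abs_nonneg _)
  have hsum : ∀ (c : lp (fun _ : ℕ => ℝ) 1) t, Summable fun n => c n • z n t := fun c t =>
    Summable.of_norm_bounded ((summable_abs_lp c).mul_right (C t)) (hle c t)
  let S : lp (fun _ : ℕ => ℝ) 1 → Ω → ℂ := fun c t => ∑' n, c n • z n t
  have hS : ∀ c, Integrable (S c) μ := fun c => hint c (summable_abs_lp c)
  have hadd : ∀ c d, S (c + d) = S c + S d := fun c d => funext fun t => by
    rw [Pi.add_apply, ← (hsum c t).tsum_add (hsum d t)]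
    exact tsum_congr fun n => by rw [lp.coeFn_add, Pi.add_apply, add_smul]
  have hsmul : ∀ (a : ℝ) c, S (a • c) = a • S c := fun a c => funext fun t => by
    rw [Pi.smul_apply, ← tsum_const_smul'']
    exact tsum_congr fun n => by rw [lp.coeFn_smul, Pi.smul_apply, smul_assoc]
  have hbound : ∀ c t, ‖S c t‖ ≤ ‖c‖ * C t := fun c t => by
    rw [norm_lp_one, ← tsum_mul_right]
    exact tsum_of_norm_bounded ((summable_abs_lp c).mul_right (C t)).hasSum (hle c t)
  have hcont : ∀ (u : ℕ → lp (fun _ : ℕ => ℝ) 1) c, Filter.Tendsto u Filter.atTop (𝓝 c) →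
      ∀ t, Filter.Tendsto (fun j => S (u j) t) Filter.atTop (𝓝 (S c t)) := by
    intro u c hu t
    rw [tendsto_iff_norm_sub_tendsto_zero] at hu ⊢
    refine squeeze_zero (fun j => norm_nonneg _) (fun j => ?_)
      (by simpa using hu.mul_const (C t))
    have h1 := hadd (u j - c) c
    rw [sub_add_cancel] at h1
    rw [h1, Pi.add_apply, add_sub_cancel_right]
    exact hbound _ _
  let T : lp (fun _ : ℕ => ℝ) 1 →ₗ[ℝ] Lp ℂ 1 μ :=
    { toFun := fun c => (hS c).toL1 (S c)
      map_add' := fun c d => by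
        rw [← Integrable.toL1_add]
        exact (Integrable.toL1_eq_toL1_iff _ _ _ _).mpr (Filter.EventuallyEq.of_eq (hadd c d))
      map_smul' := fun a c => by
        rw [RingHom.id_apply, ← Integrable.toL1_smul]
        exact (Integrable.toL1_eq_toL1_iff _ _ _ _).mpr (Filter.EventuallyEq.of_eq (hsmul a c)) }
  have hT : Continuous T := by
    -- An L¹-convergent sequence has a subsequence converging almost everywhere, and the series
    -- converge pointwise to `S c`; so the L¹-limit is `T c`.
    refine LinearMap.continuous_of_seq_closed_graph T fun u c y hu hy => ?_
    obtain ⟨ns, hns, hae⟩ := (tendstoInMeasure_of_tendsto_Lp hy).exists_seq_tendsto_ae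
    refine Lp.ext ?_
    have h1 : ∀ᵐ t ∂μ, ∀ j, (T (u j)) t = S (u j) t :=
      ae_all_iff.mpr fun j => (hS (u j)).coeFn_toL1
    have h2 : (T c : Ω → ℂ) =ᵐ[μ] S c := (hS c).coeFn_toL1
    filter_upwards [hae, h1, h2] with t h3 h4 h5
    rw [h5]
    refine tendsto_nhds_unique h3 ?_
    simp only [Function.comp_apply, h4]
    exact (hcont u c hu t).comp hns.tendsto_atTop
  let T' : lp (fun _ : ℕ => ℝ) 1 →L[ℝ] Lp ℂ 1 μ := ⟨T, hT⟩
  refine ⟨‖T'‖, fun n => ?_⟩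
  -- The n-th unit vector of ℓ¹ has norm 1 and is sent to `z n`.
  have h1 := T'.le_opNorm (lp.single 1 n 1)
  rw [lp.norm_single (by norm_num), norm_one, mul_one] at h1
  refine le_trans (le_of_eq ?_) h1
  have h2 : S (lp.single 1 n 1) = z n := funext fun t => by
    change ∑' i, (lp.single 1 n 1 : lp (fun _ : ℕ => ℝ) 1) i • z i t = _
    rw [tsum_eq_single n fun i hi => by rw [lp.single_apply_ne _ _ _ hi, zero_smul]]
    rw [lp.single_apply_self, one_smul]
  change _ = ‖(hS (lp.single 1 n 1)).toL1 (S (lp.single 1 n 1))‖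
  rw [L1.norm_of_fun_eq_integral_norm]
  simp only [h2]

variable {k k₁ : ℕ} {F : Type*} [RCLike F]
  {V : Type*} [AddCommGroup V] [Module ℂ V] [UniformSpace V] [IsUniformAddGroup V]
  [ContinuousSMul ℂ V] [LocallyConvexSpace ℝ V] [T2Space V] [CompleteSpace V]
  {σ : levi k k₁ F →* (V →L[ℂ] V)} {μU : Measure (unip k k₁ F (-1))}

/-- The absolutely convergent intertwining integrals are bounded uniformly on compact sets. -/
theorem exists_bound_intertwining (hJ : IntertwiningConverges σ μU) {f : C(Sp k F, V)}
    (hf : f ∈ smoothInd σ 1) {l : V →L[ℂ] ℂ} (hl : IsFiniteFunctional σ (leviCompact k k₁ F) l)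
    {C : Set (Sp k F)} (hC : IsCompact C) :
    ∃ B, ∀ x ∈ C, ∫ u : unip k k₁ F (-1), ‖l (f (u * x))‖ ∂μU ≤ B := by
  by_contra! h
  -- Points of C where the integral exceeds n. Along a convergent subsequence the ℓ¹-combinations of
  -- translates of f stay in Ind_P^G σ, so their intertwining integrals converge absolutely.
  choose x hxC hx using fun n : ℕ => h n
  obtain ⟨x₀, -, φ, hφ, hlim⟩ := hC.tendsto_subseq hxC
  obtain ⟨B, hB⟩ := exists_bound_integral_norm (μ := μU)
    (z := fun n (u : unip k k₁ F (-1)) => l (f (u * x (φ n)))) (fun u => by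
      obtain ⟨D, hD⟩ := (hC.image (l.continuous.comp
        (f.continuous.comp (continuous_const_mul (u : Sp k F))))).isBounded.exists_norm_le
      exact ⟨D, fun n => hD _ ⟨_, hxC (φ n), rfl⟩⟩) (fun c hc => by
      obtain ⟨Ψ, hΨ, hΨe⟩ := exists_tsum_mem_smoothInd hf hc hlim
      obtain ⟨Φ, -, hΦ⟩ := hJ Ψ hΨ
      refine (hΦ 1 l hl).1.congr (Filter.Eventually.of_forall fun u => ?_)
      simp only [mul_one]
      rw [hΨe, map_tsum_smul l (summable_smul_translate f hc hlim u)]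
      rfl)
  obtain ⟨n, hn⟩ := exists_nat_gt B
  have h1 := hx (φ n)
  have h2 : (n : ℝ) ≤ φ n := by exact_mod_cast hφ.id_le n
  linarith [hB n]

end UniformBound

/-! ### `K ∩ M`-finite functionals separate points -/

section Separation

variable {k k₁ : ℕ} {F : Type*} [RCLike F]

/-- Right translation of a function on `K ∩ M`. -/
def translateFun (c : leviCompact k k₁ F) (β : C(leviCompact k k₁ F, ℝ)) :
    C(leviCompact k k₁ F, ℝ) := β.comp ⟨fun x => x * c, continuous_mul_const c⟩

/-- The algebra of functions on `K ∩ M` whose right translates span a finite-dimensional space. -/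
def translationFinite (k k₁ : ℕ) (F : Type*) [RCLike F] :
    Subalgebra ℝ C(leviCompact k k₁ F, ℝ) where
  carrier := {β | ∃ W : Submodule ℝ C(leviCompact k k₁ F, ℝ), W.FG ∧ ∀ c, translateFun c β ∈ W}
  mul_mem' := by
    rintro β γ ⟨W, hW, hβ⟩ ⟨W', hW', hγ⟩
    exact ⟨W * W', hW.mul hW', fun c => Submodule.mul_mem_mul (hβ c) (hγ c)⟩
  add_mem' := by
    rintro β γ ⟨W, hW, hβ⟩ ⟨W', hW', hγ⟩
    exact ⟨W ⊔ W', hW.sup hW', fun c => add_mem (Submodule.mem_sup_left (hβ c))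
      (Submodule.mem_sup_right (hγ c))⟩
  algebraMap_mem' r := ⟨Submodule.span ℝ {algebraMap ℝ _ r}, Submodule.fg_span_singleton _,
    fun c => Submodule.subset_span rfl⟩

theorem continuous_leviCompact_entry (i j : Fin k ⊕ Fin k) :
    Continuous fun c : leviCompact k k₁ F => mat ((c : levi k k₁ F) : Sp k F) i j :=
  (continuous_entry i j).comp (continuous_subtype_val.comp continuous_subtype_val)

/-- The real part of a matrix entry, as a function on `K ∩ M`. -/
def reEntry (i j : Fin k ⊕ Fin k) : C(leviCompact k k₁ F, ℝ) :=
  ⟨fun c => RCLike.re (mat ((c : levi k k₁ F) : Sp k F) i j),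
    RCLike.continuous_re.comp (continuous_leviCompact_entry i j)⟩

/-- The imaginary part of a matrix entry, as a function on `K ∩ M`. -/
def imEntry (i j : Fin k ⊕ Fin k) : C(leviCompact k k₁ F, ℝ) :=
  ⟨fun c => RCLike.im (mat ((c : levi k k₁ F) : Sp k F) i j),
    RCLike.continuous_im.comp (continuous_leviCompact_entry i j)⟩

theorem reEntry_mul (i j : Fin k ⊕ Fin k) (x c : leviCompact k k₁ F) :
    reEntry i j (x * c) = ∑ a, (reEntry a j c * reEntry i a x - imEntry a j c * imEntry i a x) := by
  change RCLike.re (∑ a, mat ((x : levi k k₁ F) : Sp k F) i a *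
    mat ((c : levi k k₁ F) : Sp k F) a j) = _
  rw [map_sum]
  refine Finset.sum_congr rfl fun a _ => ?_
  rw [RCLike.mul_re, mul_comm, mul_comm (RCLike.im _)]
  rfl

theorem imEntry_mul (i j : Fin k ⊕ Fin k) (x c : leviCompact k k₁ F) :
    imEntry i j (x * c) = ∑ a, (imEntry a j c * reEntry i a x + reEntry a j c * imEntry i a x) := by
  change RCLike.im (∑ a, mat ((x : levi k k₁ F) : Sp k F) i a *
    mat ((c : levi k k₁ F) : Sp k F) a j) = _
  rw [map_sum]
  refine Finset.sum_congr rfl fun a _ => ?_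
  rw [RCLike.mul_im]
  exact congrArg₂ (· + ·) (mul_comm _ _) (mul_comm _ _)

theorem reEntry_mem (i j : Fin k ⊕ Fin k) :
    (reEntry i j : C(leviCompact k k₁ F, ℝ)) ∈ translationFinite k k₁ F := by
  refine ⟨Submodule.span ℝ (Set.range (reEntry i) ∪ Set.range (imEntry i)),
    Submodule.fg_span ((Set.finite_range _).union (Set.finite_range _)), fun c => ?_⟩
  have key : translateFun c (reEntry i j : C(leviCompact k k₁ F, ℝ)) =
      ∑ a, (reEntry a j c • reEntry i a - imEntry a j c • imEntry i a) := by
    ext x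
    refine (reEntry_mul i j x c).trans ?_
    simp only [ContinuousMap.coe_sum, Finset.sum_apply, ContinuousMap.coe_sub, Pi.sub_apply,
      ContinuousMap.coe_smul, Pi.smul_apply, smul_eq_mul]
  rw [key]
  exact Submodule.sum_mem _ fun a _ => sub_mem
    (Submodule.smul_mem _ _ (Submodule.subset_span (Or.inl ⟨a, rfl⟩)))
    (Submodule.smul_mem _ _ (Submodule.subset_span (Or.inr ⟨a, rfl⟩)))

theorem imEntry_mem (i j : Fin k ⊕ Fin k) :
    (imEntry i j : C(leviCompact k k₁ F, ℝ)) ∈ translationFinite k k₁ F := by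
  refine ⟨Submodule.span ℝ (Set.range (reEntry i) ∪ Set.range (imEntry i)),
    Submodule.fg_span ((Set.finite_range _).union (Set.finite_range _)), fun c => ?_⟩
  have key : translateFun c (imEntry i j : C(leviCompact k k₁ F, ℝ)) =
      ∑ a, (imEntry a j c • reEntry i a + reEntry a j c • imEntry i a) := by
    ext x
    refine (imEntry_mul i j x c).trans ?_
    simp only [ContinuousMap.coe_sum, Finset.sum_apply, ContinuousMap.coe_add, Pi.add_apply,
      ContinuousMap.coe_smul, Pi.smul_apply, smul_eq_mul]
  rw [key]
  exact Submodule.sum_mem _ fun a _ => add_mem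
    (Submodule.smul_mem _ _ (Submodule.subset_span (Or.inl ⟨a, rfl⟩)))
    (Submodule.smul_mem _ _ (Submodule.subset_span (Or.inr ⟨a, rfl⟩)))

/-- Stone–Weierstrass: real and imaginary parts of matrix entries are translation-finite and
separate the points of K ∩ M. -/
theorem translationFinite_closure :
    (translationFinite k k₁ F).topologicalClosure = ⊤ := by
  refine ContinuousMap.subalgebra_topologicalClosure_eq_top_of_separatesPoints _ ?_
  intro x y hxy
  by_contra! h
  refine hxy (Subtype.ext (Subtype.ext (Subtype.ext (Matrix.ext fun i j => ?_))))
  exact RCLike.ext (h _ ⟨_, reEntry_mem i j, rfl⟩) (h _ ⟨_, imEntry_mem i j, rfl⟩)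

/-- A continuous function orthogonal to all translation-finite functions vanishes. -/
theorem eq_zero_of_integral_translationFinite {φ : leviCompact k k₁ F → ℂ} (hφ : Continuous φ)
    (h : ∀ β ∈ translationFinite k k₁ F, ∫ c, (β c : ℂ) * φ c ∂leviCompactHaar k k₁ F = 0) :
    φ = 0 := by
  have hall : ∀ β : C(leviCompact k k₁ F, ℝ),
      ∫ c, (β c : ℂ) * φ c ∂leviCompactHaar k k₁ F = 0 := by
    obtain ⟨L, hL⟩ := exists_integral_functional (leviCompactHaar k k₁ F)
      (E := C(leviCompact k k₁ F, ℂ)) (fun c => φ c • ContinuousMap.evalCLM ℂ c)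
      ((hφ.comp continuous_fst).smul (continuous_snd.eval continuous_fst))
    let R : C(leviCompact k k₁ F, ℝ) → C(leviCompact k k₁ F, ℂ) := fun β =>
      ContinuousMap.comp ⟨_, Complex.continuous_ofReal⟩ β
    have hR : Continuous R := ContinuousMap.continuous_postcomp _
    have hLR : ∀ β, L (R β) = ∫ c, (β c : ℂ) * φ c ∂leviCompactHaar k k₁ F := fun β => by
      rw [hL]
      refine integral_congr_ae (Filter.Eventually.of_forall fun c => ?_)
      exact mul_comm _ _
    intro β
    have hcl : IsClosed {β | L (R β) = 0} := isClosed_eq (L.continuous.comp hR) continuous_const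
    have hsub : closure (translationFinite k k₁ F : Set C(leviCompact k k₁ F, ℝ)) ⊆
        {β | L (R β) = 0} := closure_minimal (fun β hβ => (hLR β).trans (h β hβ)) hcl
    have hmem : β ∈ (translationFinite k k₁ F).topologicalClosure := by
      rw [translationFinite_closure]; trivial
    rw [← hLR]
    exact hsub hmem
  have hreal : ∀ ψ : leviCompact k k₁ F → ℝ, Continuous ψ →
      (∫ c, ψ c * ψ c ∂leviCompactHaar k k₁ F = 0) → ψ = 0 := by
    intro ψ hψ h0
    have hc : Continuous fun c => ψ c * ψ c := hψ.mul hψ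
    by_contra hne
    obtain ⟨c, hc0⟩ := Function.ne_iff.mp hne
    have := hc.integral_pos_of_hasCompactSupport_nonneg_nonzero
      (μ := leviCompactHaar k k₁ F) (x := c) (HasCompactSupport.of_compactSpace _)
      (fun c => mul_self_nonneg _) (by simpa using hc0)
    exact this.ne' h0
  have hint : ∀ β : C(leviCompact k k₁ F, ℝ),
      Integrable (fun c => (β c : ℂ) * φ c) (leviCompactHaar k k₁ F) := fun β =>
    integrable_leviCompactHaar (by fun_prop)
  -- Testing against the real part of φ itself gives ∫ (Re φ)² = 0; the imaginary part is treated in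
  -- the same way.
  have hre : (fun c => (φ c).re) = 0 := by
    refine hreal _ (by fun_prop) ?_
    have h1 := hall ⟨fun c => (φ c).re, by fun_prop⟩
    have h2 := congrArg Complex.re h1
    rw [← Complex.reCLM_apply, ← ContinuousLinearMap.integral_comp_comm _ (hint _)] at h2
    simpa using h2
  have him : (fun c => (φ c).im) = 0 := by
    refine hreal _ (by fun_prop) ?_
    have h1 := hall ⟨fun c => (φ c).im, by fun_prop⟩
    have h2 := congrArg Complex.im h1
    rw [← Complex.imCLM_apply, ← ContinuousLinearMap.integral_comp_comm _ (hint _)] at h2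
    simpa using h2
  funext c
  exact Complex.ext (congrFun hre c) (congrFun him c)

variable {V : Type*} [AddCommGroup V] [Module ℂ V] [UniformSpace V] [IsUniformAddGroup V]
  [ContinuousSMul ℂ V] [LocallyConvexSpace ℝ V] [T2Space V]
  {σ : levi k k₁ F →* (V →L[ℂ] V)}

/-- For translation-finite β the functional x ↦ ∫ β(c) l(σ(c) x) dc is K ∩ M-finite. If all these
vanish at v, the function c ↦ l(σ(c) v) is orthogonal to a dense algebra, hence zero; at c = 1 this
reads l v = 0 for arbitrary l. -/
theorem eq_zero_of_finite_functionals (hσ : IsContRep σ) {v : V}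
    (h : ∀ l : V →L[ℂ] ℂ, IsFiniteFunctional σ (leviCompact k k₁ F) l → l v = 0) : v = 0 := by
  refine eq_zero_of_forall_functional fun l => ?_
  have hσc : Continuous fun p : leviCompact k k₁ F × V => σ p.1 p.2 :=
    hσ.comp ((continuous_subtype_val.comp continuous_fst).prodMk continuous_snd)
  have hlc : ∀ x, Continuous fun c : leviCompact k k₁ F => l (σ c x) := fun x =>
    l.continuous.comp (hσc.comp (Continuous.prodMk_left x))
  have hex : ∀ β : C(leviCompact k k₁ F, ℝ), ∃ lam : V →L[ℂ] ℂ, ∀ x,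
      lam x = ∫ c : leviCompact k k₁ F, (β c : ℂ) * l (σ c x) ∂leviCompactHaar k k₁ F := fun β => by
    obtain ⟨lam, hlam⟩ := exists_integral_functional (leviCompactHaar k k₁ F)
      (fun c : leviCompact k k₁ F => (β c : ℂ) • l.comp (σ c))
      ((Complex.continuous_ofReal.comp (β.continuous.comp continuous_fst)).smul
        (l.continuous.comp hσc))
    exact ⟨lam, fun x => by rw [hlam]; simp⟩
  choose lam hlam using hex
  have hint : ∀ (β : C(leviCompact k k₁ F, ℝ)) x, Integrable (fun c : leviCompact k k₁ F => (β c : ℂ) * l (σ c x))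
      (leviCompactHaar k k₁ F) := fun β x =>
    integrable_leviCompactHaar ((Complex.continuous_ofReal.comp (map_continuous β)).mul (hlc x))
  have hadd : ∀ β γ, lam (β + γ) = lam β + lam γ := fun β γ => by
    ext x
    rw [_root_.add_apply, hlam, hlam, hlam, ← integral_add (hint β x) (hint γ x)]
    refine integral_congr_ae (Filter.Eventually.of_forall fun c => ?_)
    simp [add_mul]
  have hsmul : ∀ (r : ℝ) β, lam (r • β) = (r : ℂ) • lam β := fun r β => by
    ext x
    rw [_root_.smul_apply, hlam, hlam, smul_eq_mul, ← integral_const_mul]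
    refine integral_congr_ae (Filter.Eventually.of_forall fun c => ?_)
    simp [mul_assoc]
  have hfin : ∀ β ∈ translationFinite k k₁ F,
      IsFiniteFunctional σ (leviCompact k k₁ F) (lam β) := by
    rintro β ⟨W, ⟨t, rfl⟩, ht⟩
    refine isFiniteFunctional_of_sum (fun γ : t => lam γ) fun x => ?_
    have h1 : (lam β).comp (σ x) = lam (translateFun x⁻¹ β) := by
      ext y
      rw [ContinuousLinearMap.comp_apply, hlam, hlam,
        ← integral_mul_right_eq_self _ (x⁻¹ : leviCompact k k₁ F)]
      refine integral_congr_ae (Filter.Eventually.of_forall fun c => ?_)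
      have h2 : σ ((c * x⁻¹ : leviCompact k k₁ F) : levi k k₁ F) (σ x y) = σ c y := by
        rw [← mul_apply_eq_comp, ← map_mul, Subgroup.coe_mul, mul_assoc,
          ← Subgroup.coe_mul, inv_mul_cancel]
        simp
      simp only [h2]
      rfl
    rw [h1]
    have hspan : ∀ γ ∈ Submodule.span ℝ (t : Set C(leviCompact k k₁ F, ℝ)),
        lam γ ∈ Submodule.span ℂ (Set.range fun γ : t => lam γ) := by
      intro γ hγ
      induction hγ using Submodule.span_induction with
      | mem γ hγ => exact Submodule.subset_span ⟨⟨γ, hγ⟩, rfl⟩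
      | zero =>
        have h0 := hadd 0 0
        rw [add_zero, left_eq_add] at h0
        rw [h0]; exact zero_mem _
      | add a b _ _ ha hb => rw [hadd]; exact add_mem ha hb
      | smul r a _ ha => rw [hsmul]; exact Submodule.smul_mem _ _ ha
    exact hspan _ (ht x⁻¹)
  have h0 : (fun c : leviCompact k k₁ F => l (σ c v)) = 0 :=
    eq_zero_of_integral_translationFinite (hlc v) fun β hβ => by
      rw [← hlam]; exact h _ (hfin β hβ)
  simpa using congrFun h0 1

end Separation

/-! ### The integral of a kernel as a coefficient of the image of the intertwining operator -/

section Coefficient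

variable {k k₁ : ℕ} {F : Type*} [RCLike F]
  {V : Type*} [AddCommGroup V] [Module ℂ V] [UniformSpace V] [IsUniformAddGroup V]
  [ContinuousSMul ℂ V] [LocallyConvexSpace ℝ V] [T2Space V] [CompleteSpace V]
  {σ : levi k k₁ F →* (V →L[ℂ] V)} {n : ℕ}
  {μU : Measure (unip k k₁ F (-1))} [μU.IsHaarMeasure]
  {μK : Measure (maxCompact k F)} [μK.IsHaarMeasure]

theorem integrable_prod_intertwining (hJ : IntertwiningConverges σ μU) {f Φ : C(Sp k F, V)}
    (hf : f ∈ smoothInd σ 1) (hΦ : IsIntertwiningIntegral σ μU f Φ) {l : V →L[ℂ] ℂ}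
    (hl : IsFiniteFunctional σ (leviCompact k k₁ F) l) {β : maxCompact k F → ℂ}
    (hβ : Continuous β) (g : Sp k F) :
    Integrable (fun p : unip k k₁ F (-1) × maxCompact k F => β p.2 * l (f (p.1 * p.2 * g)))
        (μU.prod μK) ∧
      ∫ p : unip k k₁ F (-1) × maxCompact k F, β p.2 * l (f (p.1 * p.2 * g)) ∂(μU.prod μK) =
        ∫ x : maxCompact k F, β x * l (Φ (x * g)) ∂μK := by
  have hcont : Continuous fun p : unip k k₁ F (-1) × maxCompact k F =>
      β p.2 * l (f (p.1 * p.2 * g)) := by fun_prop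
  have hmeas : AEStronglyMeasurable (fun p : unip k k₁ F (-1) × maxCompact k F =>
      β p.2 * l (f (p.1 * p.2 * g))) (μU.prod μK) := hcont.aestronglyMeasurable
  have hu : ∀ x : maxCompact k F,
      Integrable (fun u : unip k k₁ F (-1) => l (f (u * x * g))) μU := fun x => by
    simpa only [mul_assoc] using (hΦ (x * g) l hl).1
  have hint : Integrable (fun p : unip k k₁ F (-1) × maxCompact k F =>
      β p.2 * l (f (p.1 * p.2 * g))) (μU.prod μK) := by
    refine (integrable_prod_iff' hmeas).mpr
      ⟨Filter.Eventually.of_forall fun x => (hu x).const_mul (β x), ?_⟩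
    -- The convergence at each x separately does not suffice for the product; the bound on the
    -- compact set K g makes the inner integrals integrable over K.
    obtain ⟨B, hB⟩ := exists_bound_intertwining hJ hf hl
      ((isCompact_maxCompact k).image (continuous_mul_const g))
    obtain ⟨D, hD⟩ := (isCompact_range hβ).isBounded.exists_norm_le
    refine Integrable.of_bound (C := D * B) hmeas.norm.prod_swap.integral_prod_right'
      (Filter.Eventually.of_forall fun x => ?_)
    simp only [norm_mul]
    rw [integral_const_mul, norm_mul, norm_norm, Real.norm_eq_abs,
      abs_of_nonneg (integral_nonneg fun _ => norm_nonneg _)]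
    have h1 := hB _ ⟨x, x.2, rfl⟩
    simp only [← mul_assoc] at h1
    exact mul_le_mul (hD _ ⟨x, rfl⟩) h1 (integral_nonneg fun _ => norm_nonneg _)
      ((norm_nonneg _).trans (hD _ ⟨x, rfl⟩))
  refine ⟨hint, ?_⟩
  rw [integral_prod_symm _ hint]
  refine integral_congr_ae (Filter.Eventually.of_forall fun x => ?_)
  simp only
  rw [integral_const_mul, (hΦ (x * g) l hl).2]
  simp only [mul_assoc]

/-- The functional `Φ ↦ ∫_K B_{pi}(x) l(Φ(x)) dx` on the image of the intertwining operator. -/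
theorem exists_compact_functional (μU : Measure (unip k k₁ F (-1))) (μK : Measure (maxCompact k F))
    [μK.IsHaarMeasure] (b : KernelBasis σ n) (i : Fin n) (l : V →L[ℂ] ℂ) :
    ∃ lam : Fin n → imageJ σ μU →L[ℂ] ℂ,
      (∀ p, IsFiniteFunctional (imageRep σ μU) (maxCompact k F) (lam p)) ∧
      ∀ p (Φ : imageJ σ μU), lam p Φ = ∫ x : maxCompact k F, b.B p i x * l (Φ.1 x) ∂μK := by
  have hBc : ∀ p, Continuous fun x : maxCompact k F => b.B p i x := fun p =>
    (b.continuous_B p i).comp continuous_subtype_val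
  have hex : ∀ p, ∃ lam : imageJ σ μU →L[ℂ] ℂ,
      ∀ Φ : imageJ σ μU, lam Φ = ∫ x : maxCompact k F, b.B p i x * l (Φ.1 x) ∂μK := fun p => by
    have hev : Continuous fun q : maxCompact k F × imageJ σ μU => l (q.2.1 q.1) :=
      l.continuous.comp ((continuous_subtype_val.comp continuous_snd).eval
        (continuous_subtype_val.comp continuous_fst))
    obtain ⟨lam, hlam⟩ := exists_integral_functional μK
      (fun x : maxCompact k F => b.B p i x •
        (l.comp ((ContinuousMap.evalCLM ℂ (x : Sp k F)).comp (imageJ σ μU).subtypeL)))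
      (((hBc p).comp continuous_fst).smul hev)
    exact ⟨lam, fun Φ => (hlam Φ).trans rfl⟩
  choose lam hlam using hex
  refine ⟨lam, fun p => isFiniteFunctional_of_sum lam fun x => ?_, hlam⟩
  -- Substituting y x⁻¹ for y moves the translation onto B, where it acts on the first index only; i
  -- stays fixed, so the finite family `lam` spans a stable space.
  have : (lam p).comp (imageRep σ μU x) =
      ∑ s, b.B p s (x⁻¹ : maxCompact k F) • lam s := by
    haveI := isMulRightInvariant_maxCompact μK
    ext Φ
    have hc : ∀ s, Continuous fun y : maxCompact k F => b.B s i y * l (Φ.1 y) := fun s =>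
      (hBc s).mul (l.continuous.comp (Φ.1.continuous.comp continuous_subtype_val))
    have hint : ∀ s, Integrable (fun y : maxCompact k F => b.B s i y * l (Φ.1 y)) μK := fun s => by
      obtain ⟨C, hC⟩ := (isCompact_range (hc s)).isBounded.exists_norm_le
      exact Integrable.of_bound (hc s).aestronglyMeasurable_of_compactSpace C
        (Filter.Eventually.of_forall fun q => hC _ ⟨q, rfl⟩)
    rw [ContinuousLinearMap.comp_apply, hlam, ← integral_mul_right_eq_self _ x⁻¹]
    simp only [_root_.sum_apply, _root_.smul_apply, hlam, smul_eq_mul, ← integral_const_mul]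
    rw [← integral_finsetSum _ fun s _ => (hint s).const_mul _]
    refine integral_congr_ae (Filter.Eventually.of_forall fun y => ?_)
    have h1 := b.B_mul p i y x⁻¹
    have h2 : (imageRep σ μU x Φ).1 (y * x⁻¹ : maxCompact k F) = Φ.1 y := by
      change Φ.1 ((y * x⁻¹ : maxCompact k F) * (x : Sp k F)) = Φ.1 y
      simp
    simp only [h2]
    rw [Subgroup.coe_mul, h1, Finset.sum_mul]
    exact Finset.sum_congr rfl fun s _ => mul_assoc _ _ _
  rw [this]
  exact Submodule.sum_mem _ fun s _ => Submodule.smul_mem _ _ (Submodule.subset_span ⟨s, rfl⟩)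

/-- The intertwining integrals of the sections `sectionMap` are `K`-finite. -/
theorem intertwining_sectionMap_translate {b : KernelBasis σ n} {w : Fin n → V}
    (hσ : IsContRep σ)
    (hw : ∀ r (c : leviCompact k k₁ F), σ c (w r) = ∑ s, b.A r s (c : levi k k₁ F) • w s)
    {Φ : Fin n → C(Sp k F, V)}
    (hΦ : ∀ i, IsIntertwiningIntegral σ μU (sectionMap hσ b w i) (Φ i)) (i : Fin n)
    (x : maxCompact k F) (g : Sp k F) : Φ i (g * x) = ∑ s, b.A i s x • Φ s g := by
  -- The values of `Φ i` are known only through K ∩ M-finite functionals. After pairing, the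
  -- relation is the integral over Ū of the one satisfied by the sections.
  refine sub_eq_zero.mp (eq_zero_of_finite_functionals hσ fun l hl => ?_)
  rw [map_sub, map_sum, (hΦ i (g * x) l hl).2]
  simp only [map_smul, (hΦ _ g l hl).2, smul_eq_mul, ← integral_const_mul]
  rw [← integral_finsetSum _ fun s _ => ((hΦ s g l hl).1).const_mul _, sub_eq_zero]
  refine integral_congr_ae (Filter.Eventually.of_forall fun u => ?_)
  have h1 := sectionFun_mul_maxCompact hw i ((u : Sp k F) * g) x
  simp only [← mul_assoc]
  change l (sectionFun b w i _) = _
  rw [h1, map_sum]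
  simp only [map_smul, smul_eq_mul]
  rfl

/-- The integral of a kernel over `Ū × K` converges absolutely, and is a `K`-finite coefficient of
the image of the intertwining operator. -/
theorem IsCoeffKernel.integrable_and_mem (hσ : IsContRep σ) (hσ' : IsSmoothRep σ)
    (hJ : IntertwiningConverges σ μU) {H : Sp k F → Sp k F → ℂ} (hH : IsCoeffKernel σ H) :
    (∀ g : Sp k F, Integrable
        (fun p : unip k k₁ F (-1) × maxCompact k F => H (p.1 * p.2 * g) p.2) (μU.prod μK)) ∧
      (fun g => ∫ p : unip k k₁ F (-1) × maxCompact k F, H (p.1 * p.2 * g) p.2 ∂(μU.prod μK)) ∈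
        finiteCoefficients (imageRep σ μU) (maxCompact k F) := by
  obtain ⟨n, b, a, hHb⟩ := hH.exists_kernelBasis
  obtain ⟨ι, _, ℓ, w, hℓ, hw, hb⟩ := b.exists_matrix_coefficients hσ
  have hmem : ∀ J i, sectionMap hσ b (fun r => w r J) i ∈ smoothInd σ 1 := fun J i =>
    sectionMap_mem_smoothInd hσ hσ' (fun r c => hw r J c) i
  choose Φ hΦ hΦJ using fun J i => hJ _ (hmem J i)
  let Φ' : ι → Fin n → imageJ σ μU := fun J i => ⟨Φ J i, hΦ J i, _, hmem J i, hΦJ J i⟩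
  choose lam hlamfin hlam using fun J i => exists_compact_functional μU μK b i (ℓ J)
  have hBc : ∀ p i, Continuous fun x : maxCompact k F => b.B p i x := fun p i =>
    (b.continuous_B p i).comp continuous_subtype_val
  -- Moving the second variable from k to 1 brings out the matrix B(k); at second variable 1 the
  -- kernel is a sum of functionals applied to sections.
  have hexp : ∀ (g : Sp k F) (p : unip k k₁ F (-1) × maxCompact k F), H (p.1 * p.2 * g) p.2 =
      ∑ q, ∑ i, ∑ J, a q * (b.B q i p.2 *
        ℓ J (sectionMap hσ b (fun r => w r J) i (p.1 * p.2 * g))) := by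
    intro g p
    rw [hHb]
    refine Finset.sum_congr rfl fun q _ => ?_
    have h1 := b.translate_B q p.2 (p.1 * p.2 * g) 1
    rw [one_mul] at h1
    rw [h1, Finset.mul_sum]
    refine Finset.sum_congr rfl fun i _ => ?_
    rw [KernelBasis.h_eq_sum_sectionFun hb, Finset.mul_sum, Finset.mul_sum]
    rfl
  have hint := fun q i J g => integrable_prod_intertwining (μK := μK) hJ (hmem J i) (hΦJ J i)
    (hℓ J) (hBc q i) g
  have hvec : ∀ J i, IsFiniteVec (imageRep σ μU) (maxCompact k F) (Φ' J i) := fun J i => by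
    refine isFiniteVec_of_sum (Φ' J) fun x => ?_
    have h1 : imageRep σ μU x (Φ' J i) = ∑ s, b.A i s x • Φ' J s := by
      refine Subtype.ext (ContinuousMap.ext fun g => ?_)
      change Φ J i (g * x) = _
      rw [intertwining_sectionMap_translate hσ (fun r c => hw r J c) (hΦJ J) i x g]
      simp [Φ']
    rw [h1]
    exact Submodule.sum_mem _ fun s _ => Submodule.smul_mem _ _ (Submodule.subset_span ⟨s, rfl⟩)
  constructor
  · intro g
    simp only [hexp]
    exact integrable_finsetSum _ fun q _ => integrable_finsetSum _ fun i _ =>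
      integrable_finsetSum _ fun J _ => (hint q i J g).1.const_mul _
  · have hval : (fun g => ∫ p : unip k k₁ F (-1) × maxCompact k F,
        H (p.1 * p.2 * g) p.2 ∂(μU.prod μK)) =
        ∑ q, ∑ i, ∑ J, a q • fun g => lam J i q (imageRep σ μU g (Φ' J i)) := by
      funext g
      simp only [hexp, Finset.sum_apply, Pi.smul_apply, smul_eq_mul]
      rw [integral_finsetSum _ fun q _ => integrable_finsetSum _ fun i _ =>
        integrable_finsetSum _ fun J _ => (hint q i J g).1.const_mul _]
      refine Finset.sum_congr rfl fun q _ => ?_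
      rw [integral_finsetSum _ fun i _ =>
        integrable_finsetSum _ fun J _ => (hint q i J g).1.const_mul _]
      refine Finset.sum_congr rfl fun i _ => ?_
      rw [integral_finsetSum _ fun J _ => (hint q i J g).1.const_mul _]
      refine Finset.sum_congr rfl fun J _ => ?_
      rw [integral_const_mul, (hint q i J g).2, hlam]
      rfl
    rw [hval]
    exact Submodule.sum_mem _ fun q _ => Submodule.sum_mem _ fun i _ => Submodule.sum_mem _
      fun J _ => Submodule.smul_mem _ _
        (Submodule.subset_span ⟨Φ' J i, lam J i q, hvec J i, hlamfin J i q, rfl⟩)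

theorem IsCoeffKernel.onQuot_mk {H : Sp k F → Sp k F → ℂ} (hH : IsCoeffKernel σ H) (g h : Sp k F) :
    hH.onQuot g (LeviQuot.mk k₁ h) = H (h * g) h := rfl

/-- Invariance under Ū in the second variable alone removes ū there; this identifies the integrand
on M \ G with the one on Ū × K. -/
theorem IsCoeffKernel.onQuot_mk_mul {H : Sp k F → Sp k F → ℂ} (hH : IsCoeffKernel σ H) (g : Sp k F)
    (p : unip k k₁ F (-1) × maxCompact k F) :
    hH.onQuot g (LeviQuot.mk k₁ ((p.1 : Sp k F) * p.2)) = H (p.1 * p.2 * g) p.2 := by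
  rw [hH.onQuot_mk]
  simpa using hH.invariant 1 p.1 1 (p.1 * p.2 * g) p.2

theorem IsCoeffKernel.continuous_onQuot {H : Sp k F → Sp k F → ℂ} (hH : IsCoeffKernel σ H)
    (g : Sp k F) : Continuous (hH.onQuot g) := by
  rw [LeviQuot.isOpenQuotientMap_mk.isQuotientMap.continuous_iff]
  have h1 : Continuous fun p : Sp k F × Sp k F => H p.1 p.2 :=
    hH.smooth.continuous ((continuous_entries.comp continuous_fst).prodMk
      (continuous_entries.comp continuous_snd))
  exact h1.comp ((continuous_mul_const g).prodMk continuous_id)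

end Coefficient

end SpCoeff

end

theorem lemmaL {F : Type*} [RCLike F] (k k₁ : ℕ) (hk₁ : 1 ≤ k₁) (hk : k₁ ≤ k)
    {V : Type*} [AddCommGroup V] [Module ℂ V] [UniformSpace V] [IsUniformAddGroup V]
    [ContinuousSMul ℂ V] [LocallyConvexSpace ℝ V] [T2Space V] [CompleteSpace V]
    (σ : levi k k₁ F →* (V →L[ℂ] V))
    (hσ_cont : IsContRep σ) (hσ_smooth : IsSmoothRep σ) (hσ_irr : IsIrredRep σ)
    (hσ_adm : IsAdmissibleRep σ (leviCompact k k₁ F))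
    (μU : Measure (unip k k₁ F (-1))) [μU.IsHaarMeasure]
    (μK : Measure (maxCompact k F)) [μK.IsHaarMeasure]
    (ν : Measure (LeviQuot k k₁ F)) [ν.Regular] (hν : IsRightInvariant ν) (hν0 : ν ≠ 0)
    (hJ : IntertwiningConverges σ μU) :
    ∃ c : ℝ, 0 < c ∧ ∀ (H : Sp k F → Sp k F → ℂ) (hH : IsCoeffKernel σ H),
      (∀ g : Sp k F, Integrable (hH.onQuot g) ν) ∧
      (∀ g : Sp k F, Integrable
        (fun p : unip k k₁ F (-1) × maxCompact k F => H (p.1 * p.2 * g) p.2) (μU.prod μK)) ∧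
      (∀ g : Sp k F, ∫ x, hH.onQuot g x ∂ν =
        c * ∫ p : unip k k₁ F (-1) × maxCompact k F, H (p.1 * p.2 * g) p.2 ∂(μU.prod μK)) ∧
      (fun g => ∫ x, hH.onQuot g x ∂ν) ∈ finiteCoefficients (imageRep σ μU) (maxCompact k F) := by
  -- The constant comes from comparing measures alone, before any kernel is given.
  obtain ⟨c, hc0, hct, hcν⟩ := exists_eq_smul_ukMeasure μU μK ν hν hν0
  refine ⟨c.toReal, ENNReal.toReal_pos hc0 hct, fun H hH => ?_⟩
  obtain ⟨hint, hmem⟩ := hH.integrable_and_mem (μK := μK) hσ_cont hσ_smooth hJ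
  have hmap : ∀ g, ∫ x, hH.onQuot g x ∂ν = c.toReal *
      ∫ p : unip k k₁ F (-1) × maxCompact k F, H (p.1 * p.2 * g) p.2 ∂(μU.prod μK) := fun g => by
    rw [hcν, integral_smul_measure, ukMeasure, integral_map continuous_ukMap.aemeasurable
      (hH.continuous_onQuot g).aestronglyMeasurable, Complex.real_smul]
    simp only [hH.onQuot_mk_mul]
  refine ⟨fun g => ?_, hint, hmap, ?_⟩
  · rw [hcν]
    refine Integrable.smul_measure ?_ hct
    rw [ukMeasure, integrable_map_measure (hH.continuous_onQuot g).aestronglyMeasurable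
      continuous_ukMap.aemeasurable]
    exact (hint g).congr (Filter.Eventually.of_forall fun p => (hH.onQuot_mk_mul g p).symm)
  · have h := Submodule.smul_mem _ (c.toReal : ℂ) hmem
    convert h using 1
    funext g
    rw [hmap g, Pi.smul_apply, smul_eq_mul]
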